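/- **Problem (noisy linear contextual search).** Let $B=\{v\in\mathbb R^d:\|v\|_2\le 1\}$ and $0\le p<1/2$. An adversary fixes a hidden point $q_0\in B$. In each round $t=1,\dots,T$ the adversary picks a nonzero vector $x_t\in B$, which may depend on everything that happened in earlier rounds; the learner answers with a query $\hat y_t\in\mathbb R$ and incurs the loss $|\hat y_t-\langle x_t,q_0\rangle|$; the learner then receives feedback $\sigma_t\in\{-1,+1\}$, which is $\operatorname{sign}(\hat y_t-\langle x_t,q_0\rangle)$ (with the value $-1$ in case of equality), flipped with probability $p$ independently of everything else. **Algorithm (Noisy Linear Contextual Search).** Put $\eta=\frac1{2d^{10}}$, $\beta_i=2^{-100di}$ and $\gamma_i=2^{-i}$. For each integer $i\ge1$ keep a probability density $w_i$ on $B$, initially uniform, and a counter $C_i$, initially $0$; put $C_0=0$. In round $t$, given $x_t$: 1. Let $i_t$ be the largest index $i\ge 1$ such that at least one of the following holds: (a) there are $a,b\in\mathbb R$ with $|a-b|\le10\gamma_i$ and $\int_{q\in B,\ a\le\langle x_t,q\rangle\le b}w_i(q)\,dq\ge1-\gamma_i^{4d}$; (b) $C_{i-1}>100\left(\frac{d^4(i-1)}{\gamma_{i-1}^{10d}}+d^{25}(i-1)\right)$.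 2. Let $y$ be the weighted median of $w_{i_t}$ in direction $x_t$, i.e. $\int_{q\in B,\ \langle x_t,q\rangle<y}w_{i_t}(q)\,dq=\int_{q\in B,\ \langle x_t,q\rangle>y}w_{i_t}(q)\,dq=\frac12$. Query $\hat y_t=y+\delta_t$, where $\delta_t$ is uniform on $[-2\beta_{i_t},2\beta_{i_t}]$, drawn freshly and independently of the noise. 3. For each $i\in\{i_t,i_t+1\}$, multiply $w_i(q)$ by $1-\eta$ at every point $q$ that violates the feedback (i.e. $\sigma_t(\hat y_t-\langle x_t,q\rangle)<0$), and then normalize $w_i$ so that $\int_B w_i=1$. All other densities stay unchanged. Increase $C_{i_t}$ by $1$. **Theorem.** For every fixed $p\in[0,1/2)$ the expected total loss of this algorithm is $O(d^{25})$ as $d\to\infty$, hence polynomial in $d$, with no dependence on $T$. Precisely: for every $p\in[0,1/2)$ there are constants $K$ and $d_0$, depending only on $p$, such that for all $d\ge d_0$, all $q_0\in B$, all adaptive (possibly randomized) adversaries choosing the $x_t$, and all $T$, $$\mathbb E\left[\sum_{t=1}^T|\hat y_t-\langle x_t,q_0\rangle|\right]\le K\,d^{25}.$$ -/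

import Mathlib

open MeasureTheory ProbabilityTheory Set

/-- The ambient space `ℝ^d` with its Euclidean norm and inner product. -/
abbrev Eucl (d : ℕ) : Type := EuclideanSpace ℝ (Fin d)

namespace NoisySearch

noncomputable section

/-- The closed unit ball of `ℝ^d`. -/
def ball (d : ℕ) : Set (Eucl d) := Metric.closedBall 0 1

/-- The multiplicative penalty `η = 1 / (2 d^10)`. -/
def eta (d : ℕ) : ℝ := 1 / (2 * (d : ℝ) ^ 10)

/-- The size `β_i = 2^(-100 d i)` of the perturbation at scale `i`. -/
def beta (d i : ℕ) : ℝ := 1 / 2 ^ (100 * d * i)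

/-- The width `γ_i = 2^(-i)` of scale `i`. -/
def gamma (i : ℕ) : ℝ := 1 / 2 ^ i

/-- The number `100 (d^4 i / γ_i^(10 d) + d^25 i)` of rounds after which scale `i` is left. -/
def cap (d i : ℕ) : ℝ :=
  100 * ((d : ℝ) ^ 4 * i / gamma i ^ (10 * d) + (d : ℝ) ^ 25 * i)

/-- The memory of the algorithm: for every scale `i` a density `w i` on the unit ball (its values
outside the ball are never used) and the number `C i` of rounds played at scale `i` so far. -/
structure State (d : ℕ) where
  w : ℕ → Eucl d → ℝ
  C : ℕ → ℕ

/-- `∫_{q ∈ S, ‖q‖ ≤ 1} w(q) dq`. -/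
def mass {d : ℕ} (w : Eucl d → ℝ) (S : Set (Eucl d)) : ℝ := ∫ q in ball d ∩ S, w q

/-- Initially all densities are uniform on the unit ball and all counters are zero. -/
def init (d : ℕ) : State d where
  w := fun _ _ => 1 / volume.real (ball d)
  C := fun _ => 0

/-- The scales `i ≥ 1` eligible for the context `x`: either `w i` puts mass at least
`1 - γ_i^(4 d)` on a strip of width at most `10 γ_i` in direction `x`, or the counter of the
previous scale has exceeded its threshold. -/
def eligible {d : ℕ} (s : State d) (x : Eucl d) : Set ℕ :=
  {i | 0 < i ∧
    ((∃ a b : ℝ, |a - b| ≤ 10 * gamma i ∧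
        1 - gamma i ^ (4 * d) ≤ mass (s.w i) {q | a ≤ inner ℝ x q ∧ inner ℝ x q ≤ b}) ∨
      cap d (i - 1) < s.C (i - 1))}

/-- The scale `i_t`: the largest eligible index. For `x ≠ 0` and a state reached by the algorithm,
the set of eligible indices is finite and contains `1`. -/
def scale {d : ℕ} (s : State d) (x : Eucl d) : ℕ := sSup (eligible s x)

/-- `y` is a weighted median of the density `w` in direction `x`. -/
def IsMedian {d : ℕ} (w : Eucl d → ℝ) (x : Eucl d) (y : ℝ) : Prop :=
  mass w {q | inner ℝ x q < y} = 1 / 2 ∧ mass w {q | y < inner ℝ x q} = 1 / 2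

/-- The weighted median. It exists and is unique for every `x ≠ 0` and every density that is
positive on the ball and has total mass one. -/
def median {d : ℕ} (w : Eucl d → ℝ) (x : Eucl d) : ℝ := Classical.epsilon (IsMedian w x)

/-- The query `y + δ`, where `y` is the weighted median of `w_{i_t}` and `δ = 2 β_{i_t} u`;
for `u` uniform on `[-1, 1]` this `δ` is uniform on `[-2 β_{i_t}, 2 β_{i_t}]`. -/
def query {d : ℕ} (s : State d) (x : Eucl d) (u : ℝ) : ℝ :=
  median (s.w (scale s x)) x + 2 * beta d (scale s x) * u

/-- The sign of `z`, with the value `-1` at `0`. -/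
def sgn (z : ℝ) : ℝ := if 0 < z then 1 else -1

/-- The reported feedback: the sign of `yhat - ⟨x, q₀⟩`, negated when the noise bit `flip` is
set. -/
def feedback {d : ℕ} (q₀ x : Eucl d) (yhat : ℝ) (flip : Bool) : ℝ :=
  if flip then -sgn (yhat - inner ℝ x q₀) else sgn (yhat - inner ℝ x q₀)

/-- Multiply by `1 - η` the weight of each point that violates the feedback `σ ∈ {-1, 1}`. -/
def penalize {d : ℕ} (w : Eucl d → ℝ) (x : Eucl d) (yhat σ : ℝ) (q : Eucl d) : ℝ :=
  open Classical in if σ * (yhat - inner ℝ x q) < 0 then (1 - eta d) * w q else w q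

/-- Penalize, then normalize to total mass one on the unit ball. -/
def reweight {d : ℕ} (w : Eucl d → ℝ) (x : Eucl d) (yhat σ : ℝ) (q : Eucl d) : ℝ :=
  penalize w x yhat σ q / mass (penalize w x yhat σ) univ

/-- One round: only the densities at scales `i_t` and `i_t + 1` are updated, and only the counter
at scale `i_t` is increased. -/
def step {d : ℕ} (q₀ : Eucl d) (s : State d) (x : Eucl d) (u : ℝ) (flip : Bool) : State d where
  w := fun i =>
    if i = scale s x ∨ i = scale s x + 1 then
      reweight (s.w i) x (query s x u) (feedback q₀ x (query s x u) flip)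
    else s.w i
  C := fun i => if i = scale s x then s.C i + 1 else s.C i

/-- The state before round `t` (rounds are numbered from `0`), when the hidden point is `q₀`, the
contexts are `x`, the learner's random numbers are `u` and the noise bits are `flip`. -/
def run {d : ℕ} (q₀ : Eucl d) (x : ℕ → Eucl d) (u : ℕ → ℝ) (flip : ℕ → Bool) : ℕ → State d
  | 0 => init d
  | t + 1 => step q₀ (run q₀ x u flip t) (x t) (u t) (flip t)

/-- The loss `|yhat_t - ⟨x_t, q₀⟩|` of round `t`. -/
def loss {d : ℕ} (q₀ : Eucl d) (x : ℕ → Eucl d) (u : ℕ → ℝ) (flip : ℕ → Bool) (t : ℕ) : ℝ :=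
  |query (run q₀ x u flip t) (x t) (u t) - inner ℝ (x t) q₀|

/-- The total loss of the first `T` rounds. -/
def totalLoss {d : ℕ} (q₀ : Eucl d) (x : ℕ → Eucl d) (u : ℕ → ℝ) (flip : ℕ → Bool) (T : ℕ) : ℝ :=
  ∑ t ∈ Finset.range T, loss q₀ x u flip t

end

/-- The randomness of noisy contextual search against an adaptive adversary. The `σ`-algebra `𝓕 t`
is the information available before round `t`. The context `x t` is a nonzero vector of the unit
ball that may depend on all of it. After that, the learner's random number `u t`, uniform on
`[-1, 1]`, and the noise bit `flip t`, equal to `true` with probability `p`, are drawn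
independently of each other and of the past. -/
structure IsEnvironment {Ω : Type*} [mΩ : MeasurableSpace Ω] (P : Measure Ω) (p : ℝ) {d : ℕ}
    (𝓕 : Filtration ℕ mΩ) (x : ℕ → Ω → Eucl d) (u : ℕ → Ω → ℝ) (flip : ℕ → Ω → Bool) : Prop where
  context_measurable : ∀ t, Measurable[𝓕 t] (x t)
  context_mem : ∀ t ω, x t ω ≠ 0 ∧ ‖x t ω‖ ≤ 1
  u_measurable : ∀ t, Measurable[𝓕 (t + 1)] (u t)
  flip_measurable : ∀ t, Measurable[𝓕 (t + 1)] (flip t)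
  u_uniform : ∀ t, pdf.IsUniform (u t) (Icc (-1) 1) P volume
  flip_prob : ∀ t, P {ω | flip t ω = true} = ENNReal.ofReal p
  u_indep_flip : ∀ t, IndepFun (u t) (flip t) P
  indep_past : ∀ t, Indep (𝓕 t)
    (MeasurableSpace.comap (fun ω => (u t ω, flip t ω)) inferInstance) P

end NoisySearch

/-! The losses are charged to scales. In a round at scale `i` the loss is at most `3β_i` if the
median is within `β_i` of the true value (a near round). In the remaining far rounds it is normally
of order `γ_i`. It then suffices that a scale has only polynomially many far rounds on average,
linearly in `i`, and that all exceptions are exponentially rare in `d * i`; the sum over `i`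
converges because of the factor `2^(-i)`.

The first potential is the inverse weight `1 / w_j(q₀)`. True feedback never penalizes `q₀`, and `η`
is small against `1 - 2p`, so this is a supermartingale that contracts by `1 - κη r`, where `r` is
the mass on the side of the query away from `q₀` (`average_inv_reweight_le`). In a far round the
random perturbation makes `r` at least `1/8` on average for the density at `i`. In a near round the
non-eligibility of `i + 1` leaves mass `γ_{i+1}^(4d)` outside a short strip, a quarter of which is
gained on average for the density at `i + 1`. Hence `E[w_j(q₀)⁻¹ α^(-count)]` is at most its initial
value (`lintegral_inverseWeight_mul_pow_le`).

Conversely, the inverse weight cannot become tiny. Unless some query used to update `w_j` passed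
within `2 * missRadius d j` of the true value, `w_j` is constant on a small ball around `q₀`, and
total mass one bounds the value there (`pow_le_of_constant`). Such a near miss has small probability
because the perturbation has a bounded density and the counters, hence the updates of `w_j`, are
capped independently of `T`. Together these give an exponential moment of the counts: the mean
number of far rounds is `O(d^12 i)` (`setLIntegral_farAt_le`), and a counter passes its cap with
probability at most `4 * 2^(-87di)` (`measure_cap_lt_count_le`). So rule (b) of the algorithm rarely
selects a scale.

Suppose now that `i` was selected because of a narrow heavy strip. If `w_i` puts more than
`γ_i^(4d)` on the copy of the ball contracted by `γ_i` towards `q₀`, the strip meets that copy and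
the loss is at most `14γ_i`. The case of little mass near `q₀` is excluded by a second potential,
`ratio`, which compares the weight of `q`, to the power `200d`, with that of its contraction. Since
the contraction lies between `q₀` and `q`, true feedback does not increase it, a flipped bit inverts
the multiplier, and the result is a supermartingale (`average_ratio_reweight_le`). Little mass near
`q₀` forces its integral over `q` to be exponentially large in `d² i` (`le_integral_ratio`,
`le_totalRatio`), while its expected sum over the rounds at scale `i` is bounded by the number of
such rounds (`sum_lintegral_totalRatio_le`). The case analysis is `pathLoss_le`, and
`lintegral_lossBound_le` adds up one scale. -/

namespace NoisySearch

/-! ### Densities on the ball: masses, medians and multiplicative updates. -/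

section Density

variable {d : ℕ}

/-- A measurable density, bounded away from `0` and `∞`, of total mass one on the unit ball. -/
structure IsDensity (w : Eucl d → ℝ) : Prop where
  measurable : Measurable w
  bounds : ∃ m M : ℝ, 0 < m ∧ ∀ q, m ≤ w q ∧ w q ≤ M
  mass_univ : mass w univ = 1

/-- The measure on the unit ball with density `w`. -/
noncomputable def densityMeasure (w : Eucl d → ℝ) : Measure (Eucl d) :=
  (volume.restrict (ball d)).withDensity fun q => ENNReal.ofReal (w q)

theorem measurableSet_ball : MeasurableSet (ball d) := Metric.isClosed_closedBall.measurableSet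

theorem volume_ball_lt_top : volume (ball d) < ⊤ :=
  (isCompact_closedBall (0 : Eucl d) 1).measure_lt_top

theorem volume_ball_pos : 0 < volume (ball d) :=
  (Metric.measure_ball_pos volume (0 : Eucl d) one_pos).trans_le
    (measure_mono Metric.ball_subset_closedBall)

theorem volumeReal_ball_pos : 0 < volume.real (ball d) :=
  ENNReal.toReal_pos volume_ball_pos.ne' volume_ball_lt_top.ne

theorem mem_ball_iff {q : Eucl d} : q ∈ ball d ↔ ‖q‖ ≤ 1 := by
  simp [ball]

instance : IsFiniteMeasure (volume.restrict (ball d)) :=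
  ⟨by rw [Measure.restrict_apply_univ]; exact volume_ball_lt_top⟩

theorem abs_inner_le_one {x q : Eucl d} (hx : ‖x‖ ≤ 1) (hq : ‖q‖ ≤ 1) :
    |inner ℝ x q| ≤ 1 :=
  (abs_real_inner_le_norm x q).trans (mul_le_one₀ hx (norm_nonneg _) hq)

theorem measurable_inner_left (x : Eucl d) : Measurable fun q : Eucl d => inner ℝ x q :=
  (continuous_const.inner continuous_id).measurable

theorem volume_hyperplane {x : Eucl d} (hx : x ≠ 0) (c : ℝ) :
    volume {q : Eucl d | inner ℝ x q = c} = 0 := by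
  let s : AffineSubspace ℝ (Eucl d) :=
    (AffineSubspace.mk' c (⊥ : Submodule ℝ ℝ)).comap ((innerₛₗ ℝ x).toAffineMap)
  have hs : (s : Set (Eucl d)) = {q : Eucl d | inner ℝ x q = c} := by
    ext q
    simp [s, AffineSubspace.mem_mk', sub_eq_zero]
  rw [← hs]
  refine Measure.addHaar_affineSubspace _ _ fun h => ?_
  -- If the subspace were everything, it would contain both `0` and `x`; then `c = 0` and `⟨x, x⟩ =
  -- 0`.
  have h0 : (0 : Eucl d) ∈ (s : Set (Eucl d)) := by simp [h]
  have h1 : x ∈ (s : Set (Eucl d)) := by simp [h]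
  rw [hs] at h0 h1
  simp only [mem_ofPred_eq, inner_zero_right] at h0 h1
  rw [← h0] at h1
  exact hx (inner_self_eq_zero.1 h1)

theorem nonempty_of_mass_pos {w : Eucl d → ℝ} {S : Set (Eucl d)} (h : 0 < mass w S) : (ball d ∩ S).Nonempty := by
  by_contra hne
  rw [not_nonempty_iff_eq_empty] at hne
  simp [mass, hne] at h

theorem mass_hyperplane (w : Eucl d → ℝ) {x : Eucl d} (hx : x ≠ 0) (c : ℝ) :
    mass w {q | inner ℝ x q = c} = 0 := by
  rw [mass]
  exact setIntegral_measure_zero _ (measure_mono_null inter_subset_right (volume_hyperplane hx c))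

namespace IsDensity

variable {w : Eucl d → ℝ} (hw : IsDensity w)
include hw

theorem pos (q : Eucl d) : 0 < w q := by
  obtain ⟨m, M, hm, h⟩ := hw.bounds
  exact hm.trans_le (h q).1

theorem integrableOn (S : Set (Eucl d)) : IntegrableOn w (ball d ∩ S) := by
  obtain ⟨m, M, hm, h⟩ := hw.bounds
  have : IsFiniteMeasure (volume.restrict (ball d ∩ S)) :=
    ⟨by
      rw [Measure.restrict_apply_univ]
      exact (measure_mono inter_subset_left).trans_lt volume_ball_lt_top⟩
  refine Integrable.of_bound hw.measurable.aestronglyMeasurable M (ae_of_all _ fun q => ?_)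
  rw [Real.norm_of_nonneg (hw.pos q).le]
  exact (h q).2

theorem mass_eq {S : Set (Eucl d)} (hS : MeasurableSet S) :
    mass w S = (densityMeasure w).real S := by
  rw [mass, integral_eq_lintegral_of_nonneg_ae (ae_of_all _ fun q => (hw.pos q).le)
    hw.measurable.aestronglyMeasurable, Measure.real, densityMeasure, withDensity_apply _ hS,
    Measure.restrict_restrict hS, inter_comm]

theorem isProbabilityMeasure : IsProbabilityMeasure (densityMeasure w) := by
  have h := hw.mass_eq MeasurableSet.univ
  rw [hw.mass_univ, Measure.real] at h
  exact ⟨by rw [← ENNReal.toReal_eq_one_iff]; exact h.symm⟩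

theorem mass_mono {S S' : Set (Eucl d)} (h : ball d ∩ S ⊆ S') : mass w S ≤ mass w S' := by
  rw [mass, mass]
  exact setIntegral_mono_set (hw.integrableOn S') (ae_of_all _ fun q => (hw.pos q).le)
    (Filter.Eventually.of_forall fun q hq => ⟨hq.1, h hq⟩)

theorem mass_nonneg (S : Set (Eucl d)) : 0 ≤ mass w S :=
  integral_nonneg fun q => (hw.pos q).le

theorem mass_le_one (S : Set (Eucl d)) : mass w S ≤ 1 := by
  rw [← hw.mass_univ]
  exact hw.mass_mono (subset_univ _)

theorem mass_pos_of_volume_pos {S : Set (Eucl d)} (h : 0 < volume (ball d ∩ S)) : 0 < mass w S := by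
  rw [mass, setIntegral_pos_iff_support_of_nonneg_ae (ae_of_all _ fun q => (hw.pos q).le)
    (hw.integrableOn S)]
  have : Function.support w = univ := by
    ext q; simp [(hw.pos q).ne']
  rwa [this, univ_inter]

theorem mass_add {S S' : Set (Eucl d)} (hS' : MeasurableSet S')
    (h : Disjoint S S') : mass w (S ∪ S') = mass w S + mass w S' := by
  rw [mass, inter_union_distrib_left, setIntegral_union
    (h.mono inter_subset_right inter_subset_right) (measurableSet_ball.inter hS')
    (hw.integrableOn _) (hw.integrableOn _), mass, mass]

theorem mass_compl {S : Set (Eucl d)} (hS : MeasurableSet S) : mass w Sᶜ = 1 - mass w S := by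
  have := hw.mass_add hS.compl (disjoint_compl_right (a := S))
  rw [union_compl_self, hw.mass_univ] at this
  linarith

theorem mass_lt_add_mass_gt {x : Eucl d} (hx : x ≠ 0) (c : ℝ) :
    mass w {q | inner ℝ x q < c} + mass w {q | c < inner ℝ x q} = 1 := by
  have hm := measurable_inner_left x
  have h1 := hw.mass_compl (S := {q | inner ℝ x q < c}) (measurableSet_lt hm measurable_const)
  have h2 : {q : Eucl d | inner ℝ x q < c}ᶜ = {q | inner ℝ x q = c} ∪ {q | c < inner ℝ x q} := by
    ext q; simp [le_iff_lt_or_eq, eq_comm, or_comm]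
  rw [h2, hw.mass_add (measurableSet_lt measurable_const hm), mass_hyperplane w hx] at h1
  · linarith
  · rw [Set.disjoint_left]
    intro q hq hq'
    simp only [mem_ofPred_eq] at hq hq'
    linarith

/-- The closed ball is the closure of the open one, so an open set meeting it contains an open piece
of the open ball. -/
theorem mass_pos_of_isOpen {S : Set (Eucl d)} (hS : IsOpen S) (h : (ball d ∩ S).Nonempty) :
    0 < mass w S := by
  refine hw.mass_pos_of_volume_pos ?_
  obtain ⟨q, hq, hqS⟩ := h
  have hq' : q ∈ closure (Metric.ball (0 : Eucl d) 1) := by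
    rw [closure_ball _ one_ne_zero]; exact hq
  obtain ⟨q', hq'⟩ := mem_closure_iff.1 hq' S hS hqS
  refine ((hS.inter Metric.isOpen_ball).measure_pos volume ⟨q', hq'⟩).trans_le
    (measure_mono fun r hr => ⟨Metric.ball_subset_closedBall hr.2, hr.1⟩)

theorem mass_strip_pos {x q₁ q₂ : Eucl d} {a b : ℝ} (hab : a < b) (h₁ : q₁ ∈ ball d)
    (h₂ : q₂ ∈ ball d) (ha : inner ℝ x q₁ ≤ a) (hb : b ≤ inner ℝ x q₂) :
    0 < mass w {q | a < inner ℝ x q ∧ inner ℝ x q < b} := by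
  have hc : Continuous fun q : Eucl d => inner ℝ x q := continuous_const.inner continuous_id
  refine hw.mass_pos_of_isOpen ((isOpen_lt continuous_const hc).inter
    (isOpen_lt hc continuous_const)) ?_
  have := (convex_closedBall (0 : Eucl d) 1).isPreconnected.intermediate_value h₁ h₂
    hc.continuousOn
  obtain ⟨q, hq, hqe⟩ := this (show (a + b) / 2 ∈ Icc _ _ from ⟨by linarith, by linarith⟩)
  refine ⟨q, hq, ?_⟩
  simp only at hqe
  constructor <;> linarith

/-- Hyperplanes are null, so the law of `⟨x, q⟩` has a continuous distribution function, which takes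
the value `1/2`. -/
theorem exists_isMedian {x : Eucl d} (hx : x ≠ 0) : ∃ y, IsMedian w x y := by
  have := hw.isProbabilityMeasure
  have hm := measurable_inner_left x
  let ν := (densityMeasure w).map fun q => inner ℝ x q
  have : IsProbabilityMeasure ν := Measure.isProbabilityMeasure_map hm.aemeasurable
  have hac : densityMeasure w ≪ volume :=
    (withDensity_absolutelyContinuous _ _).trans Measure.restrict_le_self.absolutelyContinuous
  have hat : ∀ c, ν {c} = 0 := fun c => by
    rw [Measure.map_apply hm (measurableSet_singleton c)]
    exact hac (volume_hyperplane hx c)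
  have hcont : Continuous (cdf ν) := by
    rw [continuous_iff_continuousAt]
    intro c
    rw [(monotone_cdf ν).continuousAt_iff_leftLim_eq_rightLim, StieltjesFunction.rightLim_eq]
    have h := hat c
    rw [← measure_cdf ν, StieltjesFunction.measure_singleton, ENNReal.ofReal_eq_zero] at h
    exact le_antisymm ((monotone_cdf ν).leftLim_le le_rfl) (by linarith)
  have h0 : ∃ a, cdf ν a ≤ 1 / 2 :=
    ((tendsto_cdf_atBot ν).eventually (ge_mem_nhds (by norm_num))).exists
  have h1 : ∃ a, 1 / 2 ≤ cdf ν a :=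
    ((tendsto_cdf_atTop ν).eventually (le_mem_nhds (by norm_num))).exists
  obtain ⟨y, hy⟩ := mem_range_of_exists_le_of_exists_ge hcont h0 h1
  have hgt : mass w {q | y < inner ℝ x q} = 1 / 2 := by
    have h2 : {q : Eucl d | y < inner ℝ x q} = {q | inner ℝ x q ≤ y}ᶜ := by
      ext q; simp
    rw [h2, hw.mass_compl (measurableSet_le hm measurable_const),
      hw.mass_eq (measurableSet_le hm measurable_const)]
    rw [cdf_eq_real, map_measureReal_apply hm measurableSet_Iic] at hy
    have h3 : {q : Eucl d | inner ℝ x q ≤ y} = (fun q => inner ℝ x q) ⁻¹' Iic y := rfl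
    rw [h3, hy]; norm_num
  refine ⟨y, ?_, hgt⟩
  have := hw.mass_lt_add_mass_gt hx y
  linarith

theorem isMedian_median {x : Eucl d} (hx : x ≠ 0) : IsMedian w x (median w x) :=
  Classical.epsilon_spec (hw.exists_isMedian hx)

/-- Determines the sublevel sets of the chosen median by masses alone, which is how its
measurability is obtained. The inequality is strict because, by connectedness of the ball, the strip
between the median and `c` has positive mass whenever the ball extends up to `c`. -/
theorem median_lt_iff {x : Eucl d} (hx : x ≠ 0) (c : ℝ) :
    median w x < c ↔ 1 / 2 < mass w {q | inner ℝ x q < c} := by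
  have hm := measurable_inner_left x
  obtain ⟨h1, h2⟩ := hw.isMedian_median hx
  set y := median w x
  constructor
  · intro hy
    by_cases hc : ∃ q₂ ∈ ball d, c ≤ inner ℝ x q₂
    · obtain ⟨q₂, hq₂, hcq⟩ := hc
      obtain ⟨q₁, hq₁, hyq⟩ := nonempty_of_mass_pos (S := {q | inner ℝ x q < y})
        (by rw [h1]; norm_num)
      have hpos := hw.mass_strip_pos hy hq₁ hq₂ (le_of_lt hyq) hcq
      have hadd := hw.mass_add (S := {q | inner ℝ x q < y})
        (S' := {q | y < inner ℝ x q ∧ inner ℝ x q < c})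
        ((measurableSet_lt measurable_const hm).inter (measurableSet_lt hm measurable_const))
        (by
          rw [Set.disjoint_left]
          intro q hq hq'
          simp only [mem_ofPred_eq] at hq hq'
          linarith [hq'.1])
      have hle := hw.mass_mono (S := {q | inner ℝ x q < y} ∪
        {q | y < inner ℝ x q ∧ inner ℝ x q < c}) (S' := {q | inner ℝ x q < c})
        (by
          rintro q ⟨-, hq | hq⟩
          · exact lt_trans hq hy
          · exact hq.2)
      rw [hadd, h1] at hle
      linarith
    · push Not at hc
      have := hw.mass_mono (S := univ) (S' := {q | inner ℝ x q < c})
        (fun q hq => hc q hq.1)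
      rw [hw.mass_univ] at this
      linarith
  · intro h
    by_contra! hy
    have := hw.mass_mono (S := {q | inner ℝ x q < c}) (S' := {q | inner ℝ x q < y})
      (fun q hq => lt_of_lt_of_le hq.2 hy)
    linarith

theorem median_mem_of_mass {x : Eucl d} (hx : x ≠ 0) {a b : ℝ}
    (h : 1 / 2 < mass w {q | a ≤ inner ℝ x q ∧ inner ℝ x q ≤ b}) :
    a ≤ median w x ∧ median w x ≤ b := by
  obtain ⟨h1, h2⟩ := hw.isMedian_median hx
  set y := median w x
  constructor
  · by_contra! hy
    have := hw.mass_mono (S := {q | a ≤ inner ℝ x q ∧ inner ℝ x q ≤ b}) (S' := {q | y < inner ℝ x q})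
      (fun q hq => lt_of_lt_of_le hy hq.2.1)
    linarith
  · by_contra! hy
    have := hw.mass_mono (S := {q | a ≤ inner ℝ x q ∧ inner ℝ x q ≤ b}) (S' := {q | inner ℝ x q < y})
      (fun q hq => lt_of_le_of_lt hq.2.2 hy)
    linarith

theorem abs_median_le_one {x : Eucl d} (hx : x ≠ 0) (hx1 : ‖x‖ ≤ 1) : |median w x| ≤ 1 := by
  rw [abs_le]
  refine hw.median_mem_of_mass hx ?_
  have := hw.mass_mono (S := univ)
    (S' := {q | -1 ≤ inner ℝ x q ∧ inner ℝ x q ≤ 1})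
    (fun q hq => abs_le.1 (abs_inner_le_one hx1 (mem_ball_iff.1 hq.1)))
  rw [hw.mass_univ] at this
  linarith

end IsDensity

theorem isDensity_uniform : IsDensity fun _ : Eucl d => 1 / volume.real (ball d) := by
  have h := volumeReal_ball_pos (d := d)
  refine ⟨measurable_const, ⟨_, _, by positivity, fun q => ⟨le_rfl, le_rfl⟩⟩, ?_⟩
  rw [mass, inter_univ, setIntegral_const, smul_eq_mul]
  field_simp

theorem eta_nonneg : 0 ≤ eta d := by unfold eta; positivity

theorem eta_le_half : eta d ≤ 1 / 2 := by
  unfold eta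
  -- In dimension `0`, division by zero makes `η = 0`.
  rcases Nat.eq_zero_or_pos d with rfl | h
  · norm_num
  · have : (1 : ℝ) ≤ (d : ℝ) ^ 10 := one_le_pow₀ (by exact_mod_cast h)
    rw [div_le_div_iff₀ (by positivity) (by norm_num)]
    linarith

/-- The set of points violating the feedback `σ` to the query `yhat`. -/
def violating (x : Eucl d) (yhat σ : ℝ) : Set (Eucl d) := {q | σ * (yhat - inner ℝ x q) < 0}

theorem measurableSet_violating (x : Eucl d) (yhat σ : ℝ) :
    MeasurableSet (violating x yhat σ) :=
  measurableSet_lt ((measurable_const.sub (measurable_inner_left x)).const_mul σ)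
    measurable_const

/-- The factor by which the weight of `q` is multiplied before normalization. -/
noncomputable def factor (x : Eucl d) (yhat σ : ℝ) (q : Eucl d) : ℝ :=
  open Classical in if q ∈ violating x yhat σ then 1 - eta d else 1

theorem penalize_eq (w : Eucl d → ℝ) (x : Eucl d) (yhat σ : ℝ) (q : Eucl d) :
    penalize w x yhat σ q = factor x yhat σ q * w q := by
  unfold penalize factor violating
  simp only [mem_ofPred_eq]
  split_ifs <;> simp

theorem factor_bounds (x : Eucl d) (yhat σ : ℝ) (q : Eucl d) :
    1 / 2 ≤ factor x yhat σ q ∧ factor x yhat σ q ≤ 1 := by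
  have h1 := eta_nonneg (d := d)
  have h2 := eta_le_half (d := d)
  unfold factor
  split_ifs <;> constructor <;> linarith

theorem measurable_factor (x : Eucl d) (yhat σ : ℝ) : Measurable (factor x yhat σ) :=
  Measurable.ite (measurableSet_violating x yhat σ) measurable_const measurable_const

theorem IsDensity.mass_penalize {w : Eucl d → ℝ} (hw : IsDensity w) (x : Eucl d) (yhat σ : ℝ) :
    mass (penalize w x yhat σ) univ = 1 - eta d * mass w (violating x yhat σ) := by
  have h : penalize w x yhat σ = fun q => w q - eta d * (violating x yhat σ).indicator w q := by
    ext q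
    rw [penalize_eq, factor, indicator]
    split_ifs <;> ring
  rw [mass, h, integral_sub (hw.integrableOn _), integral_const_mul, ← mass, hw.mass_univ,
    inter_univ, setIntegral_indicator (measurableSet_violating _ _ _), ← mass]
  exact ((hw.integrableOn univ).indicator (measurableSet_violating _ _ _)).const_mul _

theorem IsDensity.mass_penalize_bounds {w : Eucl d → ℝ} (hw : IsDensity w) (x : Eucl d)
    (yhat σ : ℝ) :
    1 / 2 ≤ mass (penalize w x yhat σ) univ ∧ mass (penalize w x yhat σ) univ ≤ 1 := by
  rw [hw.mass_penalize]
  have h1 := eta_nonneg (d := d)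
  have h2 := eta_le_half (d := d)
  have h3 := hw.mass_le_one (violating x yhat σ)
  have h4 := hw.mass_nonneg (violating x yhat σ)
  constructor <;> nlinarith

/-- Penalty factors and normalizer both lie in `[1/2, 1]`, so bounds `m, M` become `m / 2, 2 * M`.
-/
theorem IsDensity.isDensity_reweight {w : Eucl d → ℝ} (hw : IsDensity w) (x : Eucl d) (yhat σ : ℝ) :
    IsDensity (reweight w x yhat σ) := by
  obtain ⟨h1, h2⟩ := hw.mass_penalize_bounds x yhat σ
  set Z := mass (penalize w x yhat σ) univ with hZ
  have he : reweight w x yhat σ = fun q => factor x yhat σ q * w q / Z := by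
    ext q
    rw [reweight, penalize_eq]
  have hZ0 : 0 < Z := by linarith
  refine ⟨?_, ?_, ?_⟩
  · rw [he]
    exact ((measurable_factor _ _ _).mul hw.measurable).div_const _
  · obtain ⟨m, M, hm, h⟩ := hw.bounds
    refine ⟨m / 2, 2 * M, by positivity, fun q => ?_⟩
    have h3 := factor_bounds x yhat σ q
    have h4 := h q
    rw [he]
    have hw0 := hw.pos q
    constructor
    · rw [le_div_iff₀ hZ0]
      nlinarith
    · rw [div_le_iff₀ hZ0]
      nlinarith
  · rw [he]
    have : (fun q => factor x yhat σ q * w q / Z) = fun q => penalize w x yhat σ q / Z := by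
      ext q; rw [penalize_eq]
    rw [this, mass, integral_div, ← mass, ← hZ, div_self hZ0.ne']

end Density

end NoisySearch

namespace NoisySearch

/-! ### Reachable states and finiteness of the set of eligible scales. -/

section Scale

variable {d : ℕ}

theorem gamma_pos (i : ℕ) : 0 < gamma i := by unfold gamma; positivity

theorem gamma_le_half {i : ℕ} (hi : 0 < i) : gamma i ≤ 1 / 2 := by
  unfold gamma
  exact one_div_le_one_div_of_le (by norm_num)
    (by simpa using pow_le_pow_right₀ (one_le_two (α := ℝ)) hi)

theorem gamma_pow_le {i : ℕ} (hi : 0 < i) (hd : 0 < d) : gamma i ^ (4 * d) ≤ 1 / 16 := by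
  calc gamma i ^ (4 * d) ≤ (1 / 2) ^ (4 * d) :=
        pow_le_pow_left₀ (gamma_pos i).le (gamma_le_half hi) _
    _ ≤ (1 / 2) ^ 4 := pow_le_pow_of_le_one (by norm_num) (by norm_num) (by omega)
    _ = 1 / 16 := by norm_num

theorem tendsto_gamma : Filter.Tendsto gamma Filter.atTop (nhds 0) := by
  have : gamma = fun i => (1 / 2 : ℝ) ^ i := by ext i; simp [gamma]
  rw [this]
  exact tendsto_pow_atTop_nhds_zero_of_lt_one (by norm_num) (by norm_num)

theorem cap_nonneg (i : ℕ) : 0 ≤ cap d i := by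
  have := gamma_pos i
  unfold cap; positivity

theorem dim_pos_of_ne_zero {x : Eucl d} (hx : x ≠ 0) : 0 < d := by
  rcases Nat.eq_zero_or_pos d with rfl | h
  · exact absurd (Subsingleton.elim x 0) hx
  · exact h

/-- The properties shared by all states that the algorithm reaches. -/
structure State.Valid (s : State d) : Prop where
  density : ∀ i, IsDensity (s.w i)
  tail : ∃ n, ∀ i, n ≤ i → s.w i = (init d).w i ∧ s.C i = 0
  count_le : ∀ i, (s.C i : ℝ) ≤ cap d i + 1
  count_zero : s.C 0 = 0

theorem valid_init : (init d).Valid where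
  density _ := isDensity_uniform
  tail := ⟨0, fun _ _ => ⟨rfl, rfl⟩⟩
  count_le i := by
    have := cap_nonneg (d := d) i
    simp only [init, Nat.cast_zero]
    linarith
  count_zero := rfl

namespace State.Valid

variable {s : State d} (hs : s.Valid) {x : Eucl d}
include hs

theorem one_mem_eligible (hx1 : ‖x‖ ≤ 1) : 1 ∈ eligible s x := by
  refine ⟨one_pos, Or.inl ⟨-1, 1, by norm_num [gamma], ?_⟩⟩
  have := (hs.density 1).mass_mono (S := univ)
    (S' := {q | -1 ≤ inner ℝ x q ∧ inner ℝ x q ≤ 1})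
    (fun q hq => abs_le.1 (abs_inner_le_one hx1 (mem_ball_iff.1 hq.1)))
  rw [(hs.density 1).mass_univ] at this
  have := pow_nonneg (gamma_pos 1).le (4 * d)
  linarith

/-- Far out, all densities are still uniform and all counters zero, so only rule (a) could apply. A
strip narrower than `⟨x, x⟩ = 2c` misses one of the two caps `⟨x, q⟩ > c` and `⟨x, q⟩ < -c`, hence
misses a fixed positive mass, which eventually exceeds `γ_i^(4d)`. -/
theorem bddAbove_eligible (hx : x ≠ 0) (hx1 : ‖x‖ ≤ 1) : BddAbove (eligible s x) := by
  have hd := dim_pos_of_ne_zero hx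
  obtain ⟨n, hn⟩ := hs.tail
  have hc : Continuous fun q : Eucl d => inner ℝ x q := continuous_const.inner continuous_id
  have hxx : 0 < inner ℝ x x := real_inner_self_pos.2 hx
  set c : ℝ := inner ℝ x x / 2 with hcdef
  have hu := isDensity_uniform (d := d)
  set w : Eucl d → ℝ := (init d).w 0 with hw
  have hu : IsDensity w := hu
  have h1 : 0 < mass w {q | c < inner ℝ x q} :=
    hu.mass_pos_of_isOpen (isOpen_lt continuous_const hc)
      ⟨x, mem_ball_iff.2 hx1, by change c < inner ℝ x x; linarith⟩
  have h2 : 0 < mass w {q | inner ℝ x q < -c} :=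
    hu.mass_pos_of_isOpen (isOpen_lt hc continuous_const)
      ⟨-x, mem_ball_iff.2 (by rwa [norm_neg]), by
        change inner ℝ x (-x) < -c
        rw [inner_neg_right]; linarith⟩
  obtain ⟨n₁, hn₁⟩ := Filter.eventually_atTop.1
    ((tendsto_gamma.const_mul 10).eventually (gt_mem_nhds (show (10 * 0 : ℝ) < inner ℝ x x by
      rw [mul_zero]; exact hxx)))
  obtain ⟨n₂, hn₂⟩ := Filter.eventually_atTop.1
    (tendsto_gamma.eventually (gt_mem_nhds (lt_min h1 h2)))
  refine ⟨n + n₁ + n₂ + 1, fun i hi => ?_⟩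
  by_contra! hlt
  obtain ⟨hi0, ⟨a, b, hab, hm⟩ | hC⟩ := hi
  · rw [(hn i (by omega)).1] at hm
    change 1 - gamma i ^ (4 * d) ≤ mass w _ at hm
    have hγ := hn₁ i (by omega)
    have hγ' := hn₂ i (by omega)
    have hpow : gamma i ^ (4 * d) ≤ gamma i := by
      have := gamma_le_half hi0
      exact pow_le_of_le_one (gamma_pos i).le (by linarith) (by omega)
    have hab' := (abs_le.1 hab).1
    rcases lt_or_ge (-c) a with ha | ha
    · have := hu.mass_mono (S := {q | a ≤ inner ℝ x q ∧ inner ℝ x q ≤ b})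
        (S' := {q | inner ℝ x q < -c}ᶜ) (fun q hq hq' => by
          have := hq.2.1
          simp only [mem_ofPred_eq] at hq'
          linarith)
      rw [hu.mass_compl (measurableSet_lt hc.measurable measurable_const)] at this
      have := lt_min_iff.1 hγ'
      linarith
    · have := hu.mass_mono (S := {q | a ≤ inner ℝ x q ∧ inner ℝ x q ≤ b})
        (S' := {q | c < inner ℝ x q}ᶜ) (fun q hq hq' => by
          have := hq.2.2
          simp only [mem_ofPred_eq] at hq'
          linarith)
      rw [hu.mass_compl (measurableSet_lt measurable_const hc.measurable)] at this
      have := lt_min_iff.1 hγ'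
      linarith
  · rw [(hn (i - 1) (by omega)).2, Nat.cast_zero] at hC
    exact absurd hC (not_lt.2 (cap_nonneg _))

theorem scale_mem (hx : x ≠ 0) (hx1 : ‖x‖ ≤ 1) : scale s x ∈ eligible s x :=
  Nat.sSup_mem ⟨1, hs.one_mem_eligible hx1⟩ (hs.bddAbove_eligible hx hx1)

theorem notMem_eligible (hx : x ≠ 0) (hx1 : ‖x‖ ≤ 1) {i : ℕ} (hi : scale s x < i) :
    i ∉ eligible s x :=
  fun h => absurd (le_csSup (hs.bddAbove_eligible hx hx1) h) (not_le.2 hi)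

theorem scale_eq_iff (hx : x ≠ 0) (hx1 : ‖x‖ ≤ 1) (i : ℕ) :
    scale s x = i ↔ i ∈ eligible s x ∧ ∀ j, i < j → j ∉ eligible s x := by
  constructor
  · rintro rfl
    exact ⟨hs.scale_mem hx hx1, fun j hj => hs.notMem_eligible hx hx1 hj⟩
  · rintro ⟨h1, h2⟩
    refine le_antisymm ?_ (le_csSup (hs.bddAbove_eligible hx hx1) h1)
    by_contra! h
    exact h2 _ h (hs.scale_mem hx hx1)

theorem scale_pos (hx : x ≠ 0) (hx1 : ‖x‖ ≤ 1) : 0 < scale s x := (hs.scale_mem hx hx1).1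

/-- If the counter of the current scale were over its cap, rule (b) would make the next scale
eligible. Thus a counter stops at most one above its cap. -/
theorem count_scale_le (hx : x ≠ 0) (hx1 : ‖x‖ ≤ 1) : (s.C (scale s x) : ℝ) ≤ cap d (scale s x) := by
  by_contra! h
  exact hs.notMem_eligible hx hx1 (Nat.lt_succ_self _) ⟨Nat.succ_pos _, Or.inr h⟩

theorem step (q₀ : Eucl d) (hx : x ≠ 0) (hx1 : ‖x‖ ≤ 1) (u : ℝ) (f : Bool) :
    (step q₀ s x u f).Valid where
  density i := by
    simp only [NoisySearch.step]
    split_ifs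
    · exact (hs.density i).isDensity_reweight _ _ _
    · exact hs.density i
  tail := by
    obtain ⟨n, hn⟩ := hs.tail
    refine ⟨n + scale s x + 2, fun i hi => ?_⟩
    simp only [NoisySearch.step]
    rw [if_neg (by omega), if_neg (by omega)]
    exact hn i (by omega)
  count_le i := by
    simp only [NoisySearch.step]
    split_ifs with h
    · subst h
      push_cast
      linarith [hs.count_scale_le hx hx1]
    · exact hs.count_le i
  count_zero := by
    simp only [NoisySearch.step]
    rw [if_neg (hs.scale_pos hx hx1).ne, hs.count_zero]

end State.Valid

end Scale

/-! ### Measurable dependence of one round on the state, context and noise. -/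

section Measurability

variable {d : ℕ} {Θ : Type*} [MeasurableSpace Θ]

/-- Joint measurability of a family of states. -/
structure MeasurableState (s : Θ → State d) : Prop where
  w : ∀ i, Measurable fun z : Θ × Eucl d => (s z.1).w i z.2
  C : ∀ i, Measurable fun θ => (s θ).C i

theorem measurable_mass {w : Θ → Eucl d → ℝ} (hw : Measurable fun z : Θ × Eucl d => w z.1 z.2)
    {E : Set (Θ × Eucl d)} (hE : MeasurableSet E) :
    Measurable fun θ => mass (w θ) {q | (θ, q) ∈ E} := by
  have h : (fun θ => mass (w θ) {q | (θ, q) ∈ E}) =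
      fun θ => ∫ q in ball d, E.indicator (fun z => w z.1 z.2) (θ, q) := by
    ext θ
    have hS : MeasurableSet {q | (θ, q) ∈ E} := measurable_prodMk_left hE
    rw [mass, ← setIntegral_indicator hS]
    rfl
  rw [h]
  exact (hw.indicator hE).stronglyMeasurable.integral_prod_right'.measurable

theorem measurable_inner_prod {x : Θ → Eucl d} (hx : Measurable x) :
    Measurable fun z : Θ × Eucl d => inner ℝ (x z.1) z.2 :=
  (hx.comp measurable_fst).inner measurable_snd

theorem measurable_median {w : Θ → Eucl d → ℝ} (hw : Measurable fun z : Θ × Eucl d => w z.1 z.2)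
    {x : Θ → Eucl d} (hx : Measurable x) (hd : ∀ θ, IsDensity (w θ)) (hx0 : ∀ θ, x θ ≠ 0) :
    Measurable fun θ => median (w θ) (x θ) := by
  refine measurable_of_Iio fun c => ?_
  have h : (fun θ => median (w θ) (x θ)) ⁻¹' Iio c =
      {θ | 1 / 2 < mass (w θ) {q | inner ℝ (x θ) q < c}} := by
    ext θ
    exact (hd θ).median_lt_iff (hx0 θ) c
  rw [h]
  exact measurableSet_lt measurable_const
    (measurable_mass hw (E := {z | inner ℝ (x z.1) z.2 < c})
      (measurableSet_lt (measurable_inner_prod hx) measurable_const))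

/-- Replaces the uncountable choice of a strip by countable operations, so that eligibility is a
measurable event. In the converse direction the rational positions stay bounded because every strip
has positive mass and so meets the ball; a limit position works by continuity of the measure along
decreasing strips. -/
theorem IsDensity.exists_strip_iff {w : Eucl d → ℝ} (hw : IsDensity w) {x : Eucl d}
    (hx1 : ‖x‖ ≤ 1) {h m : ℝ} (hm : 0 < m) :
    (∃ a b : ℝ, |a - b| ≤ h ∧ m ≤ mass w {q | a ≤ inner ℝ x q ∧ inner ℝ x q ≤ b}) ↔
      ∀ n : ℕ, ∃ r : ℚ, m ≤ mass w {q | (r : ℝ) - 1 / (n + 1) ≤ inner ℝ x q ∧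
        inner ℝ x q ≤ r + h + 1 / (n + 1)} := by
  constructor
  · rintro ⟨a, b, hab, hmass⟩ n
    have hn : (0 : ℝ) < 1 / (n + 1) := by positivity
    obtain ⟨r, hr1, hr2⟩ := exists_rat_btwn (show a < a + 1 / (n + 1) by linarith)
    refine ⟨r, hmass.trans (hw.mass_mono fun q hq => ?_)⟩
    obtain ⟨h1, h2⟩ := hq.2
    have := (abs_le.1 hab).1
    constructor <;> linarith
  · intro H
    choose r hr using H
    have hb : ∀ n, (r n : ℝ) ∈ Icc (-2 - h) 2 := by
      intro n
      have hn : 1 / ((n : ℝ) + 1) ≤ 1 := by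
        rw [div_le_one (by positivity)]; linarith [(Nat.cast_nonneg n : (0 : ℝ) ≤ n)]
      obtain ⟨q, hq, hq1, hq2⟩ := nonempty_of_mass_pos (hm.trans_le (hr n))
      have := abs_le.1 (abs_inner_le_one hx1 (mem_ball_iff.1 hq))
      constructor <;> linarith
    obtain ⟨a, -, φ, hφ, hlim⟩ := isCompact_Icc.tendsto_subseq hb
    have key : ∀ k : ℕ, m ≤ mass w {q | a - 1 / (k + 1) ≤ inner ℝ x q ∧
        inner ℝ x q ≤ a + h + 1 / (k + 1)} := by
      intro k
      have hk : (0 : ℝ) < 1 / (k + 1) / 2 := by positivity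
      have h1 := hlim.eventually (Metric.ball_mem_nhds a hk)
      have h2 := (tendsto_one_div_add_atTop_nhds_zero_nat (𝕜 := ℝ)).comp hφ.tendsto_atTop
      have h3 := h2.eventually (gt_mem_nhds hk)
      obtain ⟨n, hn1, hn2⟩ := (h1.and h3).exists
      refine (hr (φ n)).trans (hw.mass_mono fun q hq => ?_)
      obtain ⟨h4, h5⟩ := hq.2
      simp only [Function.comp_apply, Real.dist_eq, abs_lt] at hn1 hn2
      constructor <;> linarith [hn1.1, hn1.2]
    refine ⟨a, a + h, ?_, ?_⟩
    · by_contra! hlt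
      -- For negative `h` the strips eventually become empty, contradicting their positive mass.
      have hh : h < 0 := by
        by_contra! h0
        rw [sub_add_cancel_left, abs_neg, abs_of_nonneg h0] at hlt
        exact lt_irrefl _ hlt
      obtain ⟨k, hk⟩ := exists_nat_one_div_lt (show 0 < -h / 2 by linarith)
      obtain ⟨q, hq, hq1, hq2⟩ := nonempty_of_mass_pos (hm.trans_le (key k))
      linarith
    · have := hw.isProbabilityMeasure
      have hm' := measurable_inner_left x
      have hmeas : ∀ c e : ℝ, MeasurableSet {q : Eucl d | c ≤ inner ℝ x q ∧ inner ℝ x q ≤ e} :=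
        fun c e => (measurableSet_le measurable_const hm').inter
          (measurableSet_le hm' measurable_const)
      have hanti : Antitone fun k : ℕ => {q : Eucl d | a - 1 / (k + 1) ≤ inner ℝ x q ∧
          inner ℝ x q ≤ a + h + 1 / (k + 1)} := by
        intro k l hkl q hq
        have : 1 / ((l : ℝ) + 1) ≤ 1 / (k + 1) := Nat.one_div_le_one_div hkl
        obtain ⟨h1, h2⟩ := hq
        constructor <;> linarith
      have hInter : ⋂ k : ℕ, {q : Eucl d | a - 1 / (k + 1) ≤ inner ℝ x q ∧
          inner ℝ x q ≤ a + h + 1 / (k + 1)} =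
          {q | a ≤ inner ℝ x q ∧ inner ℝ x q ≤ a + h} := by
        ext q
        simp only [mem_iInter, mem_ofPred_eq]
        have hlim0 := tendsto_one_div_add_atTop_nhds_zero_nat (𝕜 := ℝ)
        constructor
        · intro hq
          constructor
          · refine le_of_tendsto (by simpa using hlim0.const_sub a)
              (Filter.Eventually.of_forall fun k => (hq k).1)
          · refine ge_of_tendsto (by simpa using hlim0.const_add (a + h))
              (Filter.Eventually.of_forall fun k => (hq k).2)
        · rintro ⟨h1, h2⟩ k
          have : (0 : ℝ) < 1 / (k + 1) := by positivity
          constructor <;> linarith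
      have ht := tendsto_measure_iInter_atTop (μ := densityMeasure w)
        (fun k => (hmeas _ _).nullMeasurableSet) hanti ⟨0, measure_ne_top _ _⟩
      rw [hInter] at ht
      have ht' := (ENNReal.tendsto_toReal (measure_ne_top _ _)).comp ht
      rw [hw.mass_eq (hmeas _ _)]
      refine ge_of_tendsto ht' (Filter.Eventually.of_forall fun k => ?_)
      have := key k
      rwa [hw.mass_eq (hmeas _ _)] at this

variable {s : Θ → State d} {x : Θ → Eucl d}

theorem measurableSet_eligible (hs : MeasurableState s) (hx : Measurable x)
    (hv : ∀ θ, (s θ).Valid) (hx0 : ∀ θ, x θ ≠ 0 ∧ ‖x θ‖ ≤ 1) (i : ℕ) :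
    MeasurableSet {θ | i ∈ eligible (s θ) (x θ)} := by
  -- Positivity of `d` is read off from a nonzero context, so the empty parameter space is treated
  -- apart.
  rcases isEmpty_or_nonempty Θ with hΘ | ⟨⟨θ₀⟩⟩
  · rw [Subsingleton.elim {θ | i ∈ eligible (s θ) (x θ)} ∅]
    exact MeasurableSet.empty
  rcases Nat.eq_zero_or_pos i with rfl | hi
  · simp [eligible]
  have hd := dim_pos_of_ne_zero (hx0 θ₀).1
  have hm : 0 < 1 - gamma i ^ (4 * d) := by linarith [gamma_pow_le hi hd]
  have h : {θ | i ∈ eligible (s θ) (x θ)} =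
      (⋂ n : ℕ, ⋃ r : ℚ, {θ | 1 - gamma i ^ (4 * d) ≤ mass ((s θ).w i)
        {q | (r : ℝ) - 1 / (n + 1) ≤ inner ℝ (x θ) q ∧
          inner ℝ (x θ) q ≤ r + 10 * gamma i + 1 / (n + 1)}}) ∪
      {θ | cap d (i - 1) < (s θ).C (i - 1)} := by
    ext θ
    simp only [eligible, mem_ofPred_eq, mem_union, mem_iInter, mem_iUnion, hi, true_and]
    rw [((hv θ).density i).exists_strip_iff (hx0 θ).2 hm]
  rw [h]
  have hin := measurable_inner_prod hx
  refine (MeasurableSet.iInter fun n => MeasurableSet.iUnion fun r =>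
    measurableSet_le measurable_const ?_).union (measurableSet_lt measurable_const ?_)
  · exact measurable_mass (hs.w i) (E := {z | (r : ℝ) - 1 / (n + 1) ≤ inner ℝ (x z.1) z.2 ∧
      inner ℝ (x z.1) z.2 ≤ r + 10 * gamma i + 1 / (n + 1)})
      ((measurableSet_le measurable_const hin).inter (measurableSet_le hin measurable_const))
  · exact measurable_from_top.comp (hs.C (i - 1))

theorem measurable_scale (hs : MeasurableState s) (hx : Measurable x)
    (hv : ∀ θ, (s θ).Valid) (hx0 : ∀ θ, x θ ≠ 0 ∧ ‖x θ‖ ≤ 1) :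
    Measurable fun θ => scale (s θ) (x θ) := by
  refine measurable_to_countable' fun i => ?_
  have h : (fun θ => scale (s θ) (x θ)) ⁻¹' {i} = {θ | i ∈ eligible (s θ) (x θ)} ∩
      ⋂ j : ℕ, ⋂ _ : i < j, {θ | j ∈ eligible (s θ) (x θ)}ᶜ := by
    ext θ
    simp only [mem_preimage, mem_singleton_iff, mem_inter_iff, mem_iInter, mem_compl_iff,
      mem_ofPred_eq]
    exact (hv θ).scale_eq_iff (hx0 θ).1 (hx0 θ).2 i
  rw [h]
  exact (measurableSet_eligible hs hx hv hx0 i).inter (MeasurableSet.iInter fun j =>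
    MeasurableSet.iInter fun _ => (measurableSet_eligible hs hx hv hx0 j).compl)

theorem measurable_scale_median (hs : MeasurableState s) (hx : Measurable x)
    (hv : ∀ θ, (s θ).Valid) (hx0 : ∀ θ, x θ ≠ 0 ∧ ‖x θ‖ ≤ 1) :
    Measurable fun θ => median ((s θ).w (scale (s θ) (x θ))) (x θ) := by
  have hN := measurable_scale hs hx hv hx0
  refine measurable_median (w := fun θ => (s θ).w (scale (s θ) (x θ))) ?_ hx
    (fun θ => (hv θ).density _) (fun θ => (hx0 θ).1)
  -- The scale is itself random; joint measurability in the index is free because there are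
  -- countably many scales.
  have h : Measurable fun z : (Θ × Eucl d) × ℕ => (s z.1.1).w z.2 z.1.2 :=
    measurable_from_prod_countable_left fun i => hs.w i
  exact h.comp (measurable_id.prodMk (hN.comp measurable_fst))

theorem measurable_query (hs : MeasurableState s) (hx : Measurable x)
    (hv : ∀ θ, (s θ).Valid) (hx0 : ∀ θ, x θ ≠ 0 ∧ ‖x θ‖ ≤ 1) :
    Measurable fun z : Θ × (ℝ × Bool) => query (s z.1) (x z.1) z.2.1 := by
  have hN := measurable_scale hs hx hv hx0
  have hmed := measurable_scale_median hs hx hv hx0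
  have hβ : Measurable fun θ => beta d (scale (s θ) (x θ)) :=
    (measurable_from_top (f := beta d)).comp hN
  exact (hmed.comp measurable_fst).add
    (((hβ.comp measurable_fst).const_mul 2).mul (measurable_fst.comp measurable_snd))

theorem measurable_sgn : Measurable sgn :=
  Measurable.ite measurableSet_Ioi measurable_const measurable_const

theorem MeasurableState.step (hs : MeasurableState s) (hx : Measurable x)
    (hv : ∀ θ, (s θ).Valid) (hx0 : ∀ θ, x θ ≠ 0 ∧ ‖x θ‖ ≤ 1) (q₀ : Eucl d) :
    MeasurableState fun z : Θ × (ℝ × Bool) => step q₀ (s z.1) (x z.1) z.2.1 z.2.2 := by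
  have hN := measurable_scale hs hx hv hx0
  have hq := measurable_query hs hx hv hx0
  set Y : Θ × (ℝ × Bool) → ℝ := fun z => query (s z.1) (x z.1) z.2.1 with hY
  have hσ : Measurable fun z : Θ × (ℝ × Bool) => feedback q₀ (x z.1) (Y z) z.2.2 := by
    have h1 : Measurable fun z : Θ × (ℝ × Bool) => sgn (Y z - inner ℝ (x z.1) q₀) :=
      measurable_sgn.comp (hq.sub ((hx.comp measurable_fst).inner measurable_const))
    exact Measurable.ite ((measurable_snd.comp measurable_snd) (measurableSet_singleton true))
      h1.neg h1
  constructor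
  · intro i
    have hset : MeasurableSet {z : (Θ × (ℝ × Bool)) × Eucl d |
        i = scale (s z.1.1) (x z.1.1) ∨ i = scale (s z.1.1) (x z.1.1) + 1} := by
      have h1 : Measurable fun z : (Θ × (ℝ × Bool)) × Eucl d => scale (s z.1.1) (x z.1.1) :=
        hN.comp (measurable_fst.comp measurable_fst)
      exact h1 (MeasurableSet.of_discrete (s := {n : ℕ | i = n ∨ i = n + 1}))
    have hwi : Measurable fun z : (Θ × (ℝ × Bool)) × Eucl d => (s z.1.1).w i z.2 :=
      (hs.w i).comp ((measurable_fst.comp measurable_fst).prodMk measurable_snd)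
    have hpen : Measurable fun z : (Θ × (ℝ × Bool)) × Eucl d =>
        penalize ((s z.1.1).w i) (x z.1.1) (Y z.1) (feedback q₀ (x z.1.1) (Y z.1) z.1.2.2) z.2 :=
      Measurable.ite (measurableSet_lt ((hσ.comp measurable_fst).mul
        ((hq.comp measurable_fst).sub (measurable_inner_prod (hx.comp measurable_fst))))
        measurable_const) (hwi.const_mul _) hwi
    have hZ : Measurable fun z : Θ × (ℝ × Bool) => mass (penalize ((s z.1).w i) (x z.1) (Y z)
        (feedback q₀ (x z.1) (Y z) z.2.2)) univ :=
      measurable_mass (w := fun z : Θ × (ℝ × Bool) => penalize ((s z.1).w i) (x z.1) (Y z)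
        (feedback q₀ (x z.1) (Y z) z.2.2)) hpen (E := univ) MeasurableSet.univ
    have hre : Measurable fun z : (Θ × (ℝ × Bool)) × Eucl d =>
        reweight ((s z.1.1).w i) (x z.1.1) (Y z.1) (feedback q₀ (x z.1.1) (Y z.1) z.1.2.2) z.2 :=
      hpen.div (hZ.comp measurable_fst)
    have he : (fun z : (Θ × (ℝ × Bool)) × Eucl d =>
        (NoisySearch.step q₀ (s z.1.1) (x z.1.1) z.1.2.1 z.1.2.2).w i z.2) = fun z =>
        if i = scale (s z.1.1) (x z.1.1) ∨ i = scale (s z.1.1) (x z.1.1) + 1 then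
          reweight ((s z.1.1).w i) (x z.1.1) (Y z.1) (feedback q₀ (x z.1.1) (Y z.1) z.1.2.2) z.2
        else (s z.1.1).w i z.2 := by
      ext z
      simp only [NoisySearch.step]
      split_ifs <;> rfl
    rw [he]
    exact Measurable.ite hset hre hwi
  · intro i
    exact Measurable.ite ((hN.comp measurable_fst)
      (MeasurableSet.of_discrete (s := {n : ℕ | i = n})))
      (((hs.C i).comp measurable_fst).add_const 1) ((hs.C i).comp measurable_fst)

end Measurability

end NoisySearch

namespace NoisySearch

/-! ### The law of one round's randomness and integration against it. -/

section NoiseLaw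

/-- The uniform distribution on `[-1, 1]`. -/
noncomputable def uniformLaw : Measure ℝ :=
  ENNReal.ofReal (1 / 2) • volume.restrict (Icc (-1) 1)

/-- The law of the noise bit. -/
noncomputable def bitLaw (p : ℝ) : Measure Bool :=
  ENNReal.ofReal (1 - p) • Measure.dirac false + ENNReal.ofReal p • Measure.dirac true

/-- The joint law of the learner's random number and the noise bit. -/
noncomputable def noiseLaw (p : ℝ) : Measure (ℝ × Bool) := uniformLaw.prod (bitLaw p)

theorem isProbabilityMeasure_bitLaw {p : ℝ} (hp0 : 0 ≤ p) (hp1 : p ≤ 1) :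
    IsProbabilityMeasure (bitLaw p) := by
  constructor
  rw [bitLaw]
  simp only [Measure.coe_add, Measure.coe_smul, Pi.add_apply, Pi.smul_apply, measure_univ,
    smul_eq_mul, mul_one]
  rw [← ENNReal.ofReal_add (by linarith) hp0]
  simp

theorem uniformLaw_of_subset {s : Set ℝ} (hs : MeasurableSet s) (h : s ⊆ Icc (-1) 1) :
    uniformLaw s = ENNReal.ofReal (1 / 2) * volume s := by
  rw [uniformLaw, Measure.smul_apply, Measure.restrict_apply hs, inter_eq_left.2 h, smul_eq_mul]

instance : IsProbabilityMeasure uniformLaw := by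
  constructor
  rw [uniformLaw, Measure.smul_apply, Measure.restrict_apply_univ, Real.volume_Icc, smul_eq_mul,
    ← ENNReal.ofReal_mul (by norm_num)]
  norm_num

theorem uniformLaw_absolutelyContinuous : uniformLaw ≪ volume :=
  Measure.smul_absolutelyContinuous.trans Measure.restrict_le_self.absolutelyContinuous

theorem uniformLaw_le (s : Set ℝ) : uniformLaw s ≤ ENNReal.ofReal (1 / 2) * volume s := by
  rw [uniformLaw, Measure.smul_apply, smul_eq_mul]
  gcongr
  exact Measure.restrict_le_self

theorem lintegral_noiseLaw (p : ℝ) {g : ℝ × Bool → ENNReal} (hg : Measurable g) :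
    ∫⁻ v, g v ∂noiseLaw p = ∫⁻ u, (ENNReal.ofReal (1 - p) * g (u, false) +
      ENNReal.ofReal p * g (u, true)) ∂uniformLaw := by
  rw [noiseLaw, lintegral_prod _ hg.aemeasurable]
  refine lintegral_congr fun u => ?_
  rw [bitLaw, lintegral_add_measure, lintegral_smul_measure, lintegral_smul_measure, lintegral_dirac,
    lintegral_dirac]
  simp

theorem isProbabilityMeasure_noiseLaw {p : ℝ} (hp0 : 0 ≤ p) (hp1 : p ≤ 1) :
    IsProbabilityMeasure (noiseLaw p) := by
  have := isProbabilityMeasure_bitLaw hp0 hp1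
  unfold noiseLaw
  infer_instance

theorem lintegral_noiseLaw_le_of_ae {p : ℝ} (hp0 : 0 ≤ p) (hp1 : p ≤ 1) {g : ℝ × Bool → ℝ}
    (hg : Measurable g) (hg0 : ∀ v, 0 ≤ g v) {b : ℝ → ℝ}
    (h : ∀ᵐ u ∂uniformLaw, (1 - p) * g (u, false) + p * g (u, true) ≤ b u) :
    ∫⁻ v, ENNReal.ofReal (g v) ∂noiseLaw p ≤ ∫⁻ u, ENNReal.ofReal (b u) ∂uniformLaw := by
  rw [lintegral_noiseLaw p hg.ennreal_ofReal]
  refine lintegral_mono_ae (h.mono fun u hu => ?_)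
  rw [← ENNReal.ofReal_mul (by linarith), ← ENNReal.ofReal_mul hp0,
    ← ENNReal.ofReal_add (mul_nonneg (by linarith) (hg0 _)) (mul_nonneg hp0 (hg0 _))]
  exact ENNReal.ofReal_le_ofReal hu

/-- Only the minorant `h` is assumed measurable: the wrong-side mass, as a function of the
perturbation, enters through an upper bound on a lower integral and is never integrated itself. -/
theorem lintegral_uniformLaw_le {c k l : ℝ} (hc : 0 ≤ c) (hk0 : 0 ≤ k) (hk1 : k ≤ 1)
    {f h : ℝ → ℝ} (hh : Measurable h) (hh0 : ∀ u, 0 ≤ h u) (hhf : ∀ u, h u ≤ f u)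
    (hf : ∀ u, f u ≤ 1) (hl : l ≤ ∫ u, h u ∂uniformLaw) :
    ∫⁻ u, ENNReal.ofReal (c * (1 - k * f u)) ∂uniformLaw ≤ ENNReal.ofReal (c * (1 - k * l)) := by
  have hint : Integrable h uniformLaw :=
    Integrable.of_bound hh.aestronglyMeasurable 1 (ae_of_all _ fun u => by
      rw [Real.norm_of_nonneg (hh0 u)]
      exact (hhf u).trans (hf u))
  calc ∫⁻ u, ENNReal.ofReal (c * (1 - k * f u)) ∂uniformLaw
      ≤ ∫⁻ u, ENNReal.ofReal (c * (1 - k * h u)) ∂uniformLaw := by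
        refine lintegral_mono fun u => ENNReal.ofReal_le_ofReal ?_
        have := hhf u
        gcongr
    _ = ENNReal.ofReal (∫ u, c * (1 - k * h u) ∂uniformLaw) := by
        refine (ofReal_integral_eq_lintegral_ofReal ?_ (ae_of_all _ fun u => ?_)).symm
        · exact ((integrable_const _).sub (hint.const_mul k)).const_mul c
        · have h1 := hh0 u
          have h2 := (hhf u).trans (hf u)
          exact mul_nonneg hc (by nlinarith)
    _ ≤ _ := by
        refine ENNReal.ofReal_le_ofReal ?_
        rw [integral_const_mul, integral_sub (integrable_const _) (hint.const_mul k),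
          integral_const_mul]
        simp only [integral_const, probReal_univ, smul_eq_mul, mul_one]
        gcongr

end NoiseLaw

/-! ### The two potentials and their one-round drift for a fixed query. -/

section Drift

variable {d : ℕ}

/-- The penalty `η` is small compared with the noise level `p`, with margin `κ`. -/
structure SmallPenalty (p κ : ℝ) (d : ℕ) : Prop where
  nonneg : 0 ≤ p
  le_half : p < 1 / 2
  margin_pos : 0 < κ
  drift : p / (1 - eta d) + κ ≤ 1 - p
  power : p ≤ (1 - p) * (1 - eta d) ^ (200 * d)

theorem violating_one (x : Eucl d) (yhat : ℝ) :
    violating x yhat 1 = {q | yhat < inner ℝ x q} := by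
  ext q; simp [violating]

theorem violating_neg_one (x : Eucl d) (yhat : ℝ) :
    violating x yhat (-1) = {q | inner ℝ x q < yhat} := by
  ext q; simp [violating]

theorem sgn_eq_or (z : ℝ) : sgn z = 1 ∨ sgn z = -1 := by
  unfold sgn; split_ifs <;> simp

theorem sgn_mul_self_nonneg (z : ℝ) : 0 ≤ sgn z * z := by
  unfold sgn; split_ifs <;> linarith

/-- The mass of the side of the query that does not contain the hidden point. -/
noncomputable def wrongMass (w : Eucl d → ℝ) (x q₀ : Eucl d) (yhat : ℝ) : ℝ :=
  mass w (violating x yhat (sgn (yhat - inner ℝ x q₀)))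

theorem feedback_false (q₀ x : Eucl d) (yhat : ℝ) :
    feedback q₀ x yhat false = sgn (yhat - inner ℝ x q₀) := rfl

theorem feedback_true (q₀ x : Eucl d) (yhat : ℝ) :
    feedback q₀ x yhat true = -sgn (yhat - inner ℝ x q₀) := rfl

theorem IsDensity.mass_violating_neg_sgn {w : Eucl d → ℝ} (hw : IsDensity w) {x : Eucl d}
    (hx : x ≠ 0) (q₀ : Eucl d) (yhat : ℝ) :
    mass w (violating x yhat (-sgn (yhat - inner ℝ x q₀))) = 1 - wrongMass w x q₀ yhat := by
  have h := hw.mass_lt_add_mass_gt hx yhat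
  unfold wrongMass
  rcases sgn_eq_or (yhat - inner ℝ x q₀) with hs | hs <;> rw [hs]
  · rw [violating_one, violating_neg_one]; linarith
  · rw [neg_neg, violating_one, violating_neg_one]; linarith

theorem factor_self_false (x q₀ : Eucl d) (yhat : ℝ) :
    factor x yhat (sgn (yhat - inner ℝ x q₀)) q₀ = 1 :=
  if_neg (not_lt.2 (sgn_mul_self_nonneg _))

theorem reweight_eq (w : Eucl d → ℝ) (x : Eucl d) (yhat σ : ℝ) (q : Eucl d) :
    reweight w x yhat σ q =
      factor x yhat σ q * w q / mass (penalize w x yhat σ) univ := by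
  rw [reweight, penalize_eq]

theorem one_sub_eta_le_factor (x : Eucl d) (yhat σ : ℝ) (q : Eucl d) :
    1 - eta d ≤ factor x yhat σ q := by
  have := eta_nonneg (d := d)
  unfold factor
  split_ifs <;> linarith

theorem one_sub_eta_pos : 0 < 1 - eta d := by
  have := eta_le_half (d := d)
  linarith

/-- With wrong-side mass `r`, true feedback multiplies the inverse weight by `1 - η r`, since `q₀`
is not penalized. Flipped feedback multiplies it by at most `(1 - η(1 - r)) / (1 - η) = 1 + η r / (1
- η)`. The average loses `η r ((1 - p) - p / (1 - η))`, which is at least `κ η r`. -/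
theorem IsDensity.average_inv_reweight_le {p κ : ℝ} (hP : SmallPenalty p κ d) {w : Eucl d → ℝ}
    (hw : IsDensity w) {x : Eucl d} (hx : x ≠ 0) (q₀ : Eucl d) (yhat : ℝ) :
    (1 - p) * (reweight w x yhat (feedback q₀ x yhat false) q₀)⁻¹ +
      p * (reweight w x yhat (feedback q₀ x yhat true) q₀)⁻¹ ≤
    (w q₀)⁻¹ * (1 - κ * eta d * wrongMass w x q₀ yhat) := by
  have hη := one_sub_eta_pos (d := d)
  have hη0 := eta_nonneg (d := d)
  have hw0 := hw.pos q₀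
  have hp := hP.nonneg
  rw [feedback_false, feedback_true, reweight_eq, reweight_eq, factor_self_false,
    hw.mass_penalize, hw.mass_penalize, hw.mass_violating_neg_sgn hx, ← wrongMass]
  set r := wrongMass w x q₀ yhat with hr
  have hr0 : 0 ≤ r := hw.mass_nonneg _
  have hr1 : r ≤ 1 := hw.mass_le_one _
  set φ := factor x yhat (-sgn (yhat - inner ℝ x q₀)) q₀
  have hφ : 1 - eta d ≤ φ := one_sub_eta_le_factor _ _ _ _
  have hφ0 : 0 < φ := hη.trans_le hφ
  have h1 : (φ * w q₀ / (1 - eta d * (1 - r)))⁻¹ ≤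
      (w q₀)⁻¹ * ((1 - eta d * (1 - r)) / (1 - eta d)) := by
    have : (φ * w q₀ / (1 - eta d * (1 - r)))⁻¹ = (w q₀)⁻¹ * ((1 - eta d * (1 - r)) / φ) := by
      rw [inv_div]; field_simp
    rw [this]
    have : 0 ≤ 1 - eta d * (1 - r) := by nlinarith
    gcongr
  have h2 : (1 * w q₀ / (1 - eta d * r))⁻¹ = (w q₀)⁻¹ * (1 - eta d * r) := by
    rw [inv_div]; field_simp
  rw [h2]
  have h3 : p * ((1 - eta d * (1 - r)) / (1 - eta d)) = p + p / (1 - eta d) * (eta d * r) := by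
    field_simp; ring
  have h4 := mul_le_mul_of_nonneg_right hP.drift (mul_nonneg hη0 hr0)
  calc _ ≤ (1 - p) * ((w q₀)⁻¹ * (1 - eta d * r)) +
        p * ((w q₀)⁻¹ * ((1 - eta d * (1 - r)) / (1 - eta d))) := by gcongr
    _ = (w q₀)⁻¹ * ((1 - p) * (1 - eta d * r) +
        p * ((1 - eta d * (1 - r)) / (1 - eta d))) := by ring
    _ ≤ _ := by
      rw [h3]
      refine mul_le_mul_of_nonneg_left ?_ (by positivity)
      linarith

/-- The contraction towards `q₀` with factor `l`. -/
def contract (q₀ : Eucl d) (l : ℝ) (q : Eucl d) : Eucl d := q₀ + l • (q - q₀)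

theorem inner_contract (x q₀ : Eucl d) (l : ℝ) (q : Eucl d) :
    inner ℝ x (contract q₀ l q) = inner ℝ x q₀ + l * (inner ℝ x q - inner ℝ x q₀) := by
  rw [contract, inner_add_right, inner_smul_right, inner_sub_right]

/-- The ratio potential: it compares the weight of `q` with that of its contraction, and the
latter with the weight of `q₀`. -/
noncomputable def ratio (w : Eucl d → ℝ) (q₀ : Eucl d) (l : ℝ) (n : ℕ) (q : Eucl d) : ℝ :=
  (w q / w (contract q₀ l q)) ^ n * (w (contract q₀ l q) / w q₀)

theorem IsDensity.ratio_pos {w : Eucl d → ℝ} (hw : IsDensity w) (q₀ : Eucl d) (l : ℝ) (n : ℕ)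
    (q : Eucl d) : 0 < ratio w q₀ l n q :=
  mul_pos (pow_pos (div_pos (hw.pos _) (hw.pos _)) _) (div_pos (hw.pos _) (hw.pos _))

theorem factor_pos (x : Eucl d) (yhat σ : ℝ) (q : Eucl d) : 0 < factor x yhat σ q :=
  one_sub_eta_pos.trans_le (one_sub_eta_le_factor _ _ _ _)

/-- The ratio is homogeneous of degree zero in the density, so the normalizer cancels. -/
theorem IsDensity.ratio_reweight {w : Eucl d → ℝ} (hw : IsDensity w) (x q₀ : Eucl d) (yhat σ l : ℝ)
    (n : ℕ) (q : Eucl d) :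
    ratio (reweight w x yhat σ) q₀ l n q = ratio (factor x yhat σ) q₀ l n q * ratio w q₀ l n q := by
  have hZ : mass (penalize w x yhat σ) univ ≠ 0 := by
    linarith [(hw.mass_penalize_bounds x yhat σ).1]
  have h1 := (factor_pos x yhat σ q).ne'
  have h2 := (factor_pos x yhat σ q₀).ne'
  have h3 := (factor_pos x yhat σ (contract q₀ l q)).ne'
  have h4 := (hw.pos q).ne'
  have h5 := (hw.pos q₀).ne'
  have h6 := (hw.pos (contract q₀ l q)).ne'
  have e : ∀ q', factor x yhat σ q' * w q' / mass (penalize w x yhat σ) univ =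
    (factor x yhat σ q' * w q') * (mass (penalize w x yhat σ) univ)⁻¹ := fun q' => div_eq_mul_inv _ _
  simp only [ratio, reweight_eq]
  rw [div_div_div_cancel_right₀ hZ, div_div_div_cancel_right₀ hZ, mul_div_mul_comm,
    mul_div_mul_comm, mul_pow]
  ring

theorem factor_neg_of_ne {x : Eucl d} {yhat σ : ℝ} {q : Eucl d}
    (hσ : σ = 1 ∨ σ = -1) (h : yhat ≠ inner ℝ x q) :
    factor x yhat (-σ) q = (1 - eta d) / factor x yhat σ q := by
  have hη := one_sub_eta_pos (d := d)
  have h0 : σ * (yhat - inner ℝ x q) ≠ 0 :=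
    mul_ne_zero (by rcases hσ with rfl | rfl <;> norm_num) (sub_ne_zero.2 h)
  unfold factor violating
  simp only [mem_ofPred_eq]
  rcases lt_or_gt_of_ne h0 with h1 | h1
  · rw [if_neg (by linarith), if_pos h1, div_self hη.ne']
  · rw [if_pos (by linarith), if_neg (by linarith), div_one]

/-- Off the query hyperplane exactly one of the two feedbacks penalizes a point, so the two factors
multiply to `1 - η`. This constant cancels in a ratio of degree zero. -/
theorem ratio_factor_neg {x q₀ : Eucl d} {yhat σ l : ℝ} {q : Eucl d} (n : ℕ)
    (hσ : σ = 1 ∨ σ = -1) (h : yhat ≠ inner ℝ x q) (h₀ : yhat ≠ inner ℝ x q₀)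
    (hc : yhat ≠ inner ℝ x (contract q₀ l q)) :
    ratio (factor x yhat (-σ)) q₀ l n q = (ratio (factor x yhat σ) q₀ l n q)⁻¹ := by
  have hη := (one_sub_eta_pos (d := d)).ne'
  simp only [ratio]
  rw [factor_neg_of_ne hσ h, factor_neg_of_ne hσ h₀, factor_neg_of_ne hσ hc,
    div_div_div_cancel_left' _ _ hη, div_div_div_cancel_left' _ _ hη, mul_inv, ← inv_pow, inv_div,
    inv_div]

/-- `q₀` is consistent with true feedback and the contraction of `q` lies on the segment from `q₀`
to `q`; hence if the contraction is penalized, so is `q`. The only possible values are `1`, `1 - η`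
and `(1 - η)^n`. -/
theorem ratio_factor_sgn_mem {x q₀ : Eucl d} {yhat l : ℝ} {q : Eucl d} {n : ℕ} (hn : 0 < n)
    (hl0 : 0 ≤ l) (hl1 : l ≤ 1) :
    ratio (factor x yhat (sgn (yhat - inner ℝ x q₀))) q₀ l n q ∈ Icc ((1 - eta d) ^ n) 1 := by
  have hη := one_sub_eta_pos (d := d)
  have hη1 : 1 - eta d ≤ 1 := by linarith [eta_nonneg (d := d)]
  have hpn : (1 - eta d) ^ n ≤ 1 - eta d := pow_le_of_le_one hη.le hη1 hn.ne'
  set σ := sgn (yhat - inner ℝ x q₀) with hσ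
  have h0 : 0 ≤ σ * (yhat - inner ℝ x q₀) := sgn_mul_self_nonneg _
  have himp : σ * (yhat - inner ℝ x (contract q₀ l q)) < 0 → σ * (yhat - inner ℝ x q) < 0 := by
    rw [inner_contract]
    intro h
    by_contra! h'
    nlinarith
  unfold ratio
  rw [factor_self_false]
  unfold factor violating
  simp only [mem_ofPred_eq]
  split_ifs with h1 h2 h2
  · rw [div_self hη.ne']; simp [hη1, hpn]
  · simp [hpn.trans hη1]
  · exact absurd (himp h2) h1
  · simp [hpn.trans hη1]

/-- After multiplication by `e` this is a quadratic inequality with roots `p / (1 - p)` and `1`; the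
hypothesis `power` places `e` between them. -/
theorem SmallPenalty.average_le_one {p κ : ℝ} (hP : SmallPenalty p κ d) {e : ℝ}
    (he : e ∈ Icc ((1 - eta d) ^ (200 * d)) 1) : (1 - p) * e + p * e⁻¹ ≤ 1 := by
  obtain ⟨h1, h2⟩ := he
  have he0 : 0 < e := (pow_pos one_sub_eta_pos _).trans_le h1
  have hp := hP.le_half
  have h3 : p ≤ (1 - p) * e := hP.power.trans (mul_le_mul_of_nonneg_left h1 (by linarith))
  have h4 : (1 - p) * e + p * e⁻¹ = ((1 - p) * e * e + p) / e := by field_simp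
  rw [h4, div_le_one he0]
  nlinarith

theorem IsDensity.average_ratio_reweight_le {p κ : ℝ} (hP : SmallPenalty p κ d) (hd : 0 < d)
    {w : Eucl d → ℝ} (hw : IsDensity w) {x q₀ : Eucl d} {yhat l : ℝ} {q : Eucl d}
    (hl0 : 0 ≤ l) (hl1 : l ≤ 1) (h : yhat ≠ inner ℝ x q) (h₀ : yhat ≠ inner ℝ x q₀)
    (hc : yhat ≠ inner ℝ x (contract q₀ l q)) :
    (1 - p) * ratio (reweight w x yhat (feedback q₀ x yhat false)) q₀ l (200 * d) q +
      p * ratio (reweight w x yhat (feedback q₀ x yhat true)) q₀ l (200 * d) q ≤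
    ratio w q₀ l (200 * d) q := by
  rw [hw.ratio_reweight, hw.ratio_reweight, feedback_false, feedback_true,
    ratio_factor_neg _ (sgn_eq_or _) h h₀ hc]
  have := hP.average_le_one (ratio_factor_sgn_mem (x := x) (q₀ := q₀) (yhat := yhat) (q := q)
    (by positivity : 0 < 200 * d) hl0 hl1)
  have h1 := mul_le_mul_of_nonneg_right this (hw.ratio_pos q₀ l (200 * d) q).le
  linarith

end Drift

/-! ### The drift of the potentials averaged over perturbation and noise bit. -/

section OneStep

variable {d : ℕ} {s : State d} {x : Eucl d}

theorem measurable_step_w (hs : s.Valid) (hx : x ≠ 0) (hx1 : ‖x‖ ≤ 1) (q₀ : Eucl d) (j : ℕ)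
    (q : Eucl d) : Measurable fun v : ℝ × Bool => (step q₀ s x v.1 v.2).w j q := by
  have h : MeasurableState fun _ : Unit => s :=
    ⟨fun i => (hs.density i).measurable.comp measurable_snd, fun i => measurable_const⟩
  have h2 := h.step (x := fun _ => x) measurable_const (fun _ => hs) (fun _ => ⟨hx, hx1⟩) q₀
  exact (h2.w j).comp ((measurable_const (a := ()).prodMk measurable_id).prodMk measurable_const)

theorem step_w_of_mem {q₀ : Eucl d} {u : ℝ} {f : Bool} {j : ℕ}
    (h : j = scale s x ∨ j = scale s x + 1) :
    (step q₀ s x u f).w j =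
      reweight (s.w j) x (query s x u) (feedback q₀ x (query s x u) f) := by
  simp [step, h]

theorem step_w_of_notMem {q₀ : Eucl d} {u : ℝ} {f : Bool} {j : ℕ}
    (h : ¬(j = scale s x ∨ j = scale s x + 1)) : (step q₀ s x u f).w j = s.w j := by
  simp [step, h]

/-- The inverse of the weight of `q₀`, relative to the uniform density. -/
noncomputable def inverseWeight (s : State d) (q₀ : Eucl d) (j : ℕ) : ℝ :=
  (volume.real (ball d))⁻¹ * (s.w j q₀)⁻¹

theorem State.Valid.inverseWeight_pos (hs : s.Valid) (q₀ : Eucl d) (j : ℕ) :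
    0 < inverseWeight s q₀ j :=
  mul_pos (inv_pos.2 volumeReal_ball_pos) (inv_pos.2 ((hs.density j).pos _))

theorem lintegral_inverseWeight_step_le {p κ : ℝ} (hP : SmallPenalty p κ d) (hs : s.Valid)
    (hx : x ≠ 0) (hx1 : ‖x‖ ≤ 1) (q₀ : Eucl d) {j : ℕ} {l : ℝ}
    (hj : j = scale s x ∨ j = scale s x + 1) {h : ℝ → ℝ} (hh : Measurable h)
    (hh0 : ∀ u, 0 ≤ h u) (hhw : ∀ u, h u ≤ wrongMass (s.w j) x q₀ (query s x u))
    (hl : l ≤ ∫ u, h u ∂uniformLaw) :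
    ∫⁻ v, ENNReal.ofReal (inverseWeight (step q₀ s x v.1 v.2) q₀ j) ∂noiseLaw p ≤
      ENNReal.ofReal (inverseWeight s q₀ j * (1 - κ * eta d * l)) := by
  have hη := eta_nonneg (d := d)
  have hη' := eta_le_half (d := d)
  have hp := hP.nonneg
  have hp' := hP.le_half
  have hκ := hP.margin_pos
  have hκ1 : κ ≤ 1 := by
    have : 0 ≤ p / (1 - eta d) := div_nonneg hp one_sub_eta_pos.le
    linarith [hP.drift]
  refine (lintegral_noiseLaw_le_of_ae hp (by linarith)
    (((measurable_step_w hs hx hx1 q₀ j q₀).inv).const_mul _)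
    (fun v => ((hs.step q₀ hx hx1 v.1 v.2).inverseWeight_pos q₀ j).le)
    (b := fun u => inverseWeight s q₀ j *
      (1 - κ * eta d * wrongMass (s.w j) x q₀ (query s x u))) (ae_of_all _ fun u => ?_)).trans
    (lintegral_uniformLaw_le (hs.inverseWeight_pos q₀ j).le (by positivity) (by nlinarith)
      hh hh0 hhw (fun u => (hs.density j).mass_le_one _) hl)
  simp only [inverseWeight, step_w_of_mem hj]
  have h1 := (hs.density j).average_inv_reweight_le hP hx q₀ (query s x u)
  have h2 := mul_le_mul_of_nonneg_left h1 (inv_pos.2 (volumeReal_ball_pos (d := d))).le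
  simp only [Pi.inv_apply]
  linarith

theorem lintegral_inverseWeight_step_le_self {p κ : ℝ} (hP : SmallPenalty p κ d) (hs : s.Valid)
    (hx : x ≠ 0) (hx1 : ‖x‖ ≤ 1) (q₀ : Eucl d) (j : ℕ) :
    ∫⁻ v, ENNReal.ofReal (inverseWeight (step q₀ s x v.1 v.2) q₀ j) ∂noiseLaw p ≤
      ENNReal.ofReal (inverseWeight s q₀ j) := by
  by_cases hj : j = scale s x ∨ j = scale s x + 1
  · have := lintegral_inverseWeight_step_le hP hs hx hx1 q₀ hj (l := 0) (h := fun _ => 0)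
      measurable_const (fun _ => le_rfl) (fun u => (hs.density j).mass_nonneg _) (by simp)
    simpa using this
  · have := isProbabilityMeasure_noiseLaw hP.nonneg (by linarith [hP.le_half])
    simp [inverseWeight, step_w_of_notMem hj]

/-- The median used in a round is far from the true value, relative to the perturbation. -/
def IsFar (q₀ : Eucl d) (s : State d) (x : Eucl d) : Prop :=
  beta d (scale s x) < |median (s.w (scale s x)) x - inner ℝ x q₀|

theorem beta_pos (i : ℕ) : 0 < beta d i := by unfold beta; positivity

theorem uniformLaw_real_Icc {a b : ℝ} (ha : -1 ≤ a) (hb : b ≤ 1) (hab : a ≤ b) :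
    uniformLaw.real (Icc a b) = (b - a) / 2 := by
  rw [Measure.real, uniformLaw_of_subset measurableSet_Icc (Icc_subset_Icc ha hb),
    Real.volume_Icc, ← ENNReal.ofReal_mul (by norm_num), ENNReal.toReal_ofReal (by linarith)]
  ring

theorem uniformLaw_real_Ioc {a b : ℝ} (ha : -1 ≤ a) (hb : b ≤ 1) (hab : a ≤ b) :
    uniformLaw.real (Ioc a b) = (b - a) / 2 := by
  rw [Measure.real, uniformLaw_of_subset measurableSet_Ioc
      (Ioc_subset_Icc_self.trans (Icc_subset_Icc ha hb)),
    Real.volume_Ioc, ← ENNReal.ofReal_mul (by norm_num), ENNReal.toReal_ofReal (by linarith)]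
  ring

theorem uniformLaw_real_Ico {a b : ℝ} (ha : -1 ≤ a) (hb : b ≤ 1) (hab : a ≤ b) :
    uniformLaw.real (Ico a b) = (b - a) / 2 := by
  rw [Measure.real, uniformLaw_of_subset measurableSet_Ico
      (Ico_subset_Icc_self.trans (Icc_subset_Icc ha hb)),
    Real.volume_Ico, ← ENNReal.ofReal_mul (by norm_num), ENNReal.toReal_ofReal (by linarith)]
  ring

theorem sgn_of_pos {z : ℝ} (hz : 0 < z) : sgn z = 1 := if_pos hz

theorem sgn_of_neg {z : ℝ} (hz : z < 0) : sgn z = -1 := if_neg hz.not_gt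

theorem wrongMass_of_lt {w : Eucl d → ℝ} {q₀ : Eucl d} {yhat : ℝ} (h : inner ℝ x q₀ < yhat) :
    wrongMass w x q₀ yhat = mass w {q | yhat < inner ℝ x q} := by
  rw [wrongMass, sgn_of_pos (sub_pos.2 h), violating_one]

theorem wrongMass_of_gt {w : Eucl d → ℝ} {q₀ : Eucl d} {yhat : ℝ} (h : yhat < inner ℝ x q₀) :
    wrongMass w x q₀ yhat = mass w {q | inner ℝ x q < yhat} := by
  rw [wrongMass, sgn_of_neg (sub_neg.2 h), violating_neg_one]

theorem integral_indicator_uniformLaw {J : Set ℝ} (hJ : MeasurableSet J) (c : ℝ) :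
    ∫ u, J.indicator (fun _ => c) u ∂uniformLaw = uniformLaw.real J * c := by
  rw [integral_indicator hJ, setIntegral_const, smul_eq_mul]

/-- With probability `1/4` the perturbation moves the query towards `⟨x, q₀⟩` by at most `β_i`,
which does not reach it. The wrong side then contains the half of the mass beyond the median, so the
mean is at least `1/4 * 1/2`. -/
theorem exists_wrongMass_bound_of_isFar (hs : s.Valid) (hx : x ≠ 0) {q₀ : Eucl d}
    (hfar : IsFar q₀ s x) :
    ∃ h : ℝ → ℝ, Measurable h ∧ (∀ u, 0 ≤ h u) ∧
      (∀ u, h u ≤ wrongMass (s.w (scale s x)) x q₀ (query s x u)) ∧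
      1 / 8 ≤ ∫ u, h u ∂uniformLaw := by
  set i := scale s x with hi
  have hw := hs.density i
  have hβ := beta_pos (d := d) i
  obtain ⟨h1, h2⟩ := hw.isMedian_median hx
  have hfar' : beta d i < |median (s.w i) x - inner ℝ x q₀| := hfar
  have hq : ∀ u, query s x u = median (s.w i) x + 2 * beta d i * u := fun u => rfl
  set y := median (s.w i) x with hy
  have key : ∀ J : Set ℝ, MeasurableSet J → uniformLaw.real J = 1 / 4 →
      (∀ u ∈ J, 1 / 2 ≤ wrongMass (s.w i) x q₀ (query s x u)) → ∃ h : ℝ → ℝ, Measurable h ∧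
      (∀ u, 0 ≤ h u) ∧ (∀ u, h u ≤ wrongMass (s.w i) x q₀ (query s x u)) ∧
      1 / 8 ≤ ∫ u, h u ∂uniformLaw := fun J hJ hJ4 hu =>
    ⟨J.indicator fun _ => 1 / 2, measurable_const.indicator hJ,
      fun u => indicator_nonneg (fun _ _ => by norm_num) u,
      fun u => indicator_le' (f := fun _ => 1 / 2)
        (g := fun u => wrongMass (s.w i) x q₀ (query s x u)) hu
        (fun _ _ => hw.mass_nonneg _) u,
      by rw [integral_indicator_uniformLaw hJ, hJ4]; norm_num⟩
  rcases lt_abs.1 hfar' with h | h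
  · refine key (Icc (-(1 / 2)) 0) measurableSet_Icc ?_ fun u hu => ?_
    · rw [uniformLaw_real_Icc] <;> norm_num
    · obtain ⟨hu1, hu2⟩ := hu
      rw [hq, wrongMass_of_lt (by nlinarith), ← h2]
      refine hw.mass_mono fun q hq => ?_
      have := hq.2
      simp only [mem_ofPred_eq] at this ⊢
      nlinarith
  · refine key (Icc 0 (1 / 2)) measurableSet_Icc ?_ fun u hu => ?_
    · rw [uniformLaw_real_Icc] <;> norm_num
    · obtain ⟨hu1, hu2⟩ := hu
      rw [hq, wrongMass_of_gt (by nlinarith), ← h1]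
      refine hw.mass_mono fun q hq => ?_
      have := hq.2
      simp only [mem_ofPred_eq] at this ⊢
      nlinarith

theorem four_beta_le (hd : 0 < d) {i : ℕ} (hi : 0 < i) : 4 * beta d i ≤ 10 * gamma (i + 1) := by
  have h : beta d i ≤ gamma (i + 1) := by
    unfold beta gamma
    refine one_div_le_one_div_of_le (by positivity) (pow_le_pow_right₀ one_le_two ?_)
    nlinarith [Nat.mul_le_mul hd hi]
  linarith [gamma_pos (i + 1)]

/-- Since `i + 1` is not eligible, the strip `y ± 2β_i`, short enough by `four_beta_le`, leaves mass
`a + b` of at least `γ_{i+1}^(4d)` outside. Perturbations in the top quarter of their range put the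
query above the true value but inside the strip and gain `b`; those in the bottom quarter gain `a`.
-/
theorem exists_wrongMass_bound_of_not_isFar (hs : s.Valid) (hx : x ≠ 0) (hx1 : ‖x‖ ≤ 1)
    {q₀ : Eucl d} (hfar : ¬IsFar q₀ s x) :
    ∃ h : ℝ → ℝ, Measurable h ∧ (∀ u, 0 ≤ h u) ∧
      (∀ u, h u ≤ wrongMass (s.w (scale s x + 1)) x q₀ (query s x u)) ∧
      gamma (scale s x + 1) ^ (4 * d) / 4 ≤ ∫ u, h u ∂uniformLaw := by
  have hd := dim_pos_of_ne_zero hx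
  set i := scale s x with hi
  have hw := hs.density (i + 1)
  have hβ := beta_pos (d := d) i
  have hfar' : |median (s.w i) x - inner ℝ x q₀| ≤ beta d i := not_lt.1 hfar
  have hq : ∀ u, query s x u = median (s.w i) x + 2 * beta d i * u := fun u => rfl
  set y := median (s.w i) x with hy
  obtain ⟨hf1, hf2⟩ := abs_le.1 hfar'
  have hm := measurable_inner_left x
  set a := mass (s.w (i + 1)) {q | inner ℝ x q < y - 2 * beta d i} with ha
  set b := mass (s.w (i + 1)) {q | y + 2 * beta d i < inner ℝ x q} with hb
  have hab : gamma (i + 1) ^ (4 * d) ≤ a + b := by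
    have hne := hs.notMem_eligible hx hx1 (Nat.lt_succ_self i)
    have hstrip : mass (s.w (i + 1)) {q | y - 2 * beta d i ≤ inner ℝ x q ∧
        inner ℝ x q ≤ y + 2 * beta d i} < 1 - gamma (i + 1) ^ (4 * d) := by
      by_contra! hle
      refine hne ⟨Nat.succ_pos _, Or.inl ⟨_, _, ?_, hle⟩⟩
      have : |y - 2 * beta d i - (y + 2 * beta d i)| = 4 * beta d i := by
        rw [abs_sub_comm, abs_of_nonneg (by linarith)]; ring
      rw [this]
      exact four_beta_le hd (hs.scale_pos hx hx1)
    have hc := hw.mass_compl (S := {q | y - 2 * beta d i ≤ inner ℝ x q ∧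
        inner ℝ x q ≤ y + 2 * beta d i})
        ((measurableSet_le measurable_const hm).inter (measurableSet_le hm measurable_const))
    have hun : {q : Eucl d | y - 2 * beta d i ≤ inner ℝ x q ∧
        inner ℝ x q ≤ y + 2 * beta d i}ᶜ = {q | inner ℝ x q < y - 2 * beta d i} ∪
        {q | y + 2 * beta d i < inner ℝ x q} := by
      ext q
      simp only [mem_compl_iff, mem_ofPred_eq, mem_union, not_and_or, not_le]
    rw [hun, hw.mass_add (measurableSet_lt measurable_const hm)
      (by
        rw [Set.disjoint_left]
        intro q hq hq'
        simp only [mem_ofPred_eq] at hq hq'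
        linarith)] at hc
    linarith
  have ha0 : 0 ≤ a := hw.mass_nonneg _
  have hb0 : 0 ≤ b := hw.mass_nonneg _
  have hJ₁ : MeasurableSet (Ioc (1 / 2 : ℝ) 1) := measurableSet_Ioc
  have hJ₂ : MeasurableSet (Ico (-1 : ℝ) (-(1 / 2))) := measurableSet_Ico
  refine ⟨fun u => (Ioc (1 / 2) 1).indicator (fun _ => b) u +
    (Ico (-1) (-(1 / 2))).indicator (fun _ => a) u,
    (measurable_const.indicator hJ₁).add (measurable_const.indicator hJ₂),
    fun u => add_nonneg (indicator_nonneg (fun _ _ => hb0) u)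
      (indicator_nonneg (fun _ _ => ha0) u), fun u => ?_, ?_⟩
  · dsimp only
    by_cases h₁ : u ∈ Ioc (1 / 2 : ℝ) 1
    · obtain ⟨hu1, hu2⟩ := h₁
      rw [indicator_of_mem (show u ∈ Ioc (1 / 2 : ℝ) 1 from ⟨hu1, hu2⟩),
        indicator_of_notMem (fun h => by linarith [h.2]), add_zero,
        hq, wrongMass_of_lt (by nlinarith)]
      refine hw.mass_mono fun q hq => ?_
      have := hq.2
      simp only [mem_ofPred_eq] at this ⊢
      nlinarith
    · rw [indicator_of_notMem h₁, zero_add]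
      by_cases h₂ : u ∈ Ico (-1 : ℝ) (-(1 / 2))
      · obtain ⟨hu1, hu2⟩ := h₂
        rw [indicator_of_mem (show u ∈ Ico (-1 : ℝ) (-(1 / 2)) from ⟨hu1, hu2⟩), hq,
          wrongMass_of_gt (by nlinarith)]
        refine hw.mass_mono fun q hq => ?_
        have := hq.2
        simp only [mem_ofPred_eq] at this ⊢
        nlinarith
      · rw [indicator_of_notMem h₂]
        exact hw.mass_nonneg _
  · rw [integral_add ((integrable_const b).indicator hJ₁) ((integrable_const a).indicator hJ₂),
      integral_indicator_uniformLaw hJ₁, integral_indicator_uniformLaw hJ₂,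
      uniformLaw_real_Ioc (by norm_num) (by norm_num) (by norm_num),
      uniformLaw_real_Ico (by norm_num) (by norm_num) (by norm_num)]
    linarith

theorem lintegral_ratio_step_le {p κ : ℝ} (hP : SmallPenalty p κ d) (hs : s.Valid)
    (hx : x ≠ 0) (hx1 : ‖x‖ ≤ 1) (q₀ : Eucl d) (j : ℕ) {l : ℝ} (hl0 : 0 ≤ l) (hl1 : l ≤ 1)
    (q : Eucl d) :
    ∫⁻ v, ENNReal.ofReal (ratio ((step q₀ s x v.1 v.2).w j) q₀ l (200 * d) q) ∂noiseLaw p ≤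
      ENNReal.ofReal (ratio (s.w j) q₀ l (200 * d) q) := by
  have hp := hP.nonneg
  have hp' := hP.le_half
  have hprob := isProbabilityMeasure_noiseLaw hp (by linarith)
  by_cases hj : j = scale s x ∨ j = scale s x + 1
  swap
  · simp [step_w_of_notMem hj]
  have hm := fun q => measurable_step_w hs hx hx1 q₀ j q
  have hβ := beta_pos (d := d) (scale s x)
  -- The perturbation has no atoms, so the query almost surely avoids the levels of the three points
  -- entering the ratio.
  have hne : ∀ c : ℝ, ∀ᵐ u ∂uniformLaw, query s x u ≠ c := by
    intro c
    refine uniformLaw_absolutelyContinuous ?_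
    refine measure_mono_null (t := {(c - median (s.w (scale s x)) x) / (2 * beta d (scale s x))})
      (fun u hu => ?_) (measure_singleton _)
    have hu : query s x u = c := not_not.1 hu
    rw [mem_singleton_iff, ← hu, query]
    field_simp
    ring
  refine (lintegral_noiseLaw_le_of_ae hp (by linarith)
    ((((hm q).div (hm _)).pow_const _).mul ((hm _).div (hm _)))
    (fun v => (((hs.step q₀ hx hx1 v.1 v.2).density j).ratio_pos q₀ l _ q).le)
    (b := fun u => ratio (s.w j) q₀ l (200 * d) q) ?_).trans (by simp)
  filter_upwards [hne (inner ℝ x q), hne (inner ℝ x q₀), hne (inner ℝ x (contract q₀ l q))]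
    with u h1 h2 h3
  simp only [step_w_of_mem hj]
  exact (hs.density j).average_ratio_reweight_le hP (dim_pos_of_ne_zero hx) hl0 hl1 h1 h2 h3

theorem noiseLaw_query_near_le {p : ℝ} (hp0 : 0 ≤ p) (hp1 : p ≤ 1) (s : State d) (x : Eucl d)
    (c : ℝ) (r : ℝ) :
    noiseLaw p {v | |query s x v.1 - c| ≤ r} ≤ ENNReal.ofReal (r / (2 * beta d (scale s x))) := by
  have hβ := beta_pos (d := d) (scale s x)
  set y := median (s.w (scale s x)) x with hy
  set β := beta d (scale s x) with hβd
  have := isProbabilityMeasure_bitLaw hp0 hp1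
  have h1 : {v : ℝ × Bool | |query s x v.1 - c| ≤ r} ⊆
      (Icc ((c - r - y) / (2 * β)) ((c + r - y) / (2 * β))) ×ˢ (univ : Set Bool) := by
    intro v hv
    have hv : |y + 2 * β * v.1 - c| ≤ r := hv
    obtain ⟨h1, h2⟩ := abs_le.1 hv
    refine ⟨⟨?_, ?_⟩, mem_univ _⟩
    · rw [div_le_iff₀ (by positivity)]; linarith
    · rw [le_div_iff₀ (by positivity)]; linarith
  refine (measure_mono h1).trans ?_
  rw [noiseLaw, Measure.prod_prod, measure_univ, mul_one]
  refine (uniformLaw_le _).trans ?_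
  rw [Real.volume_Icc, ← ENNReal.ofReal_mul (by norm_num)]
  refine ENNReal.ofReal_le_ofReal (le_of_eq ?_)
  field_simp
  ring

end OneStep

end NoisySearch

namespace NoisySearch

/-! ### Geometry of contractions towards the hidden point. -/

section Contraction

variable {d : ℕ}

theorem norm_contract_sub_le {q₀ q : Eucl d} (hq₀ : ‖q₀‖ ≤ 1) (hq : q ∈ ball d) {l : ℝ}
    (hl0 : 0 ≤ l) : ‖contract q₀ l q - q₀‖ ≤ 2 * l := by
  rw [contract, add_sub_cancel_left, norm_smul, Real.norm_of_nonneg hl0, mul_comm]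
  have := norm_sub_le q q₀
  have := mem_ball_iff.1 hq
  exact mul_le_mul_of_nonneg_right (by linarith) hl0

theorem contract_mem_ball {q₀ q : Eucl d} (hq₀ : ‖q₀‖ ≤ 1) (hq : q ∈ ball d) {l : ℝ}
    (hl0 : 0 ≤ l) (hl1 : l ≤ 1) : contract q₀ l q ∈ ball d := by
  have h := (convex_closedBall (0 : Eucl d) 1) (mem_ball_iff.2 hq₀) hq
    (sub_nonneg.2 hl1) hl0 (by ring)
  have : contract q₀ l q = (1 - l) • q₀ + l • q := by
    rw [contract]; module
  rw [this]
  exact h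

theorem measurable_contract (q₀ : Eucl d) (l : ℝ) : Measurable (contract q₀ l) := by
  unfold contract; fun_prop

/-- Change of variables: the derivative is `l` times the identity, with determinant `l^d`. -/
theorem setIntegral_contract_image (q₀ : Eucl d) {l : ℝ} (hl : 0 < l) (g : Eucl d → ℝ) :
    ∫ q in contract q₀ l '' ball d, g q = l ^ d * ∫ q in ball d, g (contract q₀ l q) := by
  have hd : ∀ q ∈ ball d, HasFDerivWithinAt (contract q₀ l)
      (l • ContinuousLinearMap.id ℝ (Eucl d)) (ball d) q := fun q _ =>
    ((((hasFDerivAt_id q).sub_const q₀).const_smul l).const_add q₀).hasFDerivWithinAt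
  have hinj : InjOn (contract q₀ l) (ball d) := fun a _ b _ h => by
    simpa [contract, hl.ne'] using h
  rw [integral_image_eq_integral_abs_det_fderiv_smul volume measurableSet_ball hd hinj]
  have hdet : (l • ContinuousLinearMap.id ℝ (Eucl d)).det = l ^ d := by
    rw [ContinuousLinearMap.det, ContinuousLinearMap.toLinearMap_smul, LinearMap.det_smul]
    simp
  simp only [hdet, abs_of_pos (pow_pos hl d), smul_eq_mul]
  rw [integral_const_mul]

theorem mass_contract_image (w : Eucl d → ℝ) {q₀ : Eucl d} (hq₀ : ‖q₀‖ ≤ 1) {l : ℝ} (hl0 : 0 < l)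
    (hl1 : l ≤ 1) :
    mass w (contract q₀ l '' ball d) = l ^ d * ∫ q in ball d, w (contract q₀ l q) := by
  rw [mass, inter_eq_right.2, setIntegral_contract_image q₀ hl0]
  rintro _ ⟨q, hq, rfl⟩
  exact contract_mem_ball hq₀ hq hl0.le hl1

/-- The contracted ball has volume `l^d * vol(B)` and lies within `2 * l` of `q₀`; its mass, at most
one, is therefore `l^d * vol(B) * w q₀`. -/
theorem IsDensity.pow_le_of_constant {w : Eucl d → ℝ} (hw : IsDensity w) {q₀ : Eucl d}
    (hq₀ : ‖q₀‖ ≤ 1) {l : ℝ} (hl0 : 0 < l) (hl1 : l ≤ 1)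
    (hc : ∀ q, ‖q - q₀‖ ≤ 2 * l → w q = w q₀) :
    l ^ d ≤ (volume.real (ball d))⁻¹ * (w q₀)⁻¹ := by
  have h := hw.mass_le_one (contract q₀ l '' ball d)
  rw [mass_contract_image w hq₀ hl0 hl1, setIntegral_congr_fun measurableSet_ball
    (g := fun _ => w q₀) (fun q hq => hc _ (norm_contract_sub_le hq₀ hq hl0.le)),
    setIntegral_const, smul_eq_mul] at h
  have h1 := hw.pos q₀
  have h2 := volumeReal_ball_pos (d := d)
  rw [← mul_inv, ← one_div, le_div_iff₀ (by positivity)]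
  exact h

theorem le_add_pow_div {r τ : ℝ} (hr : 0 ≤ r) (hτ : 0 < τ) (m : ℕ) :
    r ≤ τ + r ^ (m + 1) / τ ^ m := by
  rcases le_or_gt r τ with h | h
  · have : 0 ≤ r ^ (m + 1) / τ ^ m := by positivity
    linarith
  · have : r ≤ r ^ (m + 1) / τ ^ m := by
      rw [le_div_iff₀ (by positivity), pow_succ']
      gcongr
    linarith

theorem IsDensity.measurable_ratio {w : Eucl d → ℝ} (hw : IsDensity w) (q₀ : Eucl d) (l : ℝ)
    (n : ℕ) : Measurable (ratio w q₀ l n) := by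
  have h := hw.measurable.comp (measurable_contract q₀ l)
  exact ((hw.measurable.div h).pow_const n).mul (h.div_const _)

theorem IsDensity.integrableOn_ratio {w : Eucl d → ℝ} (hw : IsDensity w) (q₀ : Eucl d) (l : ℝ)
    (n : ℕ) : IntegrableOn (ratio w q₀ l n) (ball d) := by
  obtain ⟨m, M, hm, h⟩ := hw.bounds
  refine Integrable.of_bound (hw.measurable_ratio q₀ l n).aestronglyMeasurable
    ((M / m) ^ n * (M / m)) (ae_of_all _ fun q => ?_)
  rw [Real.norm_of_nonneg (hw.ratio_pos _ _ _ _).le, ratio]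
  have hM : 0 < M := hm.trans_le ((h q).1.trans (h q).2)
  have hr : ∀ a b, w a / w b ≤ M / m := fun a b => div_le_div₀ hM.le (h a).2 hm (h b).1
  exact mul_le_mul (pow_le_pow_left₀ (div_nonneg (hw.pos _).le (hw.pos _).le) (hr _ _) n) (hr _ _)
    (div_nonneg (hw.pos _).le (hw.pos _).le) (by positivity)

/-- If little mass lies near `q₀`, then the ratio potential is large on average. -/
theorem IsDensity.le_integral_ratio {w : Eucl d → ℝ} (hw : IsDensity w) {q₀ : Eucl d}
    (hq₀ : ‖q₀‖ ≤ 1) {l ε τ : ℝ} (hl0 : 0 < l) (hl1 : l ≤ 1) (hτ : 0 < τ)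
    (hε : τ * ε ≤ 1 / 2 * l ^ d) (hm : mass w (contract q₀ l '' ball d) ≤ ε) (m : ℕ) :
    τ ^ m / 2 * (w q₀)⁻¹ ≤ ∫ q in ball d, ratio w q₀ l (m + 1) q := by
  set f := fun q => w (contract q₀ l q) with hf
  have hfm : Measurable f := hw.measurable.comp (measurable_contract q₀ l)
  have hfi : IntegrableOn f (ball d) := by
    obtain ⟨a, M, ha, h⟩ := hw.bounds
    refine Integrable.of_bound hfm.aestronglyMeasurable M (ae_of_all _ fun q => ?_)
    rw [Real.norm_of_nonneg (hw.pos _).le]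
    exact (h _).2
  have hri := hw.integrableOn_ratio q₀ l (m + 1)
  have hld : 0 < l ^ d := pow_pos hl0 d
  have hw0 := hw.pos q₀
  have h1 : ∫ q in ball d, w q ≤
      ∫ q in ball d, (τ * f q + w q₀ / τ ^ m * ratio w q₀ l (m + 1) q) := by
    have hwi := hw.integrableOn univ
    rw [inter_univ] at hwi
    refine integral_mono hwi ((hfi.const_mul τ).add (hri.const_mul _)) fun q => ?_
    have hfq : 0 < f q := hw.pos _
    -- Taking `r = w q / f q` and multiplying by `f q` turns the second term into a multiple of the
    -- ratio potential with exponent `m + 1`.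
    have h := le_add_pow_div (div_nonneg (hw.pos q).le hfq.le) hτ m
    have h' := mul_le_mul_of_nonneg_right h hfq.le
    rw [div_mul_cancel₀ _ hfq.ne'] at h'
    refine h'.trans (le_of_eq ?_)
    rw [ratio, add_mul]
    congr 1
    change _ = w q₀ / τ ^ m * ((w q / f q) ^ (m + 1) * (f q / w q₀))
    field_simp
  rw [integral_add (hfi.const_mul τ) (hri.const_mul _), integral_const_mul, integral_const_mul]
    at h1
  have h2 : ∫ q in ball d, w q = 1 := by
    have := hw.mass_univ
    rwa [mass, inter_univ] at this
  rw [mass_contract_image w hq₀ hl0 hl1] at hm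
  -- The small-mass hypothesis leaves at most half of the total mass to the term `τ * f`, so the
  -- ratio potential must account for the other half.
  have h3 : τ * ∫ q in ball d, f q ≤ 1 / 2 := by
    have : τ * (l ^ d * ∫ q in ball d, f q) ≤ 1 / 2 * l ^ d :=
      (mul_le_mul_of_nonneg_left hm hτ.le).trans hε
    by_contra! h
    nlinarith
  rw [h2] at h1
  have h4 : 1 / 2 ≤ w q₀ / τ ^ m * ∫ q in ball d, ratio w q₀ l (m + 1) q := by linarith
  have h5 : τ ^ m / 2 * (w q₀)⁻¹ = 1 / 2 * (τ ^ m / w q₀) := by field_simp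
  rw [h5]
  calc 1 / 2 * (τ ^ m / w q₀) ≤ (w q₀ / τ ^ m * ∫ q in ball d, ratio w q₀ l (m + 1) q) *
        (τ ^ m / w q₀) := by gcongr
    _ = _ := by field_simp

/-- The query hyperplane misses the ball of radius `ρ` around `q₀`, so all its points are on the
same side as `q₀`. -/
theorem factor_eq_of_far {x q₀ q : Eucl d} {yhat ρ : ℝ} (σ : ℝ) (hx1 : ‖x‖ ≤ 1)
    (hq : ‖q - q₀‖ ≤ ρ) (h : ρ < |yhat - inner ℝ x q₀|) :
    factor x yhat σ q = factor x yhat σ q₀ := by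
  have h1 : |inner ℝ x q - inner ℝ x q₀| ≤ ρ := by
    rw [← inner_sub_right]
    exact (abs_real_inner_le_norm x _).trans
      ((mul_le_of_le_one_left (norm_nonneg _) hx1).trans hq)
  have h2 : q ∈ violating x yhat σ ↔ q₀ ∈ violating x yhat σ := by
    obtain ⟨h3, h4⟩ := abs_le.1 h1
    simp only [violating, mem_ofPred_eq, mul_neg_iff]
    rcases lt_abs.1 h with h5 | h5
    · have h6 : 0 < yhat - inner ℝ x q := by linarith
      have h7 : 0 < yhat - inner ℝ x q₀ := by linarith
      simp [h6, h7, not_lt.2 h6.le, not_lt.2 h7.le]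
    · have h6 : yhat - inner ℝ x q < 0 := by linarith
      have h7 : yhat - inner ℝ x q₀ < 0 := by linarith
      simp [h6, h7, not_lt.2 h6.le, not_lt.2 h7.le]
  unfold factor
  by_cases h3 : q₀ ∈ violating x yhat σ
  · rw [if_pos (h2.2 h3), if_pos h3]
  · rw [if_neg (mt h2.1 h3), if_neg h3]

theorem step_w_eq_of_far {s : State d} {x q₀ q : Eucl d} {u ρ : ℝ} {f : Bool} {j : ℕ}
    (hx1 : ‖x‖ ≤ 1) (hq : ‖q - q₀‖ ≤ ρ) (h : s.w j q = s.w j q₀)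
    (hfar : (j = scale s x ∨ j = scale s x + 1) → ρ < |query s x u - inner ℝ x q₀|) :
    (step q₀ s x u f).w j q = (step q₀ s x u f).w j q₀ := by
  by_cases hj : j = scale s x ∨ j = scale s x + 1
  · rw [step_w_of_mem hj, reweight_eq, reweight_eq, factor_eq_of_far _ hx1 hq (hfar hj), h]
  · rw [step_w_of_notMem hj, h]

end Contraction

/-! ### The loss of a single round. -/

section Loss

variable {d : ℕ} {s : State d} {x q₀ : Eucl d}

theorem beta_le_gamma (hd : 0 < d) (i : ℕ) : beta d i ≤ gamma i := by
  unfold beta gamma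
  refine one_div_le_one_div_of_le (by positivity) (pow_le_pow_right₀ one_le_two ?_)
  nlinarith

theorem abs_query_sub_le {u : ℝ} (hu : |u| ≤ 1) :
    |query s x u - inner ℝ x q₀| ≤
      |median (s.w (scale s x)) x - inner ℝ x q₀| + 2 * beta d (scale s x) := by
  have hβ := beta_pos (d := d) (scale s x)
  have : query s x u - inner ℝ x q₀ = (median (s.w (scale s x)) x - inner ℝ x q₀) +
      2 * beta d (scale s x) * u := by rw [query]; ring
  rw [this]
  refine (abs_add_le _ _).trans (add_le_add_right ?_ _)
  rw [abs_mul, abs_of_pos (by positivity)]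
  exact mul_le_of_le_one_right (by positivity) hu

/-- A small strip condition forces the loss to be small unless little mass lies near `q₀`. -/
theorem State.Valid.abs_median_sub_le (hs : s.Valid) (hx : x ≠ 0) (hx1 : ‖x‖ ≤ 1)
    (hq₀ : ‖q₀‖ ≤ 1) {i : ℕ} (hi : 0 < i) {a b : ℝ} (hab : |a - b| ≤ 10 * gamma i)
    (hm : 1 - gamma i ^ (4 * d) ≤ mass (s.w i) {q | a ≤ inner ℝ x q ∧ inner ℝ x q ≤ b})
    (hl : gamma i ^ (4 * d) < mass (s.w i) (contract q₀ (gamma i) '' ball d)) :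
    |median (s.w i) x - inner ℝ x q₀| ≤ 12 * gamma i := by
  have hw := hs.density i
  have hγ := gamma_pow_le hi (dim_pos_of_ne_zero hx)
  have hin := measurable_inner_left x
  have hS : MeasurableSet {q : Eucl d | a ≤ inner ℝ x q ∧ inner ℝ x q ≤ b} :=
    (measurableSet_le measurable_const hin).inter (measurableSet_le hin measurable_const)
  obtain ⟨h1, h2⟩ := hw.median_mem_of_mass hx (a := a) (b := b) (by linarith)
  obtain ⟨_, ⟨q, hq, rfl⟩, hqa, hqb⟩ : (contract q₀ (gamma i) '' ball d ∩
      {q | a ≤ inner ℝ x q ∧ inner ℝ x q ≤ b}).Nonempty := by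
    by_contra hne
    have := hw.mass_mono (S := contract q₀ (gamma i) '' ball d)
      (S' := {q | a ≤ inner ℝ x q ∧ inner ℝ x q ≤ b}ᶜ) (fun q hq hq' => hne ⟨q, hq.2, hq'⟩)
    rw [hw.mass_compl hS] at this
    linarith
  have h3 : |inner ℝ x (contract q₀ (gamma i) q) - inner ℝ x q₀| ≤ 2 * gamma i := by
    rw [← inner_sub_right]
    exact (abs_real_inner_le_norm x _).trans ((mul_le_of_le_one_left (norm_nonneg _) hx1).trans
      (norm_contract_sub_le hq₀ hq (gamma_pos i).le))
  obtain ⟨h4, h5⟩ := abs_le.1 h3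
  obtain ⟨h6, -⟩ := abs_le.1 hab
  rw [abs_le]
  constructor <;> linarith

theorem abs_median_sub_le_two (hs : s.Valid) (hx : x ≠ 0) (hx1 : ‖x‖ ≤ 1) (hq₀ : ‖q₀‖ ≤ 1)
    (i : ℕ) : |median (s.w i) x - inner ℝ x q₀| ≤ 2 := by
  have h1 := abs_le.1 ((hs.density i).abs_median_le_one hx hx1)
  have h2 := abs_le.1 (abs_inner_le_one hx1 hq₀)
  rw [abs_le]
  constructor <;> linarith [h1.1, h1.2, h2.1, h2.2]

end Loss

end NoisySearch

namespace NoisySearch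

/-! ### The random run, its adaptedness, and the inverse-weight supermartingale. -/

section SamplePath

theorem lintegral_prod_of_indepFun {Ω Θ V : Type*} {mΩ : MeasurableSpace Ω}
    {mΘ : MeasurableSpace Θ} {mV : MeasurableSpace V} {P : Measure Ω} [IsProbabilityMeasure P]
    {X : Ω → Θ} {Y : Ω → V} (hX : Measurable X) (hY : Measurable Y) (hi : IndepFun X Y P)
    {g : Θ × V → ENNReal} (hg : Measurable g) :
    ∫⁻ ω, g (X ω, Y ω) ∂P = ∫⁻ ω, ∫⁻ v, g (X ω, v) ∂(P.map Y) ∂P := by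
  have h := (indepFun_iff_map_prod_eq_prod_map_map hX.aemeasurable hY.aemeasurable).1 hi
  have hs : IsProbabilityMeasure (P.map Y) := Measure.isProbabilityMeasure_map hY.aemeasurable
  rw [← lintegral_map hg (hX.prodMk hY), h, lintegral_prod _ hg.aemeasurable,
    lintegral_map hg.lintegral_prod_right' hX]

/-- The sub-σ-algebra is encoded as the identity map into `(Ω, m)`, which reduces the claim to
independence of two random variables. -/
theorem lintegral_prod_of_indep {Ω V : Type*} {m mΩ : MeasurableSpace Ω} {mV : MeasurableSpace V}
    {P : Measure Ω} [IsProbabilityMeasure P] {Y : Ω → V} (hm : m ≤ mΩ) (hY : Measurable Y)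
    (hi : Indep m (mV.comap Y) P) {g : Ω × V → ENNReal} (hg : Measurable[m.prod mV] g) :
    ∫⁻ ω, g (ω, Y ω) ∂P = ∫⁻ ω, ∫⁻ v, g (ω, v) ∂(P.map Y) ∂P := by
  have hi' : @IndepFun Ω Ω V mΩ m mV id Y P := by
    refine (@IndepFun_iff_Indep Ω Ω V mΩ m mV id Y P).2 ?_
    rwa [MeasurableSpace.comap_id]
  exact @lintegral_prod_of_indepFun Ω Ω V mΩ m mV P _ id Y hm hY hi' g hg

section Generic

variable {Θ Θ' : Type*} [MeasurableSpace Θ] [MeasurableSpace Θ'] {d : ℕ} {s : Θ → State d}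
  {x : Θ → Eucl d}

theorem measurableState_const (s : State d) (hs : s.Valid) : MeasurableState fun _ : Θ => s :=
  ⟨fun i => (hs.density i).measurable.comp measurable_snd, fun _ => measurable_const⟩

theorem MeasurableState.comp (hs : MeasurableState s) {f : Θ' → Θ} (hf : Measurable f) :
    MeasurableState fun θ => s (f θ) :=
  ⟨fun i => (hs.w i).comp ((hf.comp measurable_fst).prodMk measurable_snd),
    fun i => (hs.C i).comp hf⟩

theorem MeasurableState.w_apply (hs : MeasurableState s) (j : ℕ) (q : Eucl d) :
    Measurable fun θ => (s θ).w j q :=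
  (hs.w j).comp (measurable_id.prodMk measurable_const)

theorem measurableSet_isFar (hs : MeasurableState s) (hx : Measurable x)
    (hv : ∀ θ, (s θ).Valid) (hx0 : ∀ θ, x θ ≠ 0 ∧ ‖x θ‖ ≤ 1) (q₀ : Eucl d) :
    MeasurableSet {θ | IsFar q₀ (s θ) (x θ)} :=
  measurableSet_lt ((measurable_from_top (f := beta d)).comp (measurable_scale hs hx hv hx0))
    ((measurable_scale_median hs hx hv hx0).sub (hx.inner measurable_const)).abs

theorem measurable_indicator_nat {p : Θ → Prop} [DecidablePred p] (hp : MeasurableSet {θ | p θ}) :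
    Measurable fun θ => if p θ then 1 else 0 :=
  Measurable.ite hp (measurable_const (a := (1 : ℕ))) (measurable_const (a := (0 : ℕ)))

theorem MeasurableState.measurable_inverseWeight_mul_pow (hs : MeasurableState s) (hx : Measurable x)
    (hv : ∀ θ, (s θ).Valid) (hx0 : ∀ θ, x θ ≠ 0 ∧ ‖x θ‖ ≤ 1) (q₀ : Eucl d) (j : ℕ)
    (c : ENNReal) {n : Θ → ℕ} (hn : Measurable n) :
    Measurable fun z : Θ × (ℝ × Bool) => ENNReal.ofReal (inverseWeight
      (NoisySearch.step q₀ (s z.1) (x z.1) z.2.1 z.2.2) q₀ j) * c ^ n z.1 :=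
  ((((hs.step hx hv hx0 q₀).w_apply j q₀).inv).const_mul _).ennreal_ofReal.mul
    (((measurable_from_top (f := fun n : ℕ => c ^ n)).comp hn).comp measurable_fst)

end Generic

theorem SmallPenalty.margin_le {p κ : ℝ} {d : ℕ} (hP : SmallPenalty p κ d) : κ ≤ 1 := by
  have : 0 ≤ p / (1 - eta d) := div_nonneg hP.nonneg one_sub_eta_pos.le
  linarith [hP.drift, hP.nonneg]

/-- The rounds played at scale `i` with the median far from the true value. -/
def FarAt {d : ℕ} (q₀ : Eucl d) (i : ℕ) (s : State d) (x : Eucl d) : Prop :=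
  scale s x = i ∧ IsFar q₀ s x

/-- The rounds played at scale `i` with the median near the true value. -/
def NearAt {d : ℕ} (q₀ : Eucl d) (i : ℕ) (s : State d) (x : Eucl d) : Prop :=
  scale s x = i ∧ ¬IsFar q₀ s x

variable {Ω : Type*} [mΩ : MeasurableSpace Ω] {P : Measure Ω} {p : ℝ}
  {d : ℕ} {𝓕 : Filtration ℕ mΩ} {x : ℕ → Ω → Eucl d} {u : ℕ → Ω → ℝ} {flip : ℕ → Ω → Bool}

namespace IsEnvironment

variable (h : IsEnvironment P p 𝓕 x u flip)
include h

theorem measurable_u (t : ℕ) : Measurable (u t) := (h.u_measurable t).mono (𝓕.le _) le_rfl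

theorem measurable_flip (t : ℕ) : Measurable (flip t) :=
  (h.flip_measurable t).mono (𝓕.le _) le_rfl

theorem map_u (t : ℕ) : P.map (u t) = uniformLaw := by
  have := h.u_uniform t
  rw [pdf.IsUniform] at this
  rw [this, ProbabilityTheory.cond, uniformLaw, Real.volume_Icc,
    ← ENNReal.ofReal_inv_of_pos (by norm_num)]
  norm_num

theorem map_flip [IsProbabilityMeasure P] (hp0 : 0 ≤ p) (hp1 : p ≤ 1) (t : ℕ) : P.map (flip t) = bitLaw p := by
  have hm := h.measurable_flip t
  have h1 := isProbabilityMeasure_bitLaw hp0 hp1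
  have h2 : IsProbabilityMeasure (P.map (flip t)) :=
    Measure.isProbabilityMeasure_map hm.aemeasurable
  have ht : P.map (flip t) {true} = ENNReal.ofReal p := by
    rw [Measure.map_apply hm (measurableSet_singleton _)]
    exact h.flip_prob t
  have ht' : bitLaw p {true} = ENNReal.ofReal p := by
    simp [bitLaw]
  have hc : ({false} : Set Bool) = {true}ᶜ := by ext b; cases b <;> simp
  refine Measure.ext_of_singleton fun b => ?_
  cases b
  · rw [hc, prob_compl_eq_one_sub (measurableSet_singleton _),
      prob_compl_eq_one_sub (measurableSet_singleton _), ht, ht']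
  · rw [ht, ht']

theorem map_noise [IsProbabilityMeasure P] (hp0 : 0 ≤ p) (hp1 : p ≤ 1) (t : ℕ) :
    P.map (fun ω => (u t ω, flip t ω)) = noiseLaw p := by
  rw [(indepFun_iff_map_prod_eq_prod_map_map (h.measurable_u t).aemeasurable
    (h.measurable_flip t).aemeasurable).1 (h.u_indep_flip t), h.map_u, h.map_flip hp0 hp1, noiseLaw]

theorem lintegral_noise [IsProbabilityMeasure P] (hp0 : 0 ≤ p) (hp1 : p ≤ 1) (t : ℕ) {g : Ω × (ℝ × Bool) → ENNReal}
    (hg : Measurable[(𝓕 t).prod inferInstance] g) :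
    ∫⁻ ω, g (ω, (u t ω, flip t ω)) ∂P = ∫⁻ ω, ∫⁻ v, g (ω, v) ∂noiseLaw p ∂P := by
  rw [← h.map_noise hp0 hp1 t]
  exact lintegral_prod_of_indep (𝓕.le t) ((h.measurable_u t).prodMk (h.measurable_flip t))
    (h.indep_past t) hg

end IsEnvironment

/-- The random state before round `t`. -/
noncomputable def path (q₀ : Eucl d) (x : ℕ → Ω → Eucl d) (u : ℕ → Ω → ℝ) (flip : ℕ → Ω → Bool)
    (t : ℕ) (ω : Ω) : State d :=
  run q₀ (fun t => x t ω) (fun t => u t ω) (fun t => flip t ω) t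

omit mΩ in
theorem path_succ (q₀ : Eucl d) (t : ℕ) (ω : Ω) :
    path q₀ x u flip (t + 1) ω = step q₀ (path q₀ x u flip t ω) (x t ω) (u t ω) (flip t ω) := rfl

namespace IsEnvironment

variable (h : IsEnvironment P p 𝓕 x u flip) (q₀ : Eucl d)
include h

theorem valid_path (t : ℕ) (ω : Ω) : (path q₀ x u flip t ω).Valid := by
  induction t with
  | zero => exact valid_init
  | succ t ih => exact ih.step q₀ (h.context_mem t ω).1 (h.context_mem t ω).2 _ _

theorem measurableState_path (t : ℕ) :
    @MeasurableState d Ω (𝓕 t) (path q₀ x u flip t) := by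
  induction t with
  | zero => exact @measurableState_const Ω (𝓕 0) d (init d) valid_init
  | succ t ih =>
    have h1 := @MeasurableState.step d Ω (𝓕 t) (path q₀ x u flip t) (x t) ih
      (h.context_measurable t) (h.valid_path q₀ t) (h.context_mem t) q₀
    have h2 : @Measurable Ω (Ω × (ℝ × Bool)) (𝓕 (t + 1))
        (@Prod.instMeasurableSpace Ω (ℝ × Bool) (𝓕 t) _) (fun ω => (ω, (u t ω, flip t ω))) :=
      Measurable.prodMk (measurable_id'' (𝓕.mono (Nat.le_succ t)))
        (Measurable.prodMk (h.u_measurable t) (h.flip_measurable t))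
    have h3 : path q₀ x u flip (t + 1) = fun ω =>
        NoisySearch.step q₀ (path q₀ x u flip t ω) (x t ω) (u t ω) (flip t ω) :=
      funext fun ω => path_succ q₀ t ω
    rw [h3]
    exact @MeasurableState.comp (Ω × (ℝ × Bool)) Ω
      (@Prod.instMeasurableSpace Ω (ℝ × Bool) (𝓕 t) _) (𝓕 (t + 1)) d
      (fun z => NoisySearch.step q₀ (path q₀ x u flip t z.1) (x t z.1) z.2.1 z.2.2) h1
      (fun ω => (ω, (u t ω, flip t ω))) h2

theorem measurable_path_scale (t : ℕ) :
    Measurable[𝓕 t] fun ω => scale (path q₀ x u flip t ω) (x t ω) :=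
  @measurable_scale d Ω (𝓕 t) _ _ (h.measurableState_path q₀ t) (h.context_measurable t)
    (h.valid_path q₀ t) (h.context_mem t)

theorem measurableSet_path_isFar (t : ℕ) :
    MeasurableSet[𝓕 t] {ω | IsFar q₀ (path q₀ x u flip t ω) (x t ω)} :=
  @measurableSet_isFar Ω (𝓕 t) d _ _ (h.measurableState_path q₀ t) (h.context_measurable t)
    (h.valid_path q₀ t) (h.context_mem t) q₀

end IsEnvironment

open Classical in
/-- The number of rounds before `t` in which the event `I` occurs. -/
noncomputable def countRounds (I : State d → Eucl d → Prop) (S : ℕ → Ω → State d)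
    (x : ℕ → Ω → Eucl d) (t : ℕ) (ω : Ω) : ℕ :=
  ∑ r ∈ Finset.range t, if I (S r ω) (x r ω) then 1 else 0

open Classical in
omit mΩ in
theorem countRounds_succ (I : State d → Eucl d → Prop) (S : ℕ → Ω → State d) (t : ℕ) (ω : Ω) :
    countRounds I S x (t + 1) ω =
      countRounds I S x t ω + if I (S t ω) (x t ω) then 1 else 0 :=
  Finset.sum_range_succ _ _

namespace IsEnvironment

variable (h : IsEnvironment P p 𝓕 x u flip) (q₀ : Eucl d)
include h

omit h in
theorem measurable_countRounds {I : State d → Eucl d → Prop} {S : ℕ → Ω → State d}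
    (hI : ∀ t, MeasurableSet[𝓕 t] {ω | I (S t ω) (x t ω)}) (t : ℕ) :
    Measurable[𝓕 t] (countRounds I S x t) := by
  classical
  unfold countRounds
  refine @Finset.measurable_fun_sum _ _ _ _ _ _ (𝓕 t) _ _ fun r hr => ?_
  exact @measurable_indicator_nat Ω (𝓕 t) _ _ (𝓕.mono (Finset.mem_range.1 hr).le _ (hI r))

/-- Each round in which `I` holds contracts the inverse weight by `α`, exactly compensating the
additional factor `α⁻¹`; in all other rounds the inverse weight is still a supermartingale. -/
theorem lintegral_inverseWeight_mul_pow_le [IsProbabilityMeasure P] {κ : ℝ} (hP : SmallPenalty p κ d)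
    {I : State d → Eucl d → Prop} {j : ℕ} {α : ℝ} (hα : 0 < α)
    (hI : ∀ t, MeasurableSet[𝓕 t] {ω | I (path q₀ x u flip t ω) (x t ω)})
    (hstep : ∀ (s : State d) (x : Eucl d), s.Valid → x ≠ 0 → ‖x‖ ≤ 1 → I s x →
      ∫⁻ v, ENNReal.ofReal (inverseWeight (step q₀ s x v.1 v.2) q₀ j) ∂noiseLaw p ≤
        ENNReal.ofReal (inverseWeight s q₀ j * α)) (t : ℕ) :
    ∫⁻ ω, ENNReal.ofReal (inverseWeight (path q₀ x u flip t ω) q₀ j) *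
      ENNReal.ofReal α⁻¹ ^ countRounds I (path q₀ x u flip) x t ω ∂P ≤ 1 := by
  classical
  induction t with
  | zero =>
    have h1 : ∀ ω, inverseWeight (path q₀ x u flip 0 ω) q₀ j = 1 := fun ω => by
      have := volumeReal_ball_pos (d := d)
      change (volume.real (ball d))⁻¹ * (1 / volume.real (ball d))⁻¹ = 1
      rw [one_div, inv_inv, inv_mul_cancel₀ this.ne']
    simp [h1, countRounds]
  | succ t ih =>
    refine le_trans ?_ ih
    -- Whether `I` holds in round `t` is decided before the noise of that round, so the count
    -- including round `t` is still `𝓕 t`-measurable.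
    let n : Ω → ℕ := countRounds I (path q₀ x u flip) x (t + 1)
    have hn : Measurable[𝓕 t] n := by
      have : n = fun ω => countRounds I (path q₀ x u flip) x t ω +
          if I (path q₀ x u flip t ω) (x t ω) then 1 else 0 :=
        funext fun ω => countRounds_succ I _ t ω
      rw [this]
      exact (measurable_countRounds hI t).add
        (@measurable_indicator_nat Ω (𝓕 t) _ _ (hI t))
    let g : Ω × (ℝ × Bool) → ENNReal := fun z =>
      ENNReal.ofReal (inverseWeight
        (step q₀ (path q₀ x u flip t z.1) (x t z.1) z.2.1 z.2.2) q₀ j) *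
      ENNReal.ofReal α⁻¹ ^ n z.1
    have hg : Measurable[(𝓕 t).prod inferInstance] g :=
      @MeasurableState.measurable_inverseWeight_mul_pow Ω (𝓕 t) d _ _ (h.measurableState_path q₀ t)
        (h.context_measurable t) (h.valid_path q₀ t) (h.context_mem t) q₀ j _ n hn
    refine (h.lintegral_noise hP.nonneg (by linarith [hP.le_half]) t hg).le.trans
      (lintegral_mono fun ω => ?_)
    have hv := h.valid_path q₀ t ω
    obtain ⟨hx, hx1⟩ := h.context_mem t ω
    simp only [g]
    rw [lintegral_mul_const' _ _ (ENNReal.pow_ne_top ENNReal.ofReal_ne_top)]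
    by_cases hIω : I (path q₀ x u flip t ω) (x t ω)
    · have hnω : n ω = countRounds I (path q₀ x u flip) x t ω + 1 := by
        simp only [n, countRounds_succ, if_pos hIω]
      calc _ ≤ ENNReal.ofReal (inverseWeight (path q₀ x u flip t ω) q₀ j * α) *
            ENNReal.ofReal α⁻¹ ^ n ω := by
              gcongr
              exact hstep _ _ hv hx hx1 hIω
        _ = _ := by
              have h0 : ENNReal.ofReal α * ENNReal.ofReal α⁻¹ = 1 := by
                rw [← ENNReal.ofReal_mul hα.le, mul_inv_cancel₀ hα.ne', ENNReal.ofReal_one]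
              rw [hnω, pow_succ', ENNReal.ofReal_mul (hv.inverseWeight_pos q₀ j).le, mul_assoc,
                ← mul_assoc (ENNReal.ofReal α), h0, one_mul]
    · have hnω : n ω = countRounds I (path q₀ x u flip) x t ω := by
        simp only [n, countRounds_succ, if_neg hIω, add_zero]
      rw [hnω]
      gcongr
      exact lintegral_inverseWeight_step_le_self hP hv hx hx1 q₀ j

theorem measurableSet_farAt (i t : ℕ) :
    MeasurableSet[𝓕 t] {ω | FarAt q₀ i (path q₀ x u flip t ω) (x t ω)} :=
  (h.measurable_path_scale q₀ t (measurableSet_singleton i)).inter (h.measurableSet_path_isFar q₀ t)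

theorem measurableSet_nearAt (i t : ℕ) :
    MeasurableSet[𝓕 t] {ω | NearAt q₀ i (path q₀ x u flip t ω) (x t ω)} :=
  (h.measurable_path_scale q₀ t (measurableSet_singleton i)).inter
    (h.measurableSet_path_isFar q₀ t).compl

theorem lintegral_inverseWeight_farAt_le [IsProbabilityMeasure P] {κ : ℝ} (hP : SmallPenalty p κ d) (i t : ℕ) :
    ∫⁻ ω, ENNReal.ofReal (inverseWeight (path q₀ x u flip t ω) q₀ i) *
      ENNReal.ofReal (1 - κ * eta d * (1 / 8))⁻¹ ^
        countRounds (FarAt q₀ i) (path q₀ x u flip) x t ω ∂P ≤ 1 := by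
  have hη := eta_nonneg (d := d)
  have hη' := eta_le_half (d := d)
  have hκ := hP.margin_le
  have hκ0 := hP.margin_pos
  refine h.lintegral_inverseWeight_mul_pow_le q₀ hP (by nlinarith)
    (fun t => h.measurableSet_farAt q₀ i t) (fun s x hs hx hx1 hI => ?_) t
  obtain ⟨rfl, hfar⟩ := hI
  obtain ⟨f, h1, h2, h3, h4⟩ := exists_wrongMass_bound_of_isFar hs hx hfar
  exact lintegral_inverseWeight_step_le hP hs hx hx1 q₀ (Or.inl rfl) h1 h2 h3 h4

theorem lintegral_inverseWeight_nearAt_le [IsProbabilityMeasure P] {κ : ℝ} (hP : SmallPenalty p κ d) (i t : ℕ) :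
    ∫⁻ ω, ENNReal.ofReal (inverseWeight (path q₀ x u flip t ω) q₀ (i + 1)) *
      ENNReal.ofReal (1 - κ * eta d * (gamma (i + 1) ^ (4 * d) / 4))⁻¹ ^
        countRounds (NearAt q₀ i) (path q₀ x u flip) x t ω ∂P ≤ 1 := by
  have hη := eta_nonneg (d := d)
  have hη' := eta_le_half (d := d)
  have hκ := hP.margin_le
  have hκ0 := hP.margin_pos
  have hγ : gamma (i + 1) ^ (4 * d) ≤ 1 :=
    pow_le_one₀ (gamma_pos _).le ((gamma_le_half (Nat.succ_pos i)).trans (by norm_num))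
  have hγ0 : 0 < gamma (i + 1) ^ (4 * d) := pow_pos (gamma_pos _) _
  have hκη : κ * eta d ≤ 1 / 2 := by nlinarith
  have hκη0 : 0 ≤ κ * eta d := by positivity
  refine h.lintegral_inverseWeight_mul_pow_le q₀ hP (by nlinarith)
    (fun t => h.measurableSet_nearAt q₀ i t) (fun s x hs hx hx1 hI => ?_) t
  obtain ⟨rfl, hfar⟩ := hI
  obtain ⟨f, h1, h2, h3, h4⟩ := exists_wrongMass_bound_of_not_isFar hs hx hx1 hfar
  exact lintegral_inverseWeight_step_le hP hs hx hx1 q₀ (Or.inr rfl) h1 h2 h3 h4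

end IsEnvironment

end SamplePath

end NoisySearch

/-! ### Near misses, and the ratio potential along the run. -/

namespace NoisySearch

/-- The rounds in which the density at scale `j` is updated. -/
def UpdatesAt {d : ℕ} (j : ℕ) (s : State d) (x : Eucl d) : Prop :=
  j = scale s x ∨ j = scale s x + 1

section Generic

variable {Θ : Type*} [MeasurableSpace Θ] {d : ℕ} {s : Θ → State d} {x : Θ → Eucl d}

theorem measurableSet_near_query (hs : MeasurableState s) (hx : Measurable x)
    (hv : ∀ θ, (s θ).Valid) (hx0 : ∀ θ, x θ ≠ 0 ∧ ‖x θ‖ ≤ 1) (q₀ : Eucl d) (j : ℕ) (ρ : ℝ) :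
    MeasurableSet {z : Θ × (ℝ × Bool) | UpdatesAt j (s z.1) (x z.1) ∧
      |query (s z.1) (x z.1) z.2.1 - inner ℝ (x z.1) q₀| ≤ ρ} := by
  have h1 : Measurable fun z : Θ × (ℝ × Bool) => scale (s z.1) (x z.1) :=
    (measurable_scale hs hx hv hx0).comp measurable_fst
  exact (h1 (MeasurableSet.of_discrete (s := {n : ℕ | j = n ∨ j = n + 1}))).inter
    (measurableSet_le ((measurable_query hs hx hv hx0).sub
      ((hx.comp measurable_fst).inner measurable_const)).abs measurable_const)

theorem MeasurableState.measurable_ratio (hs : MeasurableState s) (q₀ : Eucl d) (l : ℝ) (n j : ℕ) :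
    Measurable fun z : Θ × Eucl d => ratio ((s z.1).w j) q₀ l n z.2 := by
  have h1 : Measurable fun z : Θ × Eucl d => (s z.1).w j (contract q₀ l z.2) :=
    (hs.w j).comp (measurable_fst.prodMk ((measurable_contract q₀ l).comp measurable_snd))
  have h2 : Measurable fun z : Θ × Eucl d => (s z.1).w j q₀ :=
    (hs.w_apply j q₀).comp measurable_fst
  exact (((hs.w j).div h1).pow_const n).mul (h1.div h2)

theorem MeasurableState.measurable_ratio_mul (hs : MeasurableState s) (hx : Measurable x)
    (hv : ∀ θ, (s θ).Valid) (hx0 : ∀ θ, x θ ≠ 0 ∧ ‖x θ‖ ≤ 1) (q₀ : Eucl d) (l : ℝ) (n j : ℕ)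
    (q : Eucl d) {k : Θ → ℕ} (hk : Measurable k) :
    Measurable fun z : Θ × (ℝ × Bool) => ENNReal.ofReal (ratio
      ((NoisySearch.step q₀ (s z.1) (x z.1) z.2.1 z.2.2).w j) q₀ l n q) * (k z.1 : ENNReal) :=
  (((hs.step hx hv hx0 q₀).measurable_ratio q₀ l n j).comp
    (measurable_id.prodMk measurable_const)).ennreal_ofReal.mul
    (((measurable_from_top (f := fun n : ℕ => (n : ENNReal))).comp hk).comp measurable_fst)

end Generic

section SamplePath

variable {Ω : Type*} [mΩ : MeasurableSpace Ω] {P : Measure Ω} {p : ℝ}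
  {d : ℕ} {𝓕 : Filtration ℕ mΩ} {x : ℕ → Ω → Eucl d} {u : ℕ → Ω → ℝ} {flip : ℕ → Ω → Bool}

/-- Before round `t`, the density at scale `j` was updated with a query at distance at most `ρ`
from the true value. -/
def nearMiss (q₀ : Eucl d) (x : ℕ → Ω → Eucl d) (u : ℕ → Ω → ℝ) (flip : ℕ → Ω → Bool) (j : ℕ)
    (ρ : ℝ) (t : ℕ) : Set Ω :=
  ⋃ r ∈ Finset.range t, {ω | UpdatesAt j (path q₀ x u flip r ω) (x r ω) ∧
    |query (path q₀ x u flip r ω) (x r ω) (u r ω) - inner ℝ (x r ω) q₀| ≤ ρ}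

omit mΩ in
open Classical in
theorem countRounds_mono_time {I : State d → Eucl d → Prop} (S : ℕ → Ω → State d) (ω : Ω) {r t : ℕ}
    (hrt : r ≤ t) : countRounds I S x r ω ≤ countRounds I S x t ω :=
  Finset.sum_le_sum_of_subset (Finset.range_mono hrt)

omit mΩ in
theorem count_path_succ (q₀ : Eucl d) (i t : ℕ) (ω : Ω) :
    (path q₀ x u flip (t + 1) ω).C i = (path q₀ x u flip t ω).C i +
      if scale (path q₀ x u flip t ω) (x t ω) = i then 1 else 0 := by
  rw [path_succ]
  simp only [step, eq_comm (a := i)]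
  split_ifs <;> rfl

omit mΩ in
theorem count_eq_countRounds (q₀ : Eucl d) (i t : ℕ) (ω : Ω) :
    (path q₀ x u flip t ω).C i =
      countRounds (fun s x => scale s x = i) (path q₀ x u flip) x t ω := by
  induction t with
  | zero => rfl
  | succ t ih =>
    rw [countRounds_succ, count_path_succ, ih]
    split_ifs <;> rfl

omit mΩ in
open Classical in
theorem count_eq_far_add_near (q₀ : Eucl d) (i t : ℕ) (ω : Ω) :
    (path q₀ x u flip t ω).C i = countRounds (FarAt q₀ i) (path q₀ x u flip) x t ω +
      countRounds (NearAt q₀ i) (path q₀ x u flip) x t ω := by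
  rw [count_eq_countRounds, countRounds, countRounds, countRounds, ← Finset.sum_add_distrib]
  refine Finset.sum_congr rfl fun r _ => ?_
  unfold FarAt NearAt
  by_cases h1 : scale (path q₀ x u flip r ω) (x r ω) = i <;>
    by_cases h2 : IsFar q₀ (path q₀ x u flip r ω) (x r ω) <;> simp [h1, h2]

omit mΩ in
open Classical in
theorem countRounds_updatesAt_le (q₀ : Eucl d) (j t : ℕ) (ω : Ω) :
    countRounds (UpdatesAt (j + 1)) (path q₀ x u flip) x t ω ≤
      (path q₀ x u flip t ω).C (j + 1) + (path q₀ x u flip t ω).C j := by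
  rw [count_eq_countRounds, count_eq_countRounds, countRounds, countRounds, countRounds,
    ← Finset.sum_add_distrib]
  refine Finset.sum_le_sum fun r _ => ?_
  unfold UpdatesAt
  split_ifs <;> omega

namespace IsEnvironment

variable (h : IsEnvironment P p 𝓕 x u flip) (q₀ : Eucl d)
include h

theorem measurableState_path' (t : ℕ) : MeasurableState (path q₀ x u flip t) := by
  have h1 := @MeasurableState.comp Ω Ω (𝓕 t) mΩ d (path q₀ x u flip t)
    (h.measurableState_path q₀ t) id (measurable_id'' (𝓕.le t))
  exact h1

theorem measurable_context (t : ℕ) : Measurable (x t) :=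
  (h.context_measurable t).mono (𝓕.le t) le_rfl

theorem measurableSet_path_near_query (j : ℕ) (ρ : ℝ) (r : ℕ) :
    MeasurableSet {ω | UpdatesAt j (path q₀ x u flip r ω) (x r ω) ∧
      |query (path q₀ x u flip r ω) (x r ω) (u r ω) - inner ℝ (x r ω) q₀| ≤ ρ} := by
  have h1 := measurableSet_near_query (h.measurableState_path' q₀ r) (h.measurable_context r)
    (h.valid_path q₀ r) (h.context_mem r) q₀ j ρ
  have h2 : Measurable fun ω => (ω, (u r ω, flip r ω)) :=
    measurable_id.prodMk ((h.measurable_u r).prodMk (h.measurable_flip r))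
  exact h2 h1

theorem measurableSet_nearMiss (j : ℕ) (ρ : ℝ) (t : ℕ) :
    MeasurableSet (nearMiss q₀ x u flip j ρ t) :=
  Finset.measurableSet_biUnion _ fun r _ => h.measurableSet_path_near_query q₀ j ρ r

open Classical in
theorem measure_near_query_le [IsProbabilityMeasure P] (hp0 : 0 ≤ p) (hp1 : p ≤ 1) (j : ℕ) {ρ : ℝ}
    (hρ : 0 ≤ ρ) (r : ℕ) :
    P {ω | UpdatesAt j (path q₀ x u flip r ω) (x r ω) ∧
      |query (path q₀ x u flip r ω) (x r ω) (u r ω) - inner ℝ (x r ω) q₀| ≤ ρ} ≤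
    ∫⁻ ω, ENNReal.ofReal (ρ / (2 * beta d j)) *
      ((if UpdatesAt j (path q₀ x u flip r ω) (x r ω) then 1 else 0 : ℕ) : ENNReal) ∂P := by
  let E : Set (Ω × (ℝ × Bool)) := {z | UpdatesAt j (path q₀ x u flip r z.1) (x r z.1) ∧
    |query (path q₀ x u flip r z.1) (x r z.1) z.2.1 - inner ℝ (x r z.1) q₀| ≤ ρ}
  have hE : MeasurableSet[(𝓕 r).prod inferInstance] E :=
    @measurableSet_near_query Ω (𝓕 r) d _ _ (h.measurableState_path q₀ r)
      (h.context_measurable r) (h.valid_path q₀ r) (h.context_mem r) q₀ j ρ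
  have hE' : MeasurableSet {ω | (ω, (u r ω, flip r ω)) ∈ E} :=
    h.measurableSet_path_near_query q₀ j ρ r
  have h1 := h.lintegral_noise hp0 hp1 r (g := E.indicator fun _ => 1)
    ((@measurable_const _ _ _ _ 1).indicator hE)
  have h2 : ∫⁻ ω, E.indicator (fun _ => (1 : ENNReal)) (ω, (u r ω, flip r ω)) ∂P =
      P {ω | (ω, (u r ω, flip r ω)) ∈ E} := by
    rw [← lintegral_indicator_one hE']
    rfl
  change P {ω | (ω, (u r ω, flip r ω)) ∈ E} ≤ _
  rw [← h2, h1]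
  refine lintegral_mono fun ω => ?_
  by_cases hu : UpdatesAt j (path q₀ x u flip r ω) (x r ω)
  · rw [if_pos hu, Nat.cast_one, mul_one]
    calc ∫⁻ v, E.indicator (fun _ => (1 : ENNReal)) (ω, v) ∂noiseLaw p
        ≤ noiseLaw p {v | |query (path q₀ x u flip r ω) (x r ω) v.1 - inner ℝ (x r ω) q₀| ≤ ρ} := by
          refine le_trans (lintegral_mono fun v => ?_) (lintegral_indicator_one_le _)
          by_cases hv : (ω, v) ∈ E
          · rw [indicator_of_mem hv, indicator_of_mem (show v ∈ {v : ℝ × Bool |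
              |query (path q₀ x u flip r ω) (x r ω) v.1 - inner ℝ (x r ω) q₀| ≤ ρ} from hv.2)]
            rfl
          · rw [indicator_of_notMem hv]
            exact zero_le
      _ ≤ ENNReal.ofReal (ρ / (2 * beta d (scale (path q₀ x u flip r ω) (x r ω)))) :=
          noiseLaw_query_near_le hp0 hp1 _ _ _ _
      _ ≤ _ := by
          refine ENNReal.ofReal_le_ofReal ?_
          have h3 := beta_pos (d := d) j
          -- A density is updated only at its own scale or one below, where the perturbation is at
          -- least as wide.
          have h4 : beta d j ≤ beta d (scale (path q₀ x u flip r ω) (x r ω)) := by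
            unfold beta
            refine one_div_le_one_div_of_le (by positivity) (pow_le_pow_right₀ one_le_two ?_)
            refine Nat.mul_le_mul_left _ ?_
            rcases hu with hu | hu <;> omega
          gcongr
  · have h5 : ∀ v, (ω, v) ∉ E := fun v hv => hu hv.1
    simp [h5]

/-- A union bound over the rounds that update scale `j` only; their number is bounded by `N`, so the
horizon does not enter. -/
theorem measure_nearMiss_le [IsProbabilityMeasure P] (hp0 : 0 ≤ p) (hp1 : p ≤ 1) (j : ℕ) {ρ : ℝ}
    (hρ : 0 ≤ ρ) (t N : ℕ)
    (hN : ∀ ω, countRounds (UpdatesAt j) (path q₀ x u flip) x t ω ≤ N) :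
    P (nearMiss q₀ x u flip j ρ t) ≤ ENNReal.ofReal (ρ / (2 * beta d j)) * N := by
  classical
  refine (measure_biUnion_finset_le _ _).trans ?_
  refine (Finset.sum_le_sum fun r _ => h.measure_near_query_le q₀ hp0 hp1 j hρ r).trans ?_
  have hm : ∀ r, Measurable fun ω => ENNReal.ofReal (ρ / (2 * beta d j)) *
      ((if UpdatesAt j (path q₀ x u flip r ω) (x r ω) then 1 else 0 : ℕ) : ENNReal) := fun r => by
    have h1 := measurable_scale (h.measurableState_path' q₀ r) (h.measurable_context r)
      (h.valid_path q₀ r) (h.context_mem r)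
    have h2 := measurable_indicator_nat
      (p := fun ω => UpdatesAt j (path q₀ x u flip r ω) (x r ω))
      (h1 (MeasurableSet.of_discrete (s := {n : ℕ | j = n ∨ j = n + 1})))
    exact ((measurable_from_top (f := fun n : ℕ => (n : ENNReal))).comp h2).const_mul _
  rw [← lintegral_finsetSum _ fun r _ => hm r]
  calc _ ≤ ∫⁻ _, ENNReal.ofReal (ρ / (2 * beta d j)) * N ∂P := by
        refine lintegral_mono fun ω => ?_
        rw [← Finset.mul_sum, ← Nat.cast_sum]
        gcongr
        exact hN ω
    _ = _ := by simp

-- Off the near-miss event every update treats the ball of radius `ρ` around `q₀` uniformly, and the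
-- initial density is constant.
omit h mΩ in
theorem w_eq_of_notMem_nearMiss (h : ∀ t ω, ‖x t ω‖ ≤ 1) {j : ℕ} {ρ : ℝ} {t : ℕ} {ω : Ω}
    (hω : ω ∉ nearMiss q₀ x u flip j ρ t) {q : Eucl d} (hq : ‖q - q₀‖ ≤ ρ) :
    (path q₀ x u flip t ω).w j q = (path q₀ x u flip t ω).w j q₀ := by
  induction t with
  | zero => rfl
  | succ t ih =>
    simp only [nearMiss, mem_iUnion, Finset.mem_range, not_exists] at hω ih
    rw [path_succ]
    refine step_w_eq_of_far (h t ω) hq (ih fun r hr => hω r (by omega)) fun hu => ?_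
    by_contra! hle
    exact hω t (by omega) ⟨hu, hle⟩

omit h mΩ in
theorem nearMiss_mono {j : ℕ} {ρ : ℝ} {r t : ℕ} (hrt : r ≤ t) :
    nearMiss q₀ x u flip j ρ r ⊆ nearMiss q₀ x u flip j ρ t :=
  biUnion_subset_biUnion_left fun _ ha =>
    Finset.mem_range.2 ((Finset.mem_range.1 ha).trans_le hrt)

theorem pow_le_inverseWeight (hq₀ : ‖q₀‖ ≤ 1) {j : ℕ} {l : ℝ} (hl0 : 0 < l) (hl1 : l ≤ 1) {t : ℕ}
    {ω : Ω} (hω : ω ∉ nearMiss q₀ x u flip j (2 * l) t) :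
    l ^ d ≤ inverseWeight (path q₀ x u flip t ω) q₀ j :=
  ((h.valid_path q₀ t ω).density j).pow_le_of_constant hq₀ hl0 hl1 fun _ hq =>
    w_eq_of_notMem_nearMiss q₀ (fun t ω => (h.context_mem t ω).2) hω hq

/-- The remaining budget `N - C_i` weights the potential. A round at scale `i` lowers the budget by
one and so pays for its own summand, and the supermartingale property handles the rest. Initially
the ratio is `1` and the budget is `N`. -/
theorem lintegral_ratio_add_sum_le [IsProbabilityMeasure P] {κ : ℝ} (hP : SmallPenalty p κ d)
    {i N : ℕ} {l : ℝ} (hl0 : 0 ≤ l) (hl1 : l ≤ 1)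
    (hN : ∀ t ω, (path q₀ x u flip t ω).C i ≤ N) (q : Eucl d) (t : ℕ) :
    ∫⁻ ω, ENNReal.ofReal (ratio ((path q₀ x u flip t ω).w i) q₀ l (200 * d) q) *
      ((N - (path q₀ x u flip t ω).C i : ℕ) : ENNReal) ∂P +
    ∑ r ∈ Finset.range t, ∫⁻ ω,
      ENNReal.ofReal (ratio ((path q₀ x u flip r ω).w i) q₀ l (200 * d) q) *
      ((if scale (path q₀ x u flip r ω) (x r ω) = i then 1 else 0 : ℕ) : ENNReal) ∂P ≤ N := by
  induction t with
  | zero =>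
    have h0 : ∀ ω, ratio ((path q₀ x u flip 0 ω).w i) q₀ l (200 * d) q = 1 := fun ω => by
      have hv := (volumeReal_ball_pos (d := d)).ne'
      change (1 / volume.real (ball d) / (1 / volume.real (ball d))) ^ (200 * d) *
        (1 / volume.real (ball d) / (1 / volume.real (ball d))) = 1
      rw [div_self (one_div_ne_zero hv)]
      simp
    have hC : ∀ ω, (path q₀ x u flip 0 ω).C i = 0 := fun ω => rfl
    simp [h0, hC]
  | succ t ih =>
    refine le_trans ?_ ih
    rw [Finset.sum_range_succ, add_comm (∑ r ∈ Finset.range t, _), ← add_assoc]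
    refine add_le_add_left ?_ _
    have hs := h.measurableState_path q₀ t
    have hsc := h.measurable_path_scale q₀ t
    let k : Ω → ℕ := fun ω => N - ((path q₀ x u flip t ω).C i +
      if scale (path q₀ x u flip t ω) (x t ω) = i then 1 else 0)
    have hI := @measurable_indicator_nat Ω (𝓕 t)
      (fun ω => scale (path q₀ x u flip t ω) (x t ω) = i) _ (hsc (measurableSet_singleton i))
    have hk : Measurable[𝓕 t] k :=
      measurable_const.sub ((@MeasurableState.C d Ω (𝓕 t) _ hs i).add hI)
    have hk' : ∀ ω, (N - (path q₀ x u flip (t + 1) ω).C i : ℕ) = k ω := fun ω => by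
      rw [count_path_succ]
    -- The cap `hN` at time `t + 1` prevents truncation of the natural-number subtraction.
    have hcount : ∀ ω, k ω + (if scale (path q₀ x u flip t ω) (x t ω) = i then 1 else 0) =
        N - (path q₀ x u flip t ω).C i := fun ω => by
      have := hN (t + 1) ω
      rw [count_path_succ] at this
      simp only [k]
      omega
    have hg := @MeasurableState.measurable_ratio_mul Ω (𝓕 t) d _ _ hs
      (h.context_measurable t) (h.valid_path q₀ t) (h.context_mem t) q₀ l (200 * d) i q k hk
    have h1 := h.lintegral_noise hP.nonneg (by linarith [hP.le_half]) t hg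
    have hmI : Measurable fun ω => ENNReal.ofReal
        (ratio ((path q₀ x u flip t ω).w i) q₀ l (200 * d) q) *
        ((if scale (path q₀ x u flip t ω) (x t ω) = i then 1 else 0 : ℕ) : ENNReal) :=
      (((h.measurableState_path' q₀ t).measurable_ratio q₀ l (200 * d) i).comp
        (measurable_id.prodMk measurable_const)).ennreal_ofReal.mul
        ((measurable_from_top (f := fun n : ℕ => (n : ENNReal))).comp (hI.mono (𝓕.le t) le_rfl))
    have h2 : ∫⁻ ω, ENNReal.ofReal (ratio ((path q₀ x u flip (t + 1) ω).w i) q₀ l (200 * d) q) *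
        ((N - (path q₀ x u flip (t + 1) ω).C i : ℕ) : ENNReal) ∂P = ∫⁻ ω, ∫⁻ v,
          ENNReal.ofReal (ratio ((step q₀ (path q₀ x u flip t ω) (x t ω) v.1 v.2).w i) q₀ l
            (200 * d) q) * (k ω : ENNReal) ∂noiseLaw p ∂P := by
      refine Eq.trans (lintegral_congr fun ω => ?_) h1
      rw [hk', path_succ]
    rw [h2]
    rw [← lintegral_add_right _ hmI]
    refine lintegral_mono fun ω => ?_
    obtain ⟨hx, hx1⟩ := h.context_mem t ω
    simp only
    rw [lintegral_mul_const' _ _ (ENNReal.natCast_ne_top _), ← hcount ω, Nat.cast_add, mul_add]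
    gcongr
    exact lintegral_ratio_step_le hP (h.valid_path q₀ t ω) hx hx1 q₀ i hl0 hl1 q

/-- The ratio potential, integrated over the unit ball. -/
noncomputable def _root_.NoisySearch.totalRatio {d : ℕ} (w : Eucl d → ℝ) (q₀ : Eucl d) (l : ℝ) :
    ENNReal :=
  ∫⁻ q in ball d, ENNReal.ofReal (ratio w q₀ l (200 * d) q)

theorem measurable_totalRatio (i : ℕ) (l : ℝ) (t : ℕ) :
    Measurable fun ω => totalRatio ((path q₀ x u flip t ω).w i) q₀ l :=
  ((h.measurableState_path' q₀ t).measurable_ratio q₀ l (200 * d) i).ennreal_ofReal.lintegral_prod_right'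

/-- Tonelli integrates the bound for each fixed `q` over the ball. -/
theorem sum_lintegral_totalRatio_le [IsProbabilityMeasure P] {κ : ℝ} (hP : SmallPenalty p κ d)
    {i N : ℕ} {l : ℝ} (hl0 : 0 ≤ l) (hl1 : l ≤ 1)
    (hN : ∀ t ω, (path q₀ x u flip t ω).C i ≤ N) (t : ℕ) :
    ∑ r ∈ Finset.range t, ∫⁻ ω, totalRatio ((path q₀ x u flip r ω).w i) q₀ l *
      ((if scale (path q₀ x u flip r ω) (x r ω) = i then 1 else 0 : ℕ) : ENNReal) ∂P ≤
      N * volume (ball d) := by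
  have hI : ∀ r, Measurable fun ω =>
      ((if scale (path q₀ x u flip r ω) (x r ω) = i then 1 else 0 : ℕ) : ENNReal) := fun r => by
    have h1 := measurable_scale (h.measurableState_path' q₀ r) (h.measurable_context r)
      (h.valid_path q₀ r) (h.context_mem r)
    exact (measurable_from_top (f := fun n : ℕ => (n : ENNReal))).comp
      (measurable_indicator_nat
        (p := fun ω => scale (path q₀ x u flip r ω) (x r ω) = i) (h1 (measurableSet_singleton i)))
  have hr := fun r => ((h.measurableState_path' q₀ r).measurable_ratio q₀ l (200 * d) i).ennreal_ofReal
  have hswap : ∀ r, ∫⁻ ω, totalRatio ((path q₀ x u flip r ω).w i) q₀ l *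
      ((if scale (path q₀ x u flip r ω) (x r ω) = i then 1 else 0 : ℕ) : ENNReal) ∂P =
      ∫⁻ q in ball d, ∫⁻ ω,
        ENNReal.ofReal (ratio ((path q₀ x u flip r ω).w i) q₀ l (200 * d) q) *
        ((if scale (path q₀ x u flip r ω) (x r ω) = i then 1 else 0 : ℕ) : ENNReal) ∂P := by
    intro r
    rw [← lintegral_lintegral_swap ((hr r).mul ((hI r).comp measurable_fst)).aemeasurable]
    refine lintegral_congr fun ω => ?_
    rw [totalRatio, lintegral_mul_const' _ _ (ENNReal.natCast_ne_top _)]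
  simp only [hswap]
  rw [← lintegral_finsetSum]
  · calc _ ≤ ∫⁻ _ in ball d, (N : ENNReal) := by
          refine lintegral_mono fun q => ?_
          exact le_add_self.trans (h.lintegral_ratio_add_sum_le q₀ hP hl0 hl1 hN q t)
      _ = _ := by simp
  · intro r _
    exact ((hr r).mul ((hI r).comp measurable_fst)).lintegral_prod_left'

end IsEnvironment

end SamplePath

end NoisySearch

namespace NoisySearch

/-! ### Numerical inequalities in large dimension. -/

section Arithmetic

variable {d : ℕ} {p κ : ℝ}

/-- The dimension is large compared with the noise level. -/
structure LargeDim (p κ : ℝ) (d : ℕ) : Prop extends SmallPenalty p κ d where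
  dim_pos : 0 < d
  pow_le : 1000 * (d : ℝ) ^ 25 ≤ 2 ^ d
  far : 100 ≤ κ * (d : ℝ) ^ 13
  near : 100 * (d : ℝ) ^ 8 ≤ κ * 2 ^ d

theorem cap_eq (d i : ℕ) :
    cap d i = 100 * ((d : ℝ) ^ 4 * i * 2 ^ (10 * d * i) + (d : ℝ) ^ 25 * i) := by
  unfold cap gamma
  rw [div_pow, one_pow, ← pow_mul, div_div_eq_mul_div, div_one]
  ring_nf

theorem one_le_cast_pow (hd : 0 < d) (n : ℕ) : (1 : ℝ) ≤ (d : ℝ) ^ n :=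
  one_le_pow₀ (by exact_mod_cast hd)

/-- The exponent is `10 + 1 + 1`: `10di` comes from the cap itself, one `di` absorbs `1000 d^25`,
the other absorbs `i`. -/
theorem LargeDim.cap_add_one_le (h : LargeDim p κ d) {i : ℕ} (hi : 0 < i) :
    cap d i + 1 ≤ 2 ^ (12 * d * i) := by
  have hd := h.dim_pos
  have h1 : (i : ℝ) ≤ 2 ^ (d * i) := by
    calc (i : ℝ) ≤ 2 ^ i := by exact_mod_cast Nat.lt_two_pow_self.le
      _ ≤ 2 ^ (d * i) := pow_le_pow_right₀ one_le_two (Nat.le_mul_of_pos_left i hd)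
  have h2 : (2 : ℝ) ^ d ≤ 2 ^ (d * i) :=
    pow_le_pow_right₀ one_le_two (Nat.le_mul_of_pos_right d hi)
  have h3 : (d : ℝ) ^ 4 ≤ (d : ℝ) ^ 25 :=
    pow_le_pow_right₀ (by exact_mod_cast hd) (by norm_num)
  have h4 := one_le_cast_pow hd 25
  have h5 : (1 : ℝ) ≤ i := by exact_mod_cast hi
  have h6 : (1 : ℝ) ≤ 2 ^ (10 * d * i) := one_le_pow₀ one_le_two
  rw [cap_eq]
  set X : ℝ := 2 ^ (10 * d * i)
  set D : ℝ := (d : ℝ) ^ 25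
  calc 100 * ((d : ℝ) ^ 4 * i * X + D * i) + 1
      ≤ 100 * (D * i * X + D * i * X) + D * i * X := by
        have e1 : (d : ℝ) ^ 4 * i * X ≤ D * i * X := by gcongr
        have e2 : D * i ≤ D * i * X := le_mul_of_one_le_right (by positivity) h6
        have e3 : (1 : ℝ) ≤ D * i := one_le_mul_of_one_le_of_one_le h4 h5
        linarith
    _ ≤ 1000 * D * i * X := by
        have : 0 ≤ D * i * X := by positivity
        linarith
    _ ≤ 2 ^ (d * i) * 2 ^ (d * i) * X := by
        gcongr
        exact h.pow_le.trans h2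
    _ = 2 ^ (12 * d * i) := by
        rw [← pow_add, ← pow_add]; congr 1; ring

theorem half_cap_far (d i : ℕ) : 50 * (d : ℝ) ^ 25 * i ≤ cap d i / 2 := by
  rw [cap_eq]
  have : 0 ≤ (d : ℝ) ^ 4 * i * 2 ^ (10 * d * i) := by positivity
  linarith

theorem half_cap_near (d i : ℕ) : 50 * (d : ℝ) ^ 4 * i * 2 ^ (10 * d * i) ≤ cap d i / 2 := by
  rw [cap_eq]
  have : 0 ≤ (d : ℝ) ^ 25 * i := by positivity
  linarith

theorem two_pow_mul_exp_neg_le {m n : ℕ} {y : ℝ} (h : (m : ℝ) + n ≤ y) :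
    2 ^ m * Real.exp (-y) ≤ (1 / 2) ^ n := by
  have h2 : Real.exp (-((m : ℝ) + n)) ≤ (1 / 2) ^ (m + n) := by
    have h1 : Real.exp (-1) ≤ 1 / 2 := by
      rw [Real.exp_neg, ← one_div]
      exact one_div_le_one_div_of_le two_pos (by linarith [Real.add_one_le_exp 1])
    calc Real.exp (-((m : ℝ) + n)) = Real.exp (-1) ^ (m + n) := by
          rw [← Real.exp_nat_mul]; congr 1; push_cast; ring
      _ ≤ _ := pow_le_pow_left₀ (Real.exp_pos _).le h1 _
  calc 2 ^ m * Real.exp (-y) ≤ 2 ^ m * (1 / 2) ^ (m + n) := by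
        gcongr
        exact (Real.exp_le_exp.2 (neg_le_neg h)).trans h2
    _ = (1 / 2) ^ n := by
        rw [pow_add, ← mul_assoc, ← mul_pow]; norm_num

/-- The `d^25` part of the cap beats `1 / η`: the exponent is at least `(25/8) * 100 * d² i`, which
covers `200 d² i + 87 d i`. -/
theorem LargeDim.far_tail (h : LargeDim p κ d) (i : ℕ) :
    2 ^ (200 * d * i * d) * Real.exp (-(κ * eta d * (1 / 8) * (cap d i / 2))) ≤
      (1 / 2) ^ (87 * d * i) := by
  refine two_pow_mul_exp_neg_le ?_
  have hd : (1 : ℝ) ≤ d := by exact_mod_cast h.dim_pos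
  have hκ := h.margin_pos
  have h1 : κ * eta d * (1 / 8) * (50 * (d : ℝ) ^ 25 * i) = 25 / 8 * (κ * d ^ 13) * d ^ 2 * i := by
    unfold eta; field_simp; ring
  have h2 : κ * eta d * (1 / 8) * (50 * (d : ℝ) ^ 25 * i) ≤ κ * eta d * (1 / 8) * (cap d i / 2) :=
    mul_le_mul_of_nonneg_left (half_cap_far d i)
      (mul_nonneg (mul_nonneg hκ.le eta_nonneg) (by norm_num))
  refine le_trans ?_ h2
  rw [h1]
  push_cast
  have h3 : 25 / 8 * 100 * (d : ℝ) ^ 2 * i ≤ 25 / 8 * (κ * d ^ 13) * d ^ 2 * i := by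
    gcongr
    exact h.far
  have h4 : (d : ℝ) * i ≤ d ^ 2 * i := by
    gcongr
    nlinarith
  have h5 : 0 ≤ (d : ℝ) ^ 2 * i := by positivity
  linarith

/-- The `γ_i^(-10d)` part of the cap compensates `γ_{i+1}^(4d)` with a factor `2^d` to spare,
already at `i = 1`; that factor absorbs `1 / η`, and the exponent is at least `625 d² i`. -/
theorem LargeDim.near_tail (h : LargeDim p κ d) {i : ℕ} (hi : 0 < i) :
    2 ^ (200 * d * (i + 1) * d) *
      Real.exp (-(κ * eta d * (gamma (i + 1) ^ (4 * d) / 4) * (cap d i / 2))) ≤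
      (1 / 2) ^ (87 * d * i) := by
  refine two_pow_mul_exp_neg_le ?_
  have hd : (1 : ℝ) ≤ d := by exact_mod_cast h.dim_pos
  have hi' : (1 : ℝ) ≤ i := by exact_mod_cast hi
  have hκ := h.margin_pos
  have h0 : (0 : ℝ) ≤ κ * eta d * (gamma (i + 1) ^ (4 * d) / 4) :=
    mul_nonneg (mul_nonneg hκ.le eta_nonneg) (div_nonneg (pow_nonneg (gamma_pos _).le _) (by norm_num))
  refine le_trans ?_ (mul_le_mul_of_nonneg_left (half_cap_near d i) h0)
  have hpow : (2 : ℝ) ^ (4 * d * (i + 1)) * 2 ^ d ≤ 2 ^ (10 * d * i) := by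
    rw [← pow_add]
    refine pow_le_pow_right₀ one_le_two ?_
    nlinarith [Nat.mul_le_mul h.dim_pos hi, Nat.le_mul_of_pos_right d hi]
  have h1 : κ * eta d * (gamma (i + 1) ^ (4 * d) / 4) *
      (50 * (d : ℝ) ^ 4 * i * (2 ^ (4 * d * (i + 1)) * 2 ^ d)) =
      25 / 4 * (κ * 2 ^ d) / d ^ 6 * i := by
    have : gamma (i + 1) ^ (4 * d) = 1 / 2 ^ (4 * d * (i + 1)) := by
      unfold gamma
      rw [div_pow, one_pow, ← pow_mul]
      congr 2
      ring
    rw [this]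
    unfold eta; field_simp; ring
  have h2 : 25 / 4 * (κ * 2 ^ d) / d ^ 6 * i ≤ κ * eta d * (gamma (i + 1) ^ (4 * d) / 4) *
      (50 * (d : ℝ) ^ 4 * i * 2 ^ (10 * d * i)) := by
    rw [← h1]
    gcongr
  refine le_trans ?_ h2
  have h3 : 25 / 4 * (100 * (d : ℝ) ^ 8) / d ^ 6 * i ≤ 25 / 4 * (κ * 2 ^ d) / d ^ 6 * i := by
    gcongr 25 / 4 * ?_ / (d : ℝ) ^ 6 * (i : ℝ)
    exact h.near
  refine le_trans ?_ h3
  have h4 : 25 / 4 * (100 * (d : ℝ) ^ 8) / d ^ 6 * i = 625 * (d ^ 2 * i) := by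
    field_simp; ring
  rw [h4]
  push_cast
  have h5 : (d : ℝ) * i ≤ d ^ 2 * i := by
    gcongr
    nlinarith
  have h6 : (d : ℝ) ^ 2 ≤ d ^ 2 * i := le_mul_of_one_le_right (by positivity) hi'
  have h7 : 0 ≤ (d : ℝ) ^ 2 * i := by positivity
  linarith

end Arithmetic

/-! ### From exponential moments to tails and means of the counts. -/

section Tails

variable {Ω : Type*} [mΩ : MeasurableSpace Ω] {P : Measure Ω}

theorem exp_mul_le_inv_pow {α : ℝ} (hα0 : 0 < α) (n : ℕ) :
    Real.exp ((1 - α) * n) ≤ α⁻¹ ^ n := by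
  have h : Real.exp (1 - α) ≤ α⁻¹ := by
    rw [← Real.exp_log (inv_pos.2 hα0), Real.log_inv]
    exact Real.exp_le_exp.2 (by linarith [Real.log_le_sub_one_of_pos hα0])
  rw [mul_comm, Real.exp_nat_mul]
  exact pow_le_pow_left₀ (Real.exp_pos _).le h n

/-- Markov's inequality for the exponential moment, using `exp (1 - α) ≤ α⁻¹`. -/
theorem measure_tail_le {X : Ω → ℕ} (hX : Measurable X) {E : Set Ω}
    {α B c : ℝ} (hα0 : 0 < α) (hα1 : α ≤ 1)
    (h : ∫⁻ ω in E, ENNReal.ofReal α⁻¹ ^ X ω ∂P ≤ ENNReal.ofReal B) :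
    P ({ω | c < X ω} ∩ E) ≤ ENNReal.ofReal (B * Real.exp (-((1 - α) * c))) := by
  have hm : MeasurableSet {ω | c < (X ω : ℝ)} :=
    measurableSet_lt measurable_const (measurable_from_top.comp hX)
  have h1 : ENNReal.ofReal (Real.exp ((1 - α) * c)) * P ({ω | c < X ω} ∩ E) ≤
      ENNReal.ofReal B := by
    refine le_trans ?_ h
    rw [← Measure.restrict_apply hm]
    refine le_trans ?_ (setLIntegral_le_lintegral {ω | c < (X ω : ℝ)} _)
    rw [← setLIntegral_const]
    refine setLIntegral_mono' hm fun ω hω => ?_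
    rw [← ENNReal.ofReal_pow (inv_nonneg.2 hα0.le)]
    refine ENNReal.ofReal_le_ofReal (le_trans (Real.exp_le_exp.2 ?_) (exp_mul_le_inv_pow hα0 _))
    exact mul_le_mul_of_nonneg_left (le_of_lt hω) (by linarith)
  have h2 : ENNReal.ofReal (Real.exp (-((1 - α) * c))) *
      ENNReal.ofReal (Real.exp ((1 - α) * c)) = 1 := by
    rw [← ENNReal.ofReal_mul (Real.exp_pos _).le, ← Real.exp_add, neg_add_cancel, Real.exp_zero,
      ENNReal.ofReal_one]
  calc P ({ω | c < X ω} ∩ E) = ENNReal.ofReal (Real.exp (-((1 - α) * c))) *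
        (ENNReal.ofReal (Real.exp ((1 - α) * c)) * P ({ω | c < X ω} ∩ E)) := by
        rw [← mul_assoc, h2, one_mul]
    _ ≤ ENNReal.ofReal (Real.exp (-((1 - α) * c))) * ENNReal.ofReal B := by gcongr
    _ = _ := by rw [← ENNReal.ofReal_mul (Real.exp_pos _).le, mul_comm]

/-- With `z = (1 - α) X`, the bound `z ≤ M + exp (z - M)` gives a mean linear in `M`, the logarithm
of the moment bound. -/
theorem setLIntegral_count_le [IsProbabilityMeasure P] {X : Ω → ℕ} {E : Set Ω}
    {α M : ℝ} (hα0 : 0 < α) (hα1 : α < 1) (hM : 0 ≤ M)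
    (h : ∫⁻ ω in E, ENNReal.ofReal α⁻¹ ^ X ω ∂P ≤ ENNReal.ofReal (Real.exp M)) :
    ∫⁻ ω in E, (X ω : ENNReal) ∂P ≤ ENNReal.ofReal ((M + 1) / (1 - α)) := by
  have h1 : ∀ ω, (X ω : ENNReal) ≤ ENNReal.ofReal (M / (1 - α)) +
      ENNReal.ofReal (Real.exp (-M) / (1 - α)) * ENNReal.ofReal α⁻¹ ^ X ω := fun ω => by
    have hα : 0 < 1 - α := by linarith
    rw [← ENNReal.ofReal_pow (inv_nonneg.2 hα0.le), ← ENNReal.ofReal_mul (by positivity),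
      ← ENNReal.ofReal_add (by positivity) (by positivity), ← ENNReal.ofReal_natCast]
    refine ENNReal.ofReal_le_ofReal ?_
    rw [div_mul_eq_mul_div, ← add_div, le_div_iff₀ hα]
    have h2 := Real.add_one_le_exp ((1 - α) * X ω - M)
    have h3 : Real.exp ((1 - α) * X ω - M) ≤ Real.exp (-M) * α⁻¹ ^ X ω := by
      rw [sub_eq_neg_add, Real.exp_add]
      gcongr
      exact exp_mul_le_inv_pow hα0 _
    linarith
  have hα : 0 < 1 - α := by linarith
  calc ∫⁻ ω in E, (X ω : ENNReal) ∂P ≤ ∫⁻ ω in E, (ENNReal.ofReal (M / (1 - α)) +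
        ENNReal.ofReal (Real.exp (-M) / (1 - α)) * ENNReal.ofReal α⁻¹ ^ X ω) ∂P :=
        lintegral_mono h1
    _ ≤ ENNReal.ofReal (M / (1 - α)) +
        ENNReal.ofReal (Real.exp (-M) / (1 - α)) * ENNReal.ofReal (Real.exp M) := by
        rw [lintegral_add_left measurable_const, setLIntegral_const,
          lintegral_const_mul' _ _ ENNReal.ofReal_ne_top]
        gcongr
        exact mul_le_of_le_one_right' prob_le_one
    _ = _ := by
        rw [← ENNReal.ofReal_mul (by positivity), ← ENNReal.ofReal_add (by positivity)
          (by positivity), div_mul_eq_mul_div, ← Real.exp_add, neg_add_cancel, Real.exp_zero,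
          ← add_div]

variable {p κ : ℝ} {d : ℕ} {𝓕 : Filtration ℕ mΩ} {x : ℕ → Ω → Eucl d} {u : ℕ → Ω → ℝ}
  {flip : ℕ → Ω → Bool}

/-- The distance at which a query counts as a near miss at scale `j`. -/
noncomputable def missRadius (d j : ℕ) : ℝ := (1 / 2) ^ (200 * d * j)

theorem missRadius_pos (d j : ℕ) : 0 < missRadius d j := by unfold missRadius; positivity

theorem missRadius_le_one (d j : ℕ) : missRadius d j ≤ 1 :=
  pow_le_one₀ (by norm_num) (by norm_num)

namespace IsEnvironment

variable (h : IsEnvironment P p 𝓕 x u flip) (hL : LargeDim p κ d) (q₀ : Eucl d)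
include h

include hL in
theorem count_le_two_pow (i t : ℕ) (ω : Ω) :
    (path q₀ x u flip t ω).C i ≤ 2 ^ (12 * d * i) := by
  rcases Nat.eq_zero_or_pos i with rfl | hi
  · rw [(h.valid_path q₀ t ω).count_zero]; exact Nat.zero_le _
  · have h1 := ((h.valid_path q₀ t ω).count_le i).trans (hL.cap_add_one_le hi)
    exact_mod_cast h1

theorem measurable_countRounds_farAt (i t : ℕ) :
    Measurable (countRounds (FarAt q₀ i) (path q₀ x u flip) x t) :=
  (measurable_countRounds (fun t => h.measurableSet_farAt q₀ i t) t).mono (𝓕.le t) le_rfl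

theorem measurable_countRounds_nearAt (i t : ℕ) :
    Measurable (countRounds (NearAt q₀ i) (path q₀ x u flip) x t) :=
  (measurable_countRounds (fun t => h.measurableSet_nearAt q₀ i t) t).mono (𝓕.le t) le_rfl

include hL in
-- The exponent is `200 - 100 - 12 = 88`, from radius, perturbation width and number of updates; the
-- remaining factor `2` costs one more unit.
theorem measure_nearMiss_le_pow [IsProbabilityMeasure P] {j : ℕ} (hj : 0 < j) (t : ℕ) :
    P (nearMiss q₀ x u flip j (2 * missRadius d j) t) ≤ ENNReal.ofReal ((1 / 2) ^ (87 * d * j)) := by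
  have hp0 := hL.nonneg
  have hp1 := hL.le_half
  obtain ⟨k, rfl⟩ : ∃ k, j = k + 1 := ⟨j - 1, by omega⟩
  have hN : ∀ ω, countRounds (UpdatesAt (k + 1)) (path q₀ x u flip) x t ω ≤
      2 * 2 ^ (12 * d * (k + 1)) := fun ω => by
    have h1 := countRounds_updatesAt_le (x := x) (u := u) (flip := flip) q₀ k t ω
    have h2 := h.count_le_two_pow hL q₀ (k + 1) t ω
    have h3 := h.count_le_two_pow hL q₀ k t ω
    have h4 : 2 ^ (12 * d * k) ≤ 2 ^ (12 * d * (k + 1)) :=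
      Nat.pow_le_pow_right two_pos (Nat.mul_le_mul_left _ (Nat.le_succ k))
    omega
  refine (h.measure_nearMiss_le q₀ hp0 (by linarith) (k + 1)
    (by linarith [missRadius_pos d (k + 1)]) t _ hN).trans ?_
  rw [← ENNReal.ofReal_natCast, ← ENNReal.ofReal_mul (by
    have := missRadius_pos d (k + 1)
    have := beta_pos (d := d) (k + 1)
    positivity)]
  refine ENNReal.ofReal_le_ofReal ?_
  unfold missRadius beta
  set m := d * (k + 1) with hm
  have hm1 : 1 ≤ m := Nat.mul_pos hL.dim_pos (Nat.succ_pos k)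
  have e : ∀ c : ℕ, c * d * (k + 1) = c * m := fun c => by rw [hm]; ring
  simp only [e]
  push_cast
  have h1 : 2 * (1 / 2 : ℝ) ^ (200 * m) / (2 * (1 / 2 ^ (100 * m))) * (2 * 2 ^ (12 * m)) =
      2 * (2 ^ (100 * m) * 2 ^ (12 * m) * (1 / 2) ^ (200 * m)) := by
    field_simp
  have h2 : (2 : ℝ) ^ (100 * m) * 2 ^ (12 * m) * (1 / 2) ^ (200 * m) = (1 / 2) ^ (88 * m) := by
    rw [← pow_add, show 200 * m = (100 * m + 12 * m) + 88 * m by ring, pow_add (1 / 2 : ℝ),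
      ← mul_assoc, ← mul_pow]
    norm_num
  rw [h1, h2, show 88 * m = 87 * m + m by ring, pow_add]
  have h3 : (1 / 2 : ℝ) ^ m ≤ 1 / 2 := by
    simpa using pow_le_pow_of_le_one (by norm_num : (0 : ℝ) ≤ 1 / 2) (by norm_num) hm1
  have h4 : 0 < (1 / 2 : ℝ) ^ (87 * m) := by positivity
  nlinarith

/-- Off the near-miss event the inverse weight is at least `missRadius d j ^ d`, so it can be
divided out of the supermartingale bound. -/
theorem setLIntegral_pow_le (hq₀ : ‖q₀‖ ≤ 1) {j t : ℕ} {A : ENNReal} {X : Ω → ℕ}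
    (hX : ∫⁻ ω, ENNReal.ofReal (inverseWeight (path q₀ x u flip t ω) q₀ j) * A ^ X ω ∂P ≤ 1) :
    ∫⁻ ω in (nearMiss q₀ x u flip j (2 * missRadius d j) t)ᶜ, A ^ X ω ∂P ≤
      ENNReal.ofReal (2 ^ (200 * d * j * d)) := by
  have h2 : ENNReal.ofReal (2 ^ (200 * d * j * d)) * ENNReal.ofReal (missRadius d j ^ d) = 1 := by
    rw [← ENNReal.ofReal_mul (by positivity), missRadius, ← pow_mul, ← mul_pow]
    norm_num
  have h1 : ENNReal.ofReal (missRadius d j ^ d) *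
      ∫⁻ ω in (nearMiss q₀ x u flip j (2 * missRadius d j) t)ᶜ, A ^ X ω ∂P ≤ 1 := by
    refine le_trans ?_ hX
    rw [← lintegral_const_mul' _ _ ENNReal.ofReal_ne_top]
    refine le_trans ?_ (setLIntegral_le_lintegral
      (nearMiss q₀ x u flip j (2 * missRadius d j) t)ᶜ _)
    refine setLIntegral_mono' (h.measurableSet_nearMiss q₀ j _ t).compl fun ω hω => ?_
    gcongr
    exact h.pow_le_inverseWeight q₀ hq₀ (missRadius_pos d j) (missRadius_le_one d j) hω
  calc _ = ENNReal.ofReal (2 ^ (200 * d * j * d)) * (ENNReal.ofReal (missRadius d j ^ d) *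
        ∫⁻ ω in (nearMiss q₀ x u flip j (2 * missRadius d j) t)ᶜ, A ^ X ω ∂P) := by
        rw [← mul_assoc, h2, one_mul]
    _ ≤ ENNReal.ofReal (2 ^ (200 * d * j * d)) * 1 := by gcongr
    _ = _ := mul_one _

include hL in
theorem setLIntegral_farAt_le [IsProbabilityMeasure P] (hq₀ : ‖q₀‖ ≤ 1) (i t : ℕ) :
    ∫⁻ ω in (nearMiss q₀ x u flip i (2 * missRadius d i) t)ᶜ,
      (countRounds (FarAt q₀ i) (path q₀ x u flip) x t ω : ENNReal) ∂P ≤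
      ENNReal.ofReal ((200 * d ^ 2 * i + 1) * (16 * d ^ 10 / κ)) := by
  have hP := hL.toSmallPenalty
  have hη' := eta_le_half (d := d)
  have hη0 : 0 < eta d := by
    have : (0 : ℝ) < d := by exact_mod_cast hL.dim_pos
    unfold eta; positivity
  have hκ := hP.margin_le
  have hκ0 := hP.margin_pos
  have hd : (d : ℝ) ≠ 0 := by exact_mod_cast hL.dim_pos.ne'
  have h1 := h.setLIntegral_pow_le q₀ hq₀ (h.lintegral_inverseWeight_farAt_le q₀ hP i t)
  have hpos : 0 < κ * eta d := by positivity
  have h2 : (2 : ℝ) ^ (200 * d * i * d) ≤ Real.exp (200 * d ^ 2 * i) := by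
    have e : (200 * d ^ 2 * i : ℝ) = ((200 * d * i * d : ℕ) : ℝ) * 1 := by push_cast; ring
    rw [e, Real.exp_nat_mul]
    exact pow_le_pow_left₀ (by norm_num) (by linarith [Real.add_one_le_exp 1]) _
  have h3 := setLIntegral_count_le (P := P) (M := 200 * d ^ 2 * i)
    (show 0 < 1 - κ * eta d * (1 / 8) by nlinarith) (by linarith) (by positivity)
    (h1.trans (ENNReal.ofReal_le_ofReal h2))
  refine h3.trans (ENNReal.ofReal_le_ofReal (le_of_eq ?_))
  rw [sub_sub_cancel, div_eq_mul_inv]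
  congr 1
  unfold eta
  field_simp
  norm_num

include hL in
-- If the counter exceeds its cap, the far or the near rounds exceed half of it. Far rounds are
-- controlled by the density at `i`, near rounds by that at `i + 1`. Two tails and two near-miss
-- events give the factor `4`.
theorem measure_cap_lt_count_le [IsProbabilityMeasure P] (hq₀ : ‖q₀‖ ≤ 1) {i : ℕ} (hi : 0 < i)
    (t : ℕ) : P {ω | cap d i < (path q₀ x u flip t ω).C i} ≤
      ENNReal.ofReal (4 * (1 / 2) ^ (87 * d * i)) := by
  have hP := hL.toSmallPenalty
  have hη := eta_nonneg (d := d)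
  have hη' := eta_le_half (d := d)
  have hκ := hP.margin_le
  have hκ0 := hP.margin_pos
  have hκη : κ * eta d ≤ 1 / 2 := by nlinarith
  have hκη0 : 0 ≤ κ * eta d := by positivity
  have hγ : gamma (i + 1) ^ (4 * d) ≤ 1 :=
    pow_le_one₀ (gamma_pos _).le ((gamma_le_half (Nat.succ_pos i)).trans (by norm_num))
  have hγ0 : 0 < gamma (i + 1) ^ (4 * d) := pow_pos (gamma_pos _) _
  set M₁ := nearMiss q₀ x u flip i (2 * missRadius d i) t
  set M₂ := nearMiss q₀ x u flip (i + 1) (2 * missRadius d (i + 1)) t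
  have hfar := measure_tail_le (P := P) (c := cap d i / 2)
    (h.measurable_countRounds_farAt q₀ i t) (E := M₁ᶜ)
    (show 0 < 1 - κ * eta d * (1 / 8) by nlinarith) (by linarith)
    (h.setLIntegral_pow_le q₀ hq₀ (h.lintegral_inverseWeight_farAt_le q₀ hP i t))
  have hnear := measure_tail_le (P := P) (c := cap d i / 2)
    (h.measurable_countRounds_nearAt q₀ i t) (E := M₂ᶜ)
    (show 0 < 1 - κ * eta d * (gamma (i + 1) ^ (4 * d) / 4) by nlinarith) (by nlinarith)
    (h.setLIntegral_pow_le q₀ hq₀ (h.lintegral_inverseWeight_nearAt_le q₀ hP i t))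
  rw [sub_sub_cancel] at hfar hnear
  have hfar' := hfar.trans (ENNReal.ofReal_le_ofReal (hL.far_tail i))
  have hnear' := hnear.trans (ENNReal.ofReal_le_ofReal (hL.near_tail hi))
  have hm₁ := h.measure_nearMiss_le_pow hL q₀ hi t
  have hm₂ : P M₂ ≤ ENNReal.ofReal ((1 / 2) ^ (87 * d * i)) :=
    (h.measure_nearMiss_le_pow hL q₀ (Nat.succ_pos i) t).trans (ENNReal.ofReal_le_ofReal
      (pow_le_pow_of_le_one (by norm_num) (by norm_num)
        (Nat.mul_le_mul_left _ (Nat.le_succ i))))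
  have hsub : {ω | cap d i < (path q₀ x u flip t ω).C i} ⊆ (M₁ ∪ M₂) ∪
      (({ω | cap d i / 2 < countRounds (FarAt q₀ i) (path q₀ x u flip) x t ω} ∩ M₁ᶜ) ∪
      ({ω | cap d i / 2 < countRounds (NearAt q₀ i) (path q₀ x u flip) x t ω} ∩ M₂ᶜ)) := by
    intro ω hω
    by_cases h1 : ω ∈ M₁
    · exact Or.inl (Or.inl h1)
    by_cases h2 : ω ∈ M₂
    · exact Or.inl (Or.inr h2)
    right
    have hω : cap d i < ((path q₀ x u flip t ω).C i : ℝ) := hω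
    rw [count_eq_far_add_near, Nat.cast_add] at hω
    rcases lt_or_ge (cap d i / 2)
      (countRounds (FarAt q₀ i) (path q₀ x u flip) x t ω : ℝ) with h3 | h3
    · exact Or.inl ⟨h3, h1⟩
    · refine Or.inr ⟨?_, h2⟩
      change cap d i / 2 < _
      linarith
  refine (measure_mono hsub).trans ((measure_union_le _ _).trans
    ((add_le_add (measure_union_le _ _) (measure_union_le _ _)).trans
      ((add_le_add (add_le_add hm₁ hm₂) (add_le_add hfar' hnear')).trans ?_)))
  have hpos : 0 ≤ (1 / 2 : ℝ) ^ (87 * d * i) := by positivity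
  rw [← ENNReal.ofReal_add hpos hpos, ← ENNReal.ofReal_add (by positivity) (by positivity)]
  exact ENNReal.ofReal_le_ofReal (by linarith)

end IsEnvironment

end Tails

end NoisySearch

namespace NoisySearch

/-! ### Little mass near the hidden point makes the ratio potential huge. -/

section Bad

variable {d : ℕ} {p κ : ℝ}

theorem IsDensity.totalRatio_eq {w : Eucl d → ℝ} (hw : IsDensity w) (q₀ : Eucl d) (l : ℝ) :
    totalRatio w q₀ l = ENNReal.ofReal (∫ q in ball d, ratio w q₀ l (200 * d) q) :=
  (ofReal_integral_eq_lintegral_ofReal (hw.integrableOn_ratio q₀ l _)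
    (ae_of_all _ fun q => (hw.ratio_pos q₀ l _ q).le)).symm

/-- The threshold is `τ = γ_i^(-2d)`, so that `τ * γ_i^(4d) = γ_i^(2d)` is at most `γ_i^d / 2`. The
gain `τ^(200d - 1)`, about `2^(400 d² i)`, outweighs the factor `2^(-200 d² i)` lost through the
bound on the inverse weight. -/
theorem IsDensity.le_totalRatio {w : Eucl d → ℝ} (hw : IsDensity w) (hd : 0 < d) {q₀ : Eucl d}
    (hq₀ : ‖q₀‖ ≤ 1) {i : ℕ} (hi : 0 < i)
    (hinv : missRadius d i ^ d ≤ (volume.real (ball d))⁻¹ * (w q₀)⁻¹)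
    (hm : mass w (contract q₀ (gamma i) '' ball d) ≤ gamma i ^ (4 * d)) :
    ENNReal.ofReal (2 ^ (100 * d * d * i) * volume.real (ball d)) ≤
      totalRatio w q₀ (gamma i) := by
  rw [hw.totalRatio_eq]
  refine ENNReal.ofReal_le_ofReal ?_
  have hγ := gamma_pos i
  have hγ1 : gamma i ≤ 1 := (gamma_le_half hi).trans (by norm_num)
  have hdi : 1 ≤ d * i := Nat.mul_pos hd hi
  obtain ⟨m, hm'⟩ : ∃ m, 200 * d = m + 1 := ⟨200 * d - 1, by omega⟩
  set τ : ℝ := 2 ^ (2 * (d * i)) with hτ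
  have hγd : ∀ k : ℕ, gamma i ^ (k * d) = (1 / 2) ^ (k * (d * i)) := fun k => by
    unfold gamma
    rw [← one_div_pow, ← pow_mul]
    congr 1; ring
  have hε : τ * gamma i ^ (4 * d) ≤ 1 / 2 * gamma i ^ d := by
    have h1 := hγd 4
    have h2 := hγd 1
    rw [one_mul, one_mul] at h2
    rw [h1, h2, hτ, show 4 * (d * i) = 2 * (d * i) + (d * i + d * i) by ring, pow_add (1 / 2 : ℝ),
      ← mul_assoc, ← mul_pow, pow_add]
    have h3 : (1 / 2 : ℝ) ^ (d * i) ≤ 1 / 2 := by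
      simpa using pow_le_pow_of_le_one (by norm_num : (0 : ℝ) ≤ 1 / 2) (by norm_num) hdi
    have h4 : (0 : ℝ) < (1 / 2) ^ (d * i) := by positivity
    norm_num
    norm_num at h3
    nlinarith
  have h := hw.le_integral_ratio hq₀ hγ hγ1 (show 0 < τ by positivity) hε hm m
  rw [← hm'] at h
  refine le_trans ?_ h
  have hv := volumeReal_ball_pos (d := d)
  have h1 : missRadius d i ^ d * volume.real (ball d) ≤ (w q₀)⁻¹ := by
    calc _ ≤ (volume.real (ball d))⁻¹ * (w q₀)⁻¹ * volume.real (ball d) := by gcongr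
      _ = _ := by field_simp
  have h2 : (2 : ℝ) ^ (100 * d * d * i) ≤ τ ^ m / 2 * missRadius d i ^ d := by
    have hr : missRadius d i ^ d = (2 ^ (200 * d * i * d))⁻¹ := by
      unfold missRadius
      rw [one_div, inv_pow, inv_pow, ← pow_mul]
    rw [hr, ← div_eq_mul_inv, div_div, le_div_iff₀ (by positivity), hτ, ← pow_mul, ← pow_succ',
      ← pow_add]
    refine pow_le_pow_right₀ one_le_two ?_
    have h3 : 2 * (d * i) * m + 2 * (d * i) = 2 * (d * i) * (200 * d) := by rw [hm']; ring
    have h4 : d * i ≤ d * d * i := by nlinarith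
    have h5 : 100 * d * d * i = 100 * (d * d * i) := by ring
    have h6 : 200 * d * i * d = 200 * (d * d * i) := by ring
    have h7 : 2 * (d * i) * (200 * d) = 400 * (d * d * i) := by ring
    rw [h5, h6]
    rw [h7] at h3
    omega
  calc 2 ^ (100 * d * d * i) * volume.real (ball d)
      ≤ τ ^ m / 2 * missRadius d i ^ d * volume.real (ball d) := by gcongr
    _ = τ ^ m / 2 * (missRadius d i ^ d * volume.real (ball d)) := by ring
    _ ≤ _ := by gcongr

end Bad

/-! ### Assembly of the loss over rounds and scales. -/

section Final

variable {Ω : Type*} [mΩ : MeasurableSpace Ω] {P : Measure Ω} {p κ : ℝ} {d : ℕ}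
  {𝓕 : Filtration ℕ mΩ} {x : ℕ → Ω → Eucl d} {u : ℕ → Ω → ℝ} {flip : ℕ → Ω → Bool}

/-- The loss of round `r`, as a function on the probability space. -/
noncomputable def pathLoss (q₀ : Eucl d) (x : ℕ → Ω → Eucl d) (u : ℕ → Ω → ℝ)
    (flip : ℕ → Ω → Bool) (r : ℕ) (ω : Ω) : ℝ :=
  |query (path q₀ x u flip r ω) (x r ω) (u r ω) - inner ℝ (x r ω) q₀|

/-- The event that the counter at scale `i` has exceeded its threshold before round `t`. -/
def overCap (q₀ : Eucl d) (x : ℕ → Ω → Eucl d) (u : ℕ → Ω → ℝ) (flip : ℕ → Ω → Bool) (i t : ℕ) :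
    Set Ω := {ω | cap d i < (path q₀ x u flip t ω).C i}

/-- The event of a near miss at scale `i` before round `t`. -/
def missed (q₀ : Eucl d) (x : ℕ → Ω → Eucl d) (u : ℕ → Ω → ℝ) (flip : ℕ → Ω → Bool) (i t : ℕ) :
    Set Ω := nearMiss q₀ x u flip i (2 * missRadius d i) t

/-- The weight of the ratio potential in the bound on the loss. -/
noncomputable def ratioWeight (d i : ℕ) : ENNReal :=
  ENNReal.ofReal (4 / (2 ^ (100 * d * d * i) * volume.real (ball d)))

namespace IsEnvironment

variable (h : IsEnvironment P p 𝓕 x u flip) (hL : LargeDim p κ d) {q₀ : Eucl d} (hq₀ : ‖q₀‖ ≤ 1)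
include h hL hq₀

-- The cases are: median near the true value; near miss; previous counter over its cap; enough mass
-- near `q₀`; little mass near `q₀`. In the exceptional cases the trivial bound `4` on the loss is
-- used, and in the last one `ratioWeight` is normalized so that the potential term is at least `4`.
omit hL in
open Classical in
theorem pathLoss_le {r T : ℕ} (hr : r < T) {ω : Ω} (hu : |u r ω| ≤ 1) {i : ℕ} :
    (if scale (path q₀ x u flip r ω) (x r ω) = i then
      ENNReal.ofReal (pathLoss q₀ x u flip r ω) else 0) ≤
    ((if scale (path q₀ x u flip r ω) (x r ω) = i then 1 else 0 : ℕ) : ENNReal) *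
      (ENNReal.ofReal (3 * beta d i) + 4 * (missed q₀ x u flip i T).indicator 1 ω +
        4 * (overCap q₀ x u flip (i - 1) T).indicator 1 ω) +
    ENNReal.ofReal (14 * gamma i) * ((missed q₀ x u flip i T)ᶜ.indicator 1 ω *
      ((if FarAt q₀ i (path q₀ x u flip r ω) (x r ω) then 1 else 0 : ℕ) : ENNReal)) +
    ratioWeight d i * (totalRatio ((path q₀ x u flip r ω).w i) q₀ (gamma i) *
      ((if scale (path q₀ x u flip r ω) (x r ω) = i then 1 else 0 : ℕ) : ENNReal)) := by
  by_cases hi : scale (path q₀ x u flip r ω) (x r ω) = i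
  swap
  · rw [if_neg hi]; exact zero_le
  have hv := h.valid_path q₀ r ω
  obtain ⟨hx, hx1⟩ := h.context_mem r ω
  have hd := dim_pos_of_ne_zero hx
  set s := path q₀ x u flip r ω with hs
  have hi0 : 0 < i := hi ▸ hv.scale_pos hx hx1
  have hloss : pathLoss q₀ x u flip r ω ≤ |median (s.w i) (x r ω) - inner ℝ (x r ω) q₀| +
      2 * beta d i := by
    have := abs_query_sub_le (s := s) (x := x r ω) (q₀ := q₀) hu
    rw [hi] at this
    exact this
  have hβγ := beta_le_gamma hd i
  have hγ2 := gamma_le_half hi0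
  rw [if_pos hi, if_pos hi, Nat.cast_one, one_mul, mul_one]
  by_cases hfar : IsFar q₀ s (x r ω)
  swap
  · refine le_add_right (le_add_right (le_add_right (le_add_right ?_)))
    refine ENNReal.ofReal_le_ofReal (hloss.trans ?_)
    have : |median (s.w (scale s (x r ω))) (x r ω) - inner ℝ (x r ω) q₀| ≤
      beta d (scale s (x r ω)) := not_lt.1 hfar
    rw [hi] at this
    linarith
  have h4 : ENNReal.ofReal (pathLoss q₀ x u flip r ω) ≤ 4 := by
    rw [show (4 : ENNReal) = ENNReal.ofReal 4 by simp]
    refine ENNReal.ofReal_le_ofReal (hloss.trans ?_)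
    linarith [abs_median_sub_le_two hv hx hx1 hq₀ i]
  by_cases hM : ω ∈ missed q₀ x u flip i T
  · refine le_add_right (le_add_right (le_add_right (le_add_left ?_)))
    simpa [hM] using h4
  by_cases hC : ω ∈ overCap q₀ x u flip (i - 1) T
  · refine le_add_right (le_add_right (le_add_left ?_))
    simpa [hC] using h4
  have hel : i ∈ eligible s (x r ω) := hi ▸ hv.scale_mem hx hx1
  obtain ⟨-, ⟨a, b, hab, hmass⟩ | hcap⟩ := hel
  swap
  · refine absurd (lt_of_lt_of_le hcap ?_) hC
    rw [count_eq_countRounds, count_eq_countRounds]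
    exact_mod_cast countRounds_mono_time _ ω hr.le
  by_cases hl : gamma i ^ (4 * d) < mass (s.w i) (contract q₀ (gamma i) '' ball d)
  · refine le_add_right (le_add_left ?_)
    rw [if_pos ⟨hi, hfar⟩, indicator_of_mem hM]
    simp only [Pi.one_apply, Nat.cast_one, mul_one]
    refine ENNReal.ofReal_le_ofReal (hloss.trans ?_)
    linarith [hv.abs_median_sub_le hx hx1 hq₀ hi0 hab hmass hl]
  · refine le_add_left (h4.trans ?_)
    have hM' : ω ∉ nearMiss q₀ x u flip i (2 * missRadius d i) r :=
      fun hω => hM (nearMiss_mono q₀ hr.le hω)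
    have hinv := h.pow_le_inverseWeight q₀ hq₀ (missRadius_pos d i) (missRadius_le_one d i) hM'
    have hbad := (hv.density i).le_totalRatio hd hq₀ hi0 hinv (not_lt.1 hl)
    have hvb := volumeReal_ball_pos (d := d)
    calc (4 : ENNReal) = ratioWeight d i *
          ENNReal.ofReal (2 ^ (100 * d * d * i) * volume.real (ball d)) := by
          rw [ratioWeight, ← ENNReal.ofReal_mul (by positivity), div_mul_cancel₀ _ (by positivity)]
          simp
      _ ≤ _ := by gcongr

/-- A bound on the total loss of the rounds played at scale `i`. -/
noncomputable def _root_.NoisySearch.lossBound (q₀ : Eucl d) (x : ℕ → Ω → Eucl d) (u : ℕ → Ω → ℝ)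
    (flip : ℕ → Ω → Bool) (T i : ℕ) (ω : Ω) : ENNReal :=
  ((2 ^ (12 * d * i) : ℕ) : ENNReal) * (ENNReal.ofReal (3 * beta d i) +
    4 * (missed q₀ x u flip i T).indicator 1 ω +
    4 * (overCap q₀ x u flip (i - 1) T).indicator 1 ω) +
  ENNReal.ofReal (14 * gamma i) * (missed q₀ x u flip i T)ᶜ.indicator
    (fun ω => (countRounds (FarAt q₀ i) (path q₀ x u flip) x T ω : ENNReal)) ω +
  ratioWeight d i * ∑ r ∈ Finset.range T, (totalRatio ((path q₀ x u flip r ω).w i) q₀ (gamma i) *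
    ((if scale (path q₀ x u flip r ω) (x r ω) = i then 1 else 0 : ℕ) : ENNReal))

theorem sum_pathLoss_le_lossBound (T : ℕ) {ω : Ω} (hu : ∀ r, |u r ω| ≤ 1) (i : ℕ) :
    ∑ r ∈ Finset.range T, (if scale (path q₀ x u flip r ω) (x r ω) = i then
      ENNReal.ofReal (pathLoss q₀ x u flip r ω) else 0) ≤ lossBound q₀ x u flip T i ω := by
  classical
  refine (Finset.sum_le_sum fun r hr =>
    h.pathLoss_le hq₀ (Finset.mem_range.1 hr) (hu r)).trans ?_
  rw [Finset.sum_add_distrib, Finset.sum_add_distrib, ← Finset.sum_mul, ← Finset.mul_sum,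
    ← Finset.mul_sum, ← Finset.mul_sum, ← Nat.cast_sum, ← Nat.cast_sum]
  unfold lossBound
  gcongr
  · have h1 := count_eq_countRounds (x := x) (u := u) (flip := flip) q₀ i T ω
    have h2 := h.count_le_two_pow hL q₀ i T ω
    rw [h1, countRounds] at h2
    refine le_trans (le_of_eq ?_) h2
    refine Finset.sum_congr rfl fun r _ => ?_
    split_ifs <;> rfl
  · by_cases hM : ω ∈ (missed q₀ x u flip i T)ᶜ
    · rw [indicator_of_mem hM, indicator_of_mem hM]
      simp [countRounds]
    · rw [indicator_of_notMem hM, indicator_of_notMem hM, zero_mul]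

omit hL hq₀ in
theorem measurableSet_missed (q₀ : Eucl d) (i T : ℕ) : MeasurableSet (missed q₀ x u flip i T) :=
  h.measurableSet_nearMiss q₀ i _ T

omit hL hq₀ in
theorem measurableSet_overCap (q₀ : Eucl d) (i T : ℕ) : MeasurableSet (overCap q₀ x u flip i T) :=
  measurableSet_lt measurable_const
    (measurable_from_top.comp ((h.measurableState_path' q₀ T).C i))

omit hL hq₀ in
theorem measurable_totalRatio_mul (q₀ : Eucl d) (i r : ℕ) :
    Measurable fun ω => totalRatio ((path q₀ x u flip r ω).w i) q₀ (gamma i) *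
      ((if scale (path q₀ x u flip r ω) (x r ω) = i then 1 else 0 : ℕ) : ENNReal) := by
  have h1 := measurable_scale (h.measurableState_path' q₀ r) (h.measurable_context r)
      (h.valid_path q₀ r) (h.context_mem r)
  have h2 := measurable_indicator_nat
    (p := fun ω => scale (path q₀ x u flip r ω) (x r ω) = i) (h1 (measurableSet_singleton i))
  exact (h.measurable_totalRatio q₀ i (gamma i) r).mul
    ((measurable_from_top (f := fun n : ℕ => (n : ENNReal))).comp h2)

omit hL hq₀ in
theorem measurable_lossBound (q₀ : Eucl d) (T i : ℕ) :
    Measurable (lossBound q₀ x u flip T i) := by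
  have h1 := h.measurableSet_missed q₀ i T
  have h2 := h.measurableSet_overCap q₀ (i - 1) T
  have h3 : Measurable fun ω => (countRounds (FarAt q₀ i) (path q₀ x u flip) x T ω : ENNReal) :=
    measurable_from_top.comp (h.measurable_countRounds_farAt q₀ i T)
  unfold lossBound
  refine (Measurable.add ?_ ?_).add ?_
  · exact (((measurable_one.indicator h1).const_mul 4).const_add _).add
      ((measurable_one.indicator h2).const_mul 4) |>.const_mul _
  · exact (h3.indicator h1.compl).const_mul _
  · exact (Finset.measurable_sum _ fun r _ => h.measurable_totalRatio_mul q₀ i r).const_mul _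

theorem lintegral_lossBound_le [IsProbabilityMeasure P] (T : ℕ) {i : ℕ} (hi : 0 < i) :
    ∫⁻ ω, lossBound q₀ x u flip T i ω ∂P ≤
      ENNReal.ofReal (50000 / κ * d ^ 25 * (i * (1 / 2) ^ i)) := by
  have hd := hL.dim_pos
  have hκ0 := hL.margin_pos
  have hκ1 := hL.toSmallPenalty.margin_le
  have h1 := h.measurableSet_missed q₀ i T
  have h2 := h.measurableSet_overCap q₀ (i - 1) T
  have h3 : Measurable fun ω => (countRounds (FarAt q₀ i) (path q₀ x u flip) x T ω : ENNReal) :=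
    measurable_from_top.comp (h.measurable_countRounds_farAt q₀ i T)
  have hdi : i ≤ d * i := Nat.le_mul_of_pos_left i hd
  have hhalf : ∀ {m n : ℕ}, m ≤ n → (1 / 2 : ℝ) ^ n ≤ (1 / 2) ^ m := fun hmn =>
    pow_le_pow_of_le_one (by norm_num) (by norm_num) hmn
  have hcancel : ∀ m n : ℕ, (2 : ℝ) ^ m * (1 / 2) ^ (m + n) = (1 / 2) ^ n := fun m n => by
    rw [pow_add, ← mul_assoc, ← mul_pow]; norm_num
  have e : ∀ c : ℕ, c * d * i = c * (d * i) := fun c => mul_assoc _ _ _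
  have hcast : ((2 ^ (12 * d * i) : ℕ) : ENNReal) = ENNReal.ofReal (2 ^ (12 * d * i)) := by
    rw [← ENNReal.ofReal_natCast]; push_cast; rfl
  have hmiss : ENNReal.ofReal (2 ^ (12 * d * i)) * (4 * P (missed q₀ x u flip i T)) ≤
      ENNReal.ofReal (4 * (1 / 2) ^ i) := by
    calc _ ≤ ENNReal.ofReal (2 ^ (12 * d * i)) *
          (ENNReal.ofReal 4 * ENNReal.ofReal ((1 / 2) ^ (87 * d * i))) := by
          rw [show (4 : ENNReal) = ENNReal.ofReal 4 by simp]
          gcongr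
          exact h.measure_nearMiss_le_pow hL q₀ hi T
      _ ≤ _ := by
          rw [← ENNReal.ofReal_mul (by norm_num), ← ENNReal.ofReal_mul (by positivity)]
          refine ENNReal.ofReal_le_ofReal ?_
          rw [mul_left_comm, e, e, show 87 * (d * i) = 12 * (d * i) + 75 * (d * i) by ring, hcancel]
          have := hhalf (show i ≤ 75 * (d * i) by omega)
          linarith
  have hcap : ENNReal.ofReal (2 ^ (12 * d * i)) * (4 * P (overCap q₀ x u flip (i - 1) T)) ≤
      ENNReal.ofReal (16 * (1 / 2) ^ i) := by
    rcases Nat.lt_or_ge 1 i with hi1 | hi1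
    · obtain ⟨k, rfl⟩ : ∃ k, i = k + 1 := ⟨i - 1, by omega⟩
      have hk : 0 < k := by omega
      have hdk : k ≤ d * k := Nat.le_mul_of_pos_left k hd
      have hd1 : d ≤ d * k := Nat.le_mul_of_pos_right d hk
      calc _ ≤ ENNReal.ofReal (2 ^ (12 * d * (k + 1))) *
            (ENNReal.ofReal 4 * ENNReal.ofReal (4 * (1 / 2) ^ (87 * d * k))) := by
            rw [show (4 : ENNReal) = ENNReal.ofReal 4 by simp]
            gcongr
            exact h.measure_cap_lt_count_le hL q₀ hq₀ hk T
        _ ≤ _ := by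
            rw [← ENNReal.ofReal_mul (by norm_num), ← ENNReal.ofReal_mul (by positivity)]
            refine ENNReal.ofReal_le_ofReal ?_
            have h5 : (2 : ℝ) ^ (12 * d * (k + 1)) ≤ 2 ^ (24 * (d * k)) :=
              pow_le_pow_right₀ one_le_two (by nlinarith)
            have h6 : (2 : ℝ) ^ (24 * (d * k)) * (1 / 2) ^ (87 * d * k) =
                (1 / 2) ^ (63 * (d * k)) := by
              rw [show 87 * d * k = 24 * (d * k) + 63 * (d * k) by ring, hcancel]
            have h7 := hhalf (show k + 1 ≤ 63 * (d * k) by omega)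
            calc _ ≤ (2 : ℝ) ^ (24 * (d * k)) * (4 * (4 * (1 / 2) ^ (87 * d * k))) := by gcongr
              _ = 16 * ((2 : ℝ) ^ (24 * (d * k)) * (1 / 2) ^ (87 * d * k)) := by ring
              _ ≤ _ := by rw [h6]; linarith
    · have : overCap q₀ x u flip (i - 1) T = ∅ := by
        have hi' : i - 1 = 0 := by omega
        ext ω
        rw [hi']
        simp only [overCap, mem_ofPred_eq, mem_empty_iff_false, iff_false, not_lt]
        rw [(h.valid_path q₀ T ω).count_zero, Nat.cast_zero]
        exact cap_nonneg 0
      simp [this]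
  have hbeta : ENNReal.ofReal (2 ^ (12 * d * i)) * ENNReal.ofReal (3 * beta d i) ≤
      ENNReal.ofReal (3 * (1 / 2) ^ i) := by
    rw [← ENNReal.ofReal_mul (by positivity)]
    refine ENNReal.ofReal_le_ofReal ?_
    unfold beta
    rw [← one_div_pow, mul_left_comm, e, e,
      show 100 * (d * i) = 12 * (d * i) + 88 * (d * i) by ring, hcancel]
    have := hhalf (show i ≤ 88 * (d * i) by omega)
    linarith
  have hfar : ENNReal.ofReal (14 * gamma i) * ∫⁻ ω in (missed q₀ x u flip i T)ᶜ,
      (countRounds (FarAt q₀ i) (path q₀ x u flip) x T ω : ENNReal) ∂P ≤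
      ENNReal.ofReal (14 * (1 / 2) ^ i * ((200 * d ^ 2 * i + 1) * (16 * d ^ 10 / κ))) := by
    have hγ : gamma i = (1 / 2) ^ i := by unfold gamma; rw [one_div_pow]
    rw [hγ, ENNReal.ofReal_mul (p := 14 * (1 / 2) ^ i) (by positivity)]
    gcongr
    exact h.setLIntegral_farAt_le hL q₀ hq₀ i T
  have hrat : ratioWeight d i * ∑ r ∈ Finset.range T, ∫⁻ ω,
      totalRatio ((path q₀ x u flip r ω).w i) q₀ (gamma i) *
      ((if scale (path q₀ x u flip r ω) (x r ω) = i then 1 else 0 : ℕ) : ENNReal) ∂P ≤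
      ENNReal.ofReal (4 * (1 / 2) ^ i) := by
    have hγ1 : gamma i ≤ 1 := (gamma_le_half hi).trans (by norm_num)
    have hv := volumeReal_ball_pos (d := d)
    calc _ ≤ ratioWeight d i * (((2 ^ (12 * d * i) : ℕ) : ENNReal) * volume (ball d)) := by
          gcongr
          exact h.sum_lintegral_totalRatio_le q₀ hL.toSmallPenalty (gamma_pos i).le hγ1
            (h.count_le_two_pow hL q₀ i) T
      _ ≤ _ := by
          rw [hcast, ← ENNReal.ofReal_toReal volume_ball_lt_top.ne, ratioWeight,
            ← ENNReal.ofReal_mul (by positivity), ← ENNReal.ofReal_mul (by positivity)]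
          refine ENNReal.ofReal_le_ofReal ?_
          change 4 / (2 ^ (100 * d * d * i) * volume.real (ball d)) *
            (2 ^ (12 * d * i) * volume.real (ball d)) ≤ _
          have h5 : 4 / (2 ^ (100 * d * d * i) * volume.real (ball d)) *
            (2 ^ (12 * d * i) * volume.real (ball d)) =
            4 * ((2 : ℝ) ^ (12 * d * i) * (1 / 2) ^ (100 * d * d * i)) := by
            rw [one_div_pow]; field_simp
          have h6 : (1 / 2 : ℝ) ^ (100 * d * d * i) ≤ (1 / 2) ^ (12 * (d * i) + 88 * (d * i)) := by
            refine hhalf ?_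
            have : d * i ≤ d * d * i := by nlinarith
            have h7 : 100 * d * d * i = 100 * (d * d * i) := by ring
            omega
          rw [h5]
          calc _ ≤ 4 * ((2 : ℝ) ^ (12 * (d * i)) * (1 / 2) ^ (12 * (d * i) + 88 * (d * i))) := by
                rw [e]; gcongr
            _ ≤ _ := by
                rw [hcancel]
                have := hhalf (show i ≤ 88 * (d * i) by omega)
                linarith
  have hsplit : ∫⁻ ω, lossBound q₀ x u flip T i ω ∂P =
      ((2 ^ (12 * d * i) : ℕ) : ENNReal) * (ENNReal.ofReal (3 * beta d i) +
        4 * P (missed q₀ x u flip i T) + 4 * P (overCap q₀ x u flip (i - 1) T)) +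
      ENNReal.ofReal (14 * gamma i) * ∫⁻ ω in (missed q₀ x u flip i T)ᶜ,
        (countRounds (FarAt q₀ i) (path q₀ x u flip) x T ω : ENNReal) ∂P +
      ratioWeight d i * ∑ r ∈ Finset.range T, ∫⁻ ω,
        totalRatio ((path q₀ x u flip r ω).w i) q₀ (gamma i) *
        ((if scale (path q₀ x u flip r ω) (x r ω) = i then 1 else 0 : ℕ) : ENNReal) ∂P := by
    unfold lossBound
    have m1 := (measurable_one (α := ENNReal)).indicator h1 |>.const_mul 4
    have m2 := (measurable_one (α := ENNReal)).indicator h2 |>.const_mul 4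
    have m3 := h3.indicator h1.compl
    have m4 := fun r => h.measurable_totalRatio_mul q₀ i r
    rw [lintegral_add_right _ ((Finset.measurable_sum _ fun r _ => m4 r).const_mul _),
      lintegral_add_right _ (m3.const_mul _), lintegral_const_mul' _ _ (ENNReal.natCast_ne_top _),
      lintegral_add_right _ m2, lintegral_add_right _ m1, lintegral_const, measure_univ, mul_one,
      lintegral_const_mul _ (measurable_one.indicator h1),
      lintegral_const_mul _ (measurable_one.indicator h2), lintegral_indicator_one h1,
      lintegral_indicator_one h2, lintegral_const_mul _ m3, lintegral_indicator h1.compl,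
      lintegral_const_mul _ (Finset.measurable_sum _ fun r _ => m4 r),
      lintegral_finsetSum _ fun r _ => m4 r]
  rw [hsplit, hcast, mul_add, mul_add]
  refine (add_le_add (add_le_add (add_le_add (add_le_add hbeta hmiss) hcap) hfar) hrat).trans ?_
  rw [← ENNReal.ofReal_add (by positivity) (by positivity),
    ← ENNReal.ofReal_add (by positivity) (by positivity),
    ← ENNReal.ofReal_add (by positivity) (by positivity),
    ← ENNReal.ofReal_add (by positivity) (by positivity)]
  refine ENNReal.ofReal_le_ofReal ?_
  have hd1 : (1 : ℝ) ≤ d := by exact_mod_cast hd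
  have hi1 : (1 : ℝ) ≤ i := by exact_mod_cast hi
  have hD : (1 : ℝ) ≤ d ^ 25 := one_le_cast_pow hd 25
  have hD2 : (1 : ℝ) ≤ d ^ 2 * i := one_le_mul_of_one_le_of_one_le (one_le_cast_pow hd 2) hi1
  -- The far rounds contribute only order `d^12 * i`; the exponent is relaxed to `25` here.
  have hD12 : (d : ℝ) ^ 12 ≤ d ^ 25 := pow_le_pow_right₀ hd1 (by norm_num)
  have hκi : 1 ≤ 1 / κ := by rw [le_div_iff₀ hκ0]; linarith
  have hg : 0 < (1 / 2 : ℝ) ^ i := by positivity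
  have h8 : (200 * (d : ℝ) ^ 2 * i + 1) * (16 * d ^ 10 / κ) ≤ 3216 * (1 / κ * d ^ 25 * i) := by
    calc _ ≤ (200 * (d : ℝ) ^ 2 * i + d ^ 2 * i) * (16 * d ^ 10 / κ) := by gcongr
      _ = 3216 * (1 / κ * d ^ 12 * i) := by field_simp; ring
      _ ≤ _ := by gcongr
  have h9 : 1 ≤ 1 / κ * (d : ℝ) ^ 25 * i :=
    one_le_mul_of_one_le_of_one_le (one_le_mul_of_one_le_of_one_le hκi hD) hi1
  calc _ = (1 / 2 : ℝ) ^ i * (27 + 14 * ((200 * (d : ℝ) ^ 2 * i + 1) * (16 * d ^ 10 / κ))) := by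
        ring
    _ ≤ (1 / 2 : ℝ) ^ i * (50000 * (1 / κ * (d : ℝ) ^ 25 * i)) := by
        gcongr
        linarith
    _ = _ := by ring

theorem lintegral_sum_pathLoss_le [IsProbabilityMeasure P] (T : ℕ) :
    ∫⁻ ω, ∑ r ∈ Finset.range T, ENNReal.ofReal (pathLoss q₀ x u flip r ω) ∂P ≤
      ENNReal.ofReal (100000 / κ * d ^ 25) := by
  have hκ0 := hL.margin_pos
  have hu : ∀ᵐ ω ∂P, ∀ r, |u r ω| ≤ 1 := by
    refine ae_all_iff.2 fun r => ?_
    have h1 : ∀ᵐ v ∂(P.map (u r)), |v| ≤ 1 := by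
      rw [h.map_u, uniformLaw]
      refine Measure.ae_smul_measure ((ae_restrict_mem measurableSet_Icc).mono fun v hv => ?_) _
      exact abs_le.2 hv
    exact ae_of_ae_map (h.measurable_u r).aemeasurable h1
  calc _ ≤ ∫⁻ ω, ∑' i : ℕ, lossBound q₀ x u flip T (i + 1) ω ∂P := by
        refine lintegral_mono_ae (hu.mono fun ω hω => ?_)
        calc _ ≤ ∑ r ∈ Finset.range T, ∑' i : ℕ,
              (if scale (path q₀ x u flip r ω) (x r ω) = i + 1 then
                ENNReal.ofReal (pathLoss q₀ x u flip r ω) else 0) := by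
              refine Finset.sum_le_sum fun r _ => ?_
              have hpos := (h.valid_path q₀ r ω).scale_pos (h.context_mem r ω).1
                (h.context_mem r ω).2
              -- The series is indexed from scale `1`, and the current scale is positive, so its
              -- index is the scale minus one.
              refine le_trans ?_ (ENNReal.le_tsum (scale (path q₀ x u flip r ω) (x r ω) - 1))
              rw [if_pos (by omega)]
          _ = ∑' i : ℕ, ∑ r ∈ Finset.range T,
              (if scale (path q₀ x u flip r ω) (x r ω) = i + 1 then
                ENNReal.ofReal (pathLoss q₀ x u flip r ω) else 0) :=
              (Summable.tsum_finsetSum fun _ _ => ENNReal.summable).symm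
          _ ≤ _ := ENNReal.tsum_le_tsum fun i => h.sum_pathLoss_le_lossBound hL hq₀ T hω (i + 1)
    _ = ∑' i : ℕ, ∫⁻ ω, lossBound q₀ x u flip T (i + 1) ω ∂P :=
        lintegral_tsum fun i => (h.measurable_lossBound q₀ T (i + 1)).aemeasurable
    _ ≤ ∑' i : ℕ, ENNReal.ofReal
          (50000 / κ * d ^ 25 * (((i + 1 : ℕ) : ℝ) * (1 / 2) ^ (i + 1))) :=
        ENNReal.tsum_le_tsum fun i => h.lintegral_lossBound_le hL hq₀ T (Nat.succ_pos i)
    _ = _ := by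
        -- `∑ i * 2^(-i) = 2`, and the term at `i = 0` vanishes.
        have hs := hasSum_coe_mul_geometric_of_norm_lt_one (r := (1 / 2 : ℝ)) (by norm_num)
        have hs' := ((hasSum_nat_add_iff' 1).2 hs).mul_left (50000 / κ * (d : ℝ) ^ 25)
        rw [← ENNReal.ofReal_tsum_of_nonneg (fun i => by positivity) hs'.summable, hs'.tsum_eq]
        congr 1
        norm_num
        ring

omit hL hq₀ in
theorem measurable_pathLoss (q₀ : Eucl d) (r : ℕ) : Measurable (pathLoss q₀ x u flip r) := by
  have h1 := measurable_query (h.measurableState_path' q₀ r) (h.measurable_context r)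
    (h.valid_path q₀ r) (h.context_mem r)
  have h2 : Measurable fun ω => (ω, (u r ω, flip r ω)) :=
    measurable_id.prodMk ((h.measurable_u r).prodMk (h.measurable_flip r))
  exact ((h1.comp h2).sub ((h.measurable_context r).inner measurable_const)).abs

theorem integrable_totalLoss_and_integral_le [IsProbabilityMeasure P] (T : ℕ) :
    Integrable (fun ω => totalLoss q₀ (fun t => x t ω) (fun t => u t ω) (fun t => flip t ω) T) P ∧
    ∫ ω, totalLoss q₀ (fun t => x t ω) (fun t => u t ω) (fun t => flip t ω) T ∂P ≤
      100000 / κ * d ^ 25 := by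
  have hκ0 := hL.margin_pos
  have he : (fun ω => totalLoss q₀ (fun t => x t ω) (fun t => u t ω) (fun t => flip t ω) T) =
      fun ω => ∑ r ∈ Finset.range T, pathLoss q₀ x u flip r ω := rfl
  have h0 : ∀ ω, 0 ≤ ∑ r ∈ Finset.range T, pathLoss q₀ x u flip r ω := fun ω =>
    Finset.sum_nonneg fun r _ => abs_nonneg _
  have hm : Measurable fun ω => ∑ r ∈ Finset.range T, pathLoss q₀ x u flip r ω :=
    Finset.measurable_sum _ fun r _ => h.measurable_pathLoss q₀ r
  have hle : ∫⁻ ω, ENNReal.ofReal (∑ r ∈ Finset.range T, pathLoss q₀ x u flip r ω) ∂P ≤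
      ENNReal.ofReal (100000 / κ * d ^ 25) := by
    simp only [ENNReal.ofReal_sum_of_nonneg fun r _ => abs_nonneg _, pathLoss]
    exact h.lintegral_sum_pathLoss_le hL hq₀ T
  rw [he]
  constructor
  · refine ⟨hm.aestronglyMeasurable, ?_⟩
    rw [hasFiniteIntegral_iff_ofReal (ae_of_all _ h0)]
    exact hle.trans_lt ENNReal.ofReal_lt_top
  · rw [integral_eq_lintegral_of_nonneg_ae (ae_of_all _ h0) hm.aestronglyMeasurable]
    exact ENNReal.toReal_le_of_le_ofReal (by positivity) hle

end IsEnvironment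

theorem eventually_largeDim {p : ℝ} (hp0 : 0 ≤ p) (hp : p < 1 / 2) :
    ∀ᶠ d : ℕ in Filter.atTop, LargeDim p ((1 - 2 * p) / 4) d := by
  set κ := (1 - 2 * p) / 4 with hκd
  have hκ : 0 < κ := by rw [hκd]; linarith
  have hd0 := Filter.eventually_gt_atTop (α := ℕ) 0
  have hpow : ∀ (k : ℕ) (c : ℝ), 0 < c → ∀ᶠ d : ℕ in Filter.atTop, (d : ℝ) ^ k ≤ c * 2 ^ d := by
    intro k c hc
    have h1 := tendsto_pow_const_div_const_pow_of_one_lt k (one_lt_two (α := ℝ))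
    filter_upwards [h1.eventually (ge_mem_nhds hc)] with d hd
    rwa [div_le_iff₀ (by positivity)] at hd
  have hlin : ∀ c : ℝ, ∀ᶠ d : ℕ in Filter.atTop, c ≤ d := fun c =>
    (tendsto_natCast_atTop_atTop (R := ℝ)).eventually (Filter.eventually_ge_atTop c)
  filter_upwards [hd0, hpow 25 (1 / 1000) (by norm_num), hpow 8 (κ / 100) (by positivity),
    hlin (100 / κ)] with d hd h25 h8 hk
  have hd1 : (1 : ℝ) ≤ d := by exact_mod_cast hd
  have hη0 : 0 < eta d := by unfold eta; positivity
  have hη : eta d * d ^ 2 ≤ 1 / 2 := by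
    unfold eta
    rw [div_mul_eq_mul_div, div_le_div_iff₀ (by positivity) (by norm_num)]
    have h9 : (d : ℝ) ^ 2 ≤ d ^ 10 := pow_le_pow_right₀ hd1 (by norm_num)
    linarith
  rw [div_le_iff₀ hκ] at hk
  -- From `200 η d² ≤ 100 ≤ κ d` one factor `d` is cancelled.
  have hηd : 200 * (eta d * d) ≤ κ := by
    have h3 : 200 * (eta d * d) * d ≤ κ * d := by nlinarith
    exact le_of_mul_le_mul_right h3 (by linarith)
  have hηκ : 200 * eta d ≤ κ := by nlinarith
  have hκ4 : 4 * κ = 1 - 2 * p := by rw [hκd]; ring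
  refine { nonneg := hp0, le_half := hp, margin_pos := hκ, drift := ?_, power := ?_,
           dim_pos := hd, pow_le := by linarith, far := ?_, near := by linarith }
  · have h3 : p / (1 - eta d) ≤ p + 3 * κ := by
      rw [div_le_iff₀ (by linarith)]
      nlinarith
    linarith
  · have h3 := one_add_mul_le_pow (a := -eta d) (by linarith) (200 * d)
    push_cast at h3
    rw [← sub_eq_add_neg] at h3
    have h4 : 1 - κ ≤ (1 - eta d) ^ (200 * d) := by linarith
    nlinarith
  · have h3 : (d : ℝ) ≤ d ^ 13 := le_self_pow₀ hd1 (by norm_num)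
    nlinarith

end Final

end NoisySearch

theorem mainTheorem4 (p : ℝ) (hp0 : 0 ≤ p) (hp : p < 1 / 2) :
    ∃ (K : ℝ) (d₀ : ℕ), ∀ d : ℕ, d₀ ≤ d →
      ∀ (Ω : Type*) [mΩ : MeasurableSpace Ω] (P : Measure Ω) [IsProbabilityMeasure P]
        (𝓕 : Filtration ℕ mΩ) (q₀ : Eucl d)
        (x : ℕ → Ω → Eucl d) (u : ℕ → Ω → ℝ) (flip : ℕ → Ω → Bool),
        ‖q₀‖ ≤ 1 →
        NoisySearch.IsEnvironment P p 𝓕 x u flip →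
        ∀ T : ℕ,
          Integrable (fun ω => NoisySearch.totalLoss q₀ (fun t => x t ω) (fun t => u t ω)
            (fun t => flip t ω) T) P ∧
          ∫ ω, NoisySearch.totalLoss q₀ (fun t => x t ω) (fun t => u t ω)
            (fun t => flip t ω) T ∂P ≤ K * (d : ℝ) ^ 25 := by
  obtain ⟨d₀, hd₀⟩ := Filter.eventually_atTop.1 (NoisySearch.eventually_largeDim hp0 hp)
  refine ⟨100000 / ((1 - 2 * p) / 4), d₀, fun d hd Ω _ P _ 𝓕 q₀ x u flip hq₀ h T => ?_⟩
  exact h.integrable_totalLoss_and_integral_le (hd₀ d hd) hq₀ T
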